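/- Consider Activated Random Walks on $\mathbb{Z}$ with sleeping rate $\lambda\in[0,\infty)$ and nearest-neighbour jump distribution $p(\cdot)$, that is, $p(z)=0$ unless $|z|=1$. Initially the numbers of particles at the sites are i.i.d. Poisson random variables with mean $\mu\ge 0$, and all particles are active. Active particles jump at rate $1$ with displacement distributed as $p$, and attempt to fall asleep at rate $\lambda$; the attempt succeeds only if the particle is alone at its site. Sleeping particles do not move, and become active as soon as another particle is at the same site. The infinite system is the limit, as $M\to\infty$, of the systems in which only the particles initially in $[-M,M]$ are present. The system fixates if the state of each site (number and type of particles) is eventually constant in time. Let $$\mu_c(\lambda)=\sup\{\mu\ge 0:\ \text{the system with parameters } \lambda,\mu \text{ fixates almost surely}\}\in[0,\infty].$$ Suppose that the jumps are biased: the drift $v=\sum_z z\,p(z)=p(1)-p(-1)$ is not zero. Let $(X_n)_{n\ge0}$ be the discrete-time random walk with $X_0=0$ and increments distributed as $p$, let $$T=\#\{n\ge 0:\ v X_n\le 0\},$$ which is the number of times $n\ge 0$ at which the walk is found on $(-\infty,0]$ if $v>0$, and on $[0,\infty)$ if $v<0$, and let $$F(\lambda)=\mathbb{E}\Big[\Big(\frac{1}{1+\lambda}\Big)^{T}\Big],$$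 where the power is $0$ when $T=\infty$. Then, for every $\lambda<\infty$, $$\mu_c(\lambda)\ \le\ 1-F(\lambda)\ <\ 1,$$ and, for every $\mu>1-F(\lambda)$, the probability that the system fixates is $0$. Moreover, $\lim_{\lambda\downarrow 0}\mu_c(\lambda)=0$. -/

import Mathlib

open MeasureTheory ProbabilityTheory Filter Topology
open scoped NNReal ENNReal

namespace ARW

/-! ### Local states, configurations and the two kinds of transitions -/

/-- State of a site: `num n` means `n` active particles, `rho` means one passive particle. -/
inductive SiteState where
  | num (n : ℕ)
  | rho

namespace SiteState

/-- Number of active particles. -/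
def active : SiteState → ℕ
  | num n => n
  | rho => 0

/-- Arrival of a particle; a passive particle is activated, `ϱ + 1 = 2`. -/
def add : SiteState → SiteState
  | num n => num (n + 1)
  | rho => num 2

/-- Departure of a particle (only applied by the dynamics to `num n` with `n ≥ 1`). -/
def remove : SiteState → SiteState
  | num n => num (n - 1)
  | rho => num 0

/-- Attempt to fall asleep; it is effective only for a particle which is alone. -/
def sleep : SiteState → SiteState
  | num n => if n = 1 then rho else num n
  | rho => rho

end SiteState

/-- A configuration on the lattice `ℤ`. -/
abbrev Config := ℤ → SiteState

/-- An instruction: fall asleep, or jump by the displacement `z`. -/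
inductive Instruction where
  | sleep
  | jump (z : ℤ)

instance : MeasurableSpace Instruction := ⊤

/-- The transition of a configuration when an instruction is executed at `x`. -/
def topple (x : ℤ) : Instruction → Config → Config
  | .sleep, η => Function.update η x (η x).sleep
  | .jump z, η =>
      let η' := Function.update η x (η x).remove
      Function.update η' (x + z) (η' (x + z)).add

/-! ### The randomness -/

/-- Randomness attached to one site: the initial number of particles, and for the `k`-th ring
(`k = 0, 1, …`) of the clock of the site, the instruction executed at that ring together with the
amount of internal time between the preceding ring (or the start) and that ring. -/
abbrev SiteEnv := ℕ × (ℕ → Instruction × ℝ)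

/-- Randomness attached to all sites. -/
abbrev Env := ℤ → SiteEnv

/-- Law of one instruction: sleep with probability `lam / (1 + lam)`, and jump by `z` with
probability `p z / (1 + lam)`. -/
noncomputable def instructionLaw (p : PMF ℤ) (lam : ℝ≥0) : Measure Instruction :=
  (lam / (1 + lam)) • Measure.dirac Instruction.sleep +
    (1 / (1 + lam)) • (p.map Instruction.jump).toMeasure

instance (p : PMF ℤ) (lam : ℝ≥0) : IsProbabilityMeasure (instructionLaw p lam) := by
  refine ⟨?_⟩
  have h : lam / (1 + lam) + 1 / (1 + lam) = 1 := by
    have : (1 : ℝ≥0) + lam ≠ 0 := by positivity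
    field_simp
    ring
  have h' : ((lam / (1 + lam) : ℝ≥0) : ℝ≥0∞) + ((1 / (1 + lam) : ℝ≥0) : ℝ≥0∞) = 1 := by
    exact_mod_cast h
  simpa [instructionLaw, ENNReal.smul_def] using h'

/-- The exponential law of parameter one. -/
noncomputable def expLaw : Measure ℝ := expMeasure 1

instance : IsProbabilityMeasure expLaw := isProbabilityMeasure_expMeasure one_pos

/-- Law of the randomness at one site: a Poisson number of particles of mean `mu`, independent
i.i.d. instructions, and independent i.i.d. exponential gaps (a unit Poisson process). -/
noncomputable def siteLaw (p : PMF ℤ) (lam mu : ℝ≥0) : Measure SiteEnv :=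
  (poissonMeasure mu).prod
    (Measure.infinitePi fun _ : ℕ => (instructionLaw p lam).prod expLaw)

instance (p : PMF ℤ) (lam mu : ℝ≥0) : IsProbabilityMeasure (siteLaw p lam mu) := by
  unfold siteLaw; infer_instance

/-- Law of all the randomness: independent and identically distributed over the sites. -/
noncomputable def law (p : PMF ℤ) (lam mu : ℝ≥0) : Measure Env :=
  Measure.infinitePi fun _ : ℤ => siteLaw p lam mu

/-- The `k`-th instruction at `x`. -/
def instr (ω : Env) (x : ℤ) (k : ℕ) : Instruction := ((ω x).2 k).1

/-- The internal time of `x` that elapses before the `k`-th ring, since the preceding one. -/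
def gap (ω : Env) (x : ℤ) (k : ℕ) : ℝ := ((ω x).2 k).2

/-! ### The continuous-time dynamics started from finitely many particles -/

/-- Everything that has to be remembered right after a ring (or at the start): the configuration,
the number of rings so far at each site, the internal time left before the next ring at each
site, and the present (real) time. -/
structure Snapshot where
  config : Config
  rings : ℤ → ℕ
  left : ℤ → ℝ
  time : ℝ≥0∞

/-- The clock of a site runs at speed `1 + lam` times its number of active particles. -/
noncomputable def speed (lam : ℝ≥0) (η : Config) (x : ℤ) : ℝ := (1 + lam) * (η x).active

/-- Real time until the next ring at `x`, if nothing happens elsewhere (for `x` unstable). -/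
noncomputable def wait (lam : ℝ≥0) (s : Snapshot) (x : ℤ) : ℝ := s.left x / speed lam s.config x

/-- `x` is the unstable site whose clock rings next (the leftmost one in case of a tie, which has
probability zero). -/
def RingsNext (lam : ℝ≥0) (s : Snapshot) (x : ℤ) : Prop :=
  0 < (s.config x).active ∧ ∀ y, 0 < (s.config y).active →
    wait lam s x < wait lam s y ∨ (wait lam s x = wait lam s y ∧ x ≤ y)

open Classical in
/-- Passage to the next ring. If no site is unstable, there is no further ring: the time of the
next one is `∞`. -/
noncomputable def step (lam : ℝ≥0) (ω : Env) (s : Snapshot) : Snapshot :=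
  if h : ∃ x, RingsNext lam s x then
    let x := h.choose
    let δ := wait lam s x
    { config := topple x (instr ω x (s.rings x)) s.config
      rings := Function.update s.rings x (s.rings x + 1)
      left := Function.update (fun y => s.left y - speed lam s.config y * δ) x
        (gap ω x (s.rings x + 1))
      time := s.time + ENNReal.ofReal δ }
  else { s with time := ⊤ }

/-- The start: only the particles initially in `[-M, M]` are present, all of them active. -/
noncomputable def start (ω : Env) (M : ℕ) : Snapshot where
  config := fun x => if |x| ≤ (M : ℤ) then .num (ω x).1 else .num 0
  rings := fun _ => 0
  left := fun x => gap ω x 0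
  time := 0

/-- The situation after `n` rings. -/
noncomputable def snapshot (lam : ℝ≥0) (ω : Env) (M n : ℕ) : Snapshot :=
  (step lam ω)^[n] (start ω M)

/-- The configuration at time `t` of the dynamics on `ℤ` started with the particles initially in
`[-M, M]`: the one right after the last ring up to time `t`. -/
noncomputable def finiteConfig (lam : ℝ≥0) (ω : Env) (M : ℕ) (t : ℝ≥0) : Config :=
  (snapshot lam ω M (sInf {n | (t : ℝ≥0∞) < (snapshot lam ω M (n + 1)).time})).config

/-! ### The infinite system, fixation and the critical density -/

/-- The state of site `x` at time `t` in the infinite system is `c`: the infinite system is the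
limit, as `M → ∞`, of the systems started with the particles initially in `[-M, M]`. -/
def HasState (lam : ℝ≥0) (ω : Env) (t : ℝ≥0) (x : ℤ) (c : SiteState) : Prop :=
  ∀ᶠ M : ℕ in atTop, finiteConfig lam ω M t x = c

/-- Local fixation: the state of each site is eventually constant in time. -/
def Fixates (lam : ℝ≥0) (ω : Env) : Prop :=
  ∀ x : ℤ, ∃ c : SiteState, ∀ᶠ t : ℝ≥0 in atTop, HasState lam ω t x c

/-- The critical density: the supremum of the densities at which the system fixates almost
surely. -/
noncomputable def criticalDensity (p : PMF ℤ) (lam : ℝ≥0) : ℝ≥0∞ :=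
  ⨆ (mu : ℝ≥0) (_ : ∀ᵐ ω ∂(law p lam mu), Fixates lam ω), (mu : ℝ≥0∞)

/-! ### The underlying random walk -/

/-- Jumps are to nearest neighbours. -/
def NearestNeighbour (p : PMF ℤ) : Prop := ∀ z : ℤ, |z| ≠ 1 → p z = 0

/-- Mean displacement of one jump. The jumps are biased when it is not zero. -/
noncomputable def drift (p : PMF ℤ) : ℝ := ∑' z : ℤ, (p z).toReal * z

/-- Position after `n` steps of the discrete-time walk from the origin with increments `ξ`. -/
def walk (ξ : ℕ → ℤ) (n : ℕ) : ℤ := ∑ i ∈ Finset.range n, ξ i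

/-- Total number of times `n = 0, 1, 2, …` at which the walk is found on the half-line opposite to
the drift: `(-∞, 0]` if the drift is positive, `[0, ∞)` if it is negative. -/
noncomputable def timeSpent (p : PMF ℤ) (ξ : ℕ → ℤ) : ℕ∞ :=
  {n : ℕ | drift p * (walk ξ n : ℝ) ≤ 0}.encard

open Classical in
/-- `F = E[(1 / (1 + lam)) ^ T]`, with the power read as `0` when `T = ∞`. -/
noncomputable def F (p : PMF ℤ) (lam : ℝ≥0) : ℝ :=
  ∫ ξ, (if timeSpent p ξ = ⊤ then 0 else (1 / (1 + (lam : ℝ))) ^ (timeSpent p ξ).toNat)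
    ∂(Measure.infinitePi fun _ : ℕ => p.toMeasure)

end ARW

/-! The proof splits into a deterministic and a probabilistic half, joined by the property
`Unstable`: legal topplings starting from finitely many particles can topple the origin arbitrarily
often.

Deterministic half (`Regular.not_fixates`). Each site owns a stack of instructions, and a site that
is active in a smaller system is still active in a larger one in which its own odometer is the same
and the other odometers are at least as large (`Legal.active_mono`). Hence every legal odometer is
exceeded by the dynamics at a time that does not depend on the size `M` of the system
(`Regular.exists_time_ge`). A Grönwall bound on the internal clocks, also uniform in `M`, allows the
passage to the limit. Suppose the system fixates. If the eventual state of the origin has no active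
particle, its internal clock stops in the limit, so its odometer is bounded, contradicting
`Unstable`. The definition of fixation also allows a constant positive number of active particles.
The clock of the origin then runs at constant speed, and each jump from the origin must be
compensated at the very same instant by an arrival from a neighbour. Among three such coincidences
two involve the same neighbour, which yields a linear relation between independent exponential gaps;
almost surely there is none (`LimitRings.false`, `ae_generic`).

Probabilistic half (`ae_unstable`). After a reflection the drift points to the right. In the box
`[0, n]`, sites with two or more particles are first toppled until none is left. The sites are then
swept from left to right: the particle found at `i` is carried until it leaves the box, fills a hole
to the right of `i`, or meets a sleep instruction at a position `≤ i`, which is a failure. To the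
right of `i` the carried particle always has company, so sleep instructions have no effect there.
Carrying thus fails with probability at most `h 0 = 1 - E[(1 / (1 + lam)) ^ T]`, because at each
visit to the left half-line the next instruction is a jump with probability `1 / (1 + lam)`. There
are at most `n + 1` carries, so about `(n + 1) * h 0` failures at most, against about `(n + 1) * mu`
particles. The surplus leaves the box, only boundedly many particles in mean leave it on the left,
and so site `n` is toppled a number of times linear in `n` (`tendsto_law_sweep_lt`). Placing `n` at
the origin by translation gives `Unstable`.

Supermartingales replace exact stochastic comparisons (`lintegral_sweep_le`, `failPotential_step`).
Finally `T` is almost surely finite by the strong law, which gives `0 < F`, and `F` tends to `1` as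
`lam` tends to `0` by dominated convergence. -/

namespace ARW

/-! ### Particle counts, legal sequences of topplings and the mass balance -/

/-- Number of particles, active or not. -/
def SiteState.count : SiteState → ℕ
  | .num n => n
  | .rho => 1

@[simp] lemma SiteState.count_num (n : ℕ) : (SiteState.num n).count = n := rfl
@[simp] lemma SiteState.count_rho : SiteState.rho.count = 1 := rfl
@[simp] lemma SiteState.active_num (n : ℕ) : (SiteState.num n).active = n := rfl
@[simp] lemma SiteState.active_rho : SiteState.rho.active = 0 := rfl

@[simp] lemma SiteState.count_sleep (s : SiteState) : s.sleep.count = s.count := by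
  cases s with
  | num n => by_cases h : n = 1 <;> simp [SiteState.sleep, h]
  | rho => rfl

@[simp] lemma SiteState.count_add (s : SiteState) : s.add.count = s.count + 1 := by
  cases s <;> simp [SiteState.add]

@[simp] lemma SiteState.count_remove (s : SiteState) : s.remove.count = s.count - 1 := by
  cases s <;> simp [SiteState.remove]

lemma SiteState.active_le_count (s : SiteState) : s.active ≤ s.count := by
  cases s <;> simp

lemma SiteState.count_pos_of_active {s : SiteState} (h : 0 < s.active) : 0 < s.count :=
  h.trans_le s.active_le_count

/-- All instructions are to sleep or to jump to a nearest neighbour. -/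
def NNInstr (ω : Env) : Prop :=
  ∀ x k, instr ω x k = .sleep ∨ instr ω x k = .jump 1 ∨ instr ω x k = .jump (-1)

open Classical in
/-- Number of jumps by `z` among the first `k` instructions at `x`. -/
noncomputable def sent (ω : Env) (x z : ℤ) (k : ℕ) : ℕ :=
  ((Finset.range k).filter fun j => instr ω x j = .jump z).card

@[simp] lemma sent_zero (ω : Env) (x z : ℤ) : sent ω x z 0 = 0 := by simp [sent]

open Classical in
lemma sent_succ (ω : Env) (x z : ℤ) (k : ℕ) :
    sent ω x z (k + 1) = sent ω x z k + if instr ω x k = .jump z then 1 else 0 := by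
  simp only [sent, Finset.range_add_one, Finset.filter_insert]
  split_ifs with h <;> simp

lemma sent_mono (ω : Env) (x z : ℤ) : Monotone (sent ω x z) := by
  classical
  exact monotone_nat_of_le_succ fun k => by rw [sent_succ]; omega

lemma sent_le (ω : Env) (x z : ℤ) (k : ℕ) : sent ω x z k ≤ k := by
  classical
  unfold sent
  exact (Finset.card_filter_le _ _).trans (by simp)

/-- Configurations and odometers that can be reached by toppling active sites. -/
inductive Legal (ω : Env) (η₀ : Config) : Config → (ℤ → ℕ) → Prop
  | refl : Legal ω η₀ η₀ 0
  | step {η : Config} {k : ℤ → ℕ} (x : ℤ) : Legal ω η₀ η k → 0 < (η x).active →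
      Legal ω η₀ (topple x (instr ω x (k x)) η) (Function.update k x (k x + 1))

lemma count_topple_jump {η : Config} {x y z : ℤ} (hz : z ≠ 0) :
    (topple x (.jump z) η y).count =
      if y = x then (η x).count - 1 else if y = x + z then (η y).count + 1 else (η y).count := by
  have h : x + z ≠ x := by omega
  by_cases hy : y = x
  · subst hy
    simp [topple, Function.update_of_ne h.symm]
  · by_cases hy' : y = x + z
    · subst hy'
      simp [topple, hy]
    · simp [topple, hy, hy']

lemma count_topple_sleep {η : Config} {x y : ℤ} :
    (topple x .sleep η y).count = (η y).count := by
  by_cases hy : y = x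
  · subst hy; simp [topple]
  · simp [topple, hy]

/-- Mass balance at each site along a legal sequence. -/
lemma Legal.balance {ω : Env} (hω : NNInstr ω) {η₀ η : Config} {k : ℤ → ℕ}
    (h : Legal ω η₀ η k) (x : ℤ) :
    (η x).count + sent ω x 1 (k x) + sent ω x (-1) (k x) =
      (η₀ x).count + sent ω (x - 1) 1 (k (x - 1)) + sent ω (x + 1) (-1) (k (x + 1)) := by
  classical
  induction h generalizing x with
  | refl => simp
  | @step η k y h hy ih =>
    have hx := ih x
    have hpos := SiteState.count_pos_of_active hy
    have hs : ∀ w z, sent ω w z (Function.update k y (k y + 1) w) = sent ω w z (k w) +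
        if w = y ∧ instr ω y (k y) = .jump z then 1 else 0 := by
      intro w z
      by_cases hw : w = y
      · subst hw; simp [sent_succ]
      · simp [hw]
    simp only [hs]
    rcases hω y (k y) with hi | hi | hi <;> rw [hi]
    · simp only [count_topple_sleep]; simpa using hx
    · rw [count_topple_jump (by norm_num)]
      have e1 : (Instruction.jump 1 = Instruction.jump (-1)) = False := by simp
      have e2 : (x - 1 = y) ↔ x = y + 1 := by omega
      simp only [e1, and_true, and_false, if_false, e2]
      by_cases hxy : x = y
      · subst hxy; simp; omega
      · by_cases hxy' : x = y + 1 <;> simp [hxy, hxy'] at * <;> omega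
    · rw [count_topple_jump (by norm_num)]
      have e1 : (Instruction.jump (-1) = Instruction.jump 1) = False := by simp
      have e2 : (x + 1 = y) ↔ x = y + -1 := by omega
      simp only [e1, and_true, and_false, if_false, e2]
      by_cases hxy : x = y
      · subst hxy; simp; omega
      · by_cases hxy' : x = y + -1 <;> simp [hxy, hxy'] at * <;> omega

/-- No passive particle. -/
def AllActive (η : Config) : Prop := ∀ x, η x ≠ .rho

/-- A site is passive only right after a sleep instruction, and after a sleep instruction it is
neither empty nor occupied by one active particle. -/
lemma Legal.sleep_spec {ω : Env} {η₀ η : Config} {k : ℤ → ℕ}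
    (h : Legal ω η₀ η k) (h₀ : AllActive η₀) (x : ℤ) :
    (η x = .rho → ∃ j, k x = j + 1 ∧ instr ω x j = .sleep) ∧
    (∀ j, k x = j + 1 → instr ω x j = .sleep → η x ≠ .num 0 ∧ η x ≠ .num 1) := by
  induction h generalizing x with
  | refl => exact ⟨fun h => absurd h (h₀ x), fun j hj => by simp at hj⟩
  | @step η k y h hy ih =>
    by_cases hxy : x = y
    · subst hxy
      obtain ⟨n, hn⟩ : ∃ n, η x = .num n := by
        cases hη : η x with
        | num n => exact ⟨n, rfl⟩
        | rho => simp [hη] at hy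
      have hn0 : 0 < n := by simpa [hn] using hy
      cases hi : instr ω x (k x) with
      | sleep =>
        refine ⟨fun _ => ⟨k x, by simp, hi⟩, fun j hj hj' => ?_⟩
        by_cases h1 : n = 1
        · simp [topple, hn, SiteState.sleep, h1]
        · simp only [topple, hn, SiteState.sleep, h1]
          simp [h1]; omega
      | jump z =>
        refine ⟨fun hr => ?_, fun j hj hj' => ?_⟩
        · by_cases hz : z = 0
          · subst hz; simp [topple, hn, SiteState.remove, SiteState.add] at hr
          · simp [topple, hn, SiteState.remove, hz] at hr
        · have : j = k x := by simpa using hj.symm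
          subst this; simp [hi] at hj'
    · have hk : Function.update k y (k y + 1) x = k x := by simp [hxy]
      rw [hk]
      have key : topple y (instr ω y (k y)) η x = η x ∨
          topple y (instr ω y (k y)) η x = (η x).add := by
        cases instr ω y (k y) with
        | sleep => left; simp [topple, hxy]
        | jump z =>
          by_cases hz : x = y + z
          · right; subst hz; simp [topple, hxy]
          · left; simp [topple, hxy, hz]
      rcases key with e | e
      · rw [e]; exact ih x
      · rw [e]
        refine ⟨fun hr => ?_, fun j hj hj' => ?_⟩
        · cases hη : η x <;> simp [hη, SiteState.add] at hr
        · have := (ih x).2 j hj hj'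
          cases hη : η x <;> simp [hη, SiteState.add] at this ⊢
          omega

/-- Monotonicity of instability: more particles, and more topplings elsewhere. -/
lemma Legal.active_mono {ω : Env} (hω : NNInstr ω) {η₀ η₀' η η' : Config} {k k' : ℤ → ℕ}
    (h : Legal ω η₀ η k) (h' : Legal ω η₀' η' k') (h₀ : AllActive η₀) (h₀' : AllActive η₀')
    (hle : ∀ x, (η₀ x).count ≤ (η₀' x).count) (hk : ∀ x, k x ≤ k' x) {x : ℤ}
    (hx : k x = k' x) (ha : 0 < (η x).active) : 0 < (η' x).active := by
  have b := h.balance hω x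
  have b' := h'.balance hω x
  have m1 := sent_mono ω (x - 1) 1 (hk (x - 1))
  have m2 := sent_mono ω (x + 1) (-1) (hk (x + 1))
  have m3 := hle x
  rw [hx] at b
  have hc : (η x).count ≤ (η' x).count := by omega
  have hp := SiteState.count_pos_of_active ha
  cases hη' : η' x with
  | num m => rw [hη'] at hc; simp at hc ⊢; omega
  | rho =>
    -- The last instruction used at `x` was a sleep, and it is the same one in both systems since
    -- the odometers at `x` agree. In the smaller system `x` is therefore not in the state `num 1`
    -- after it, while its count is positive and at most one.
    obtain ⟨j, hj, hj'⟩ := (h'.sleep_spec h₀' x).1 hη'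
    have := (h.sleep_spec h₀ x).2 j (hx.trans hj) hj'
    rw [hη'] at hc
    cases hη : η x with
    | num m =>
      rw [hη] at hc hp this; simp at hc hp this
      omega
    | rho => simp [hη] at ha

/-- The number of active particles is at most the initial number plus the number of topplings
at the neighbours. -/
lemma Legal.active_le {ω : Env} (hω : NNInstr ω) {η₀ η : Config} {k : ℤ → ℕ}
    (h : Legal ω η₀ η k) (x : ℤ) :
    (η x).active ≤ (η₀ x).count + k (x - 1) + k (x + 1) := by
  have b := h.balance hω x
  have m1 := sent_le ω (x - 1) 1 (k (x - 1))
  have m2 := sent_le ω (x + 1) (-1) (k (x + 1))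
  have := (η x).active_le_count
  omega

/-- The number of particles in a finite set never exceeds a bound for the initial number of
particles in every finite set. -/
lemma Legal.sum_count_le {ω : Env} (hω : NNInstr ω) {η₀ η : Config} {k : ℤ → ℕ}
    (h : Legal ω η₀ η k) {N : ℕ} (hN : ∀ A : Finset ℤ, ∑ x ∈ A, (η₀ x).count ≤ N)
    (A : Finset ℤ) : ∑ x ∈ A, (η x).count ≤ N := by
  classical
  induction h generalizing A with
  | refl => exact hN A
  | @step η k y h hy ih =>
    have hpos := SiteState.count_pos_of_active hy
    -- The set is enlarged to contain both ends of the jump, so that the jump does not change the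
    -- sum; this is why the induction runs over all finite sets at once.
    have key : ∀ z : ℤ, z ≠ 0 → ∑ x ∈ A, (topple y (.jump z) η x).count ≤ N := by
      intro z hz
      have hz' : y + z ≠ y := by omega
      have hz'' : y ∉ (insert (y + z) A).erase y := by simp
      have hmem : y + z ∈ (insert (y + z) A).erase y := by simp [hz]
      calc ∑ x ∈ A, (topple y (.jump z) η x).count
          ≤ ∑ x ∈ insert y ((insert (y + z) A).erase y), (topple y (.jump z) η x).count := by
            refine Finset.sum_le_sum_of_subset fun w hw => ?_
            simp only [Finset.mem_insert, Finset.mem_erase]; tauto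
        _ = ∑ x ∈ insert y ((insert (y + z) A).erase y), (η x).count := by
            rw [Finset.sum_insert hz'', Finset.sum_insert hz'',
              ← Finset.add_sum_erase _ _ hmem, ← Finset.add_sum_erase _ _ hmem]
            have : ∀ x ∈ ((insert (y + z) A).erase y).erase (y + z),
                (topple y (.jump z) η x).count = (η x).count := by
              intro x hx
              simp only [Finset.mem_erase, Finset.mem_insert] at hx
              rw [count_topple_jump hz, if_neg hx.2.1, if_neg hx.1]
            rw [Finset.sum_congr rfl this, count_topple_jump hz, count_topple_jump hz]
            simp [hz]; omega
        _ ≤ N := ih _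
    rcases hω y (k y) with hi | hi | hi <;> rw [hi]
    · simpa only [count_topple_sleep] using ih A
    · exact key 1 (by norm_num)
    · exact key (-1) (by norm_num)

end ARW

namespace ARW

/-! ### The embedded chain of the continuous-time dynamics -/

/-- Internal time of `x` at which `k` rings are completed. -/
noncomputable def clock (ω : Env) (x : ℤ) (k : ℕ) : ℝ := ∑ j ∈ Finset.range k, gap ω x j

@[simp] lemma clock_zero (ω : Env) (x : ℤ) : clock ω x 0 = 0 := by simp [clock]

lemma clock_succ (ω : Env) (x : ℤ) (k : ℕ) : clock ω x (k + 1) = clock ω x k + gap ω x k := by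
  simp [clock, Finset.sum_range_succ]

lemma clock_strictMono {ω : Env} (hg : ∀ x k, 0 < gap ω x k) (x : ℤ) :
    StrictMono (clock ω x) :=
  strictMono_nat_of_lt_succ fun k => by rw [clock_succ]; linarith [hg x k]

/-- Internal time of `x` elapsed at a snapshot. -/
noncomputable def elapsed (ω : Env) (s : Snapshot) (x : ℤ) : ℝ :=
  clock ω x (s.rings x + 1) - s.left x

lemma speed_nonneg (lam : ℝ≥0) (η : Config) (x : ℤ) : 0 ≤ speed lam η x := by
  unfold speed; positivity

lemma speed_pos {lam : ℝ≥0} {η : Config} {x : ℤ} (h : 0 < (η x).active) : 0 < speed lam η x := by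
  unfold speed; positivity

lemma speed_eq_zero {lam : ℝ≥0} {η : Config} {x : ℤ} (h : ¬ 0 < (η x).active) :
    speed lam η x = 0 := by
  have : (η x).active = 0 := by omega
  simp [speed, this]

lemma exists_ringsNext {lam : ℝ≥0} {s : Snapshot} (hfin : {x | 0 < (s.config x).active}.Finite)
    (hne : ∃ x, 0 < (s.config x).active) : ∃ x, RingsNext lam s x := by
  -- The lexicographic order on waiting time and position encodes the tie-breaking rule.
  obtain ⟨x, hx, hmin⟩ := Set.exists_min_image _ (fun x => toLex (wait lam s x, x)) hfin hne
  refine ⟨x, hx, fun y hy => ?_⟩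
  have := hmin y hy
  rw [Prod.Lex.le_iff] at this
  simpa using this

lemma Legal.finite_support {ω : Env} {η₀ η : Config} {k : ℤ → ℕ} (h : Legal ω η₀ η k)
    (h₀ : {x | η₀ x ≠ .num 0}.Finite) : {x | η x ≠ .num 0}.Finite := by
  induction h with
  | refl => exact h₀
  | @step η k y h hy ih =>
    cases hi : instr ω y (k y) with
    | sleep =>
      refine (ih.insert y).subset fun w hw => ?_
      by_cases hwy : w = y
      · exact Or.inl hwy
      · right; simpa [topple, hwy] using hw
    | jump z =>
      refine ((ih.insert y).insert (y + z)).subset fun w hw => ?_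
      by_cases hwy : w = y
      · exact Or.inr (Or.inl hwy)
      · by_cases hwz : w = y + z
        · exact Or.inl hwz
        · right; right; simpa [topple, hwy, hwz] using hw

lemma Legal.finite_active {ω : Env} {η₀ η : Config} {k : ℤ → ℕ} (h : Legal ω η₀ η k)
    (h₀ : {x | η₀ x ≠ .num 0}.Finite) : {x | 0 < (η x).active}.Finite :=
  (h.finite_support h₀).subset fun x hx he => by
    rw [Set.mem_ofPred_eq, he] at hx; simp at hx

/-- The invariants of the embedded chain. -/
structure SnapshotInv (ω : Env) (M : ℕ) (s : Snapshot) : Prop where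
  legal : Legal ω (start ω M).config s.config s.rings
  left_nonneg : ∀ x, 0 ≤ s.left x
  -- A tie leaves an active site with remaining time zero, so strict positivity is kept only for
  -- sites without active particles.
  left_pos : ∀ x, (s.config x).active = 0 → 0 < s.left x
  left_le : ∀ x, s.left x ≤ gap ω x (s.rings x)

lemma start_support (ω : Env) (M : ℕ) : {x | (start ω M).config x ≠ .num 0}.Finite := by
  refine (Set.finite_Icc (-(M : ℤ)) M).subset fun x hx => ?_
  by_contra hx'
  apply hx
  have : ¬ |x| ≤ (M : ℤ) := fun h => hx' (by simpa [abs_le] using h)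
  simp [start, this]

lemma start_allActive (ω : Env) (M : ℕ) : AllActive (start ω M).config := by
  intro x
  simp only [start]
  split_ifs <;> simp

lemma active_topple_ge {η : Config} {x y : ℤ} (h : y ≠ x) (i : Instruction) :
    (η y).active ≤ (topple x i η y).active := by
  cases i with
  | sleep => simp [topple, h]
  | jump z =>
    by_cases hz : y = x + z
    · subst hz
      simp only [topple, Function.update_self, ne_eq, h, not_false_eq_true,
        Function.update_of_ne]
      cases η (x + z) <;> simp [SiteState.add]
    · simp [topple, h, hz]

lemma SnapshotInv.finite_active {ω : Env} {M : ℕ} {s : Snapshot} (h : SnapshotInv ω M s) :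
    {x | 0 < (s.config x).active}.Finite :=
  h.legal.finite_active (start_support ω M)

lemma wait_nonneg {lam : ℝ≥0} {ω : Env} {M : ℕ} {s : Snapshot} (h : SnapshotInv ω M s) (x : ℤ) :
    0 ≤ wait lam s x := div_nonneg (h.left_nonneg x) (speed_nonneg _ _ _)

/-- The ringing site minimises the waiting time, so no other clock runs past its own next ring. -/
lemma speed_mul_wait_le {lam : ℝ≥0} {ω : Env} {M : ℕ} {s : Snapshot} (h : SnapshotInv ω M s)
    {x : ℤ} (hx : RingsNext lam s x) (y : ℤ) :
    speed lam s.config y * wait lam s x ≤ s.left y := by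
  by_cases hy : 0 < (s.config y).active
  · have h1 : wait lam s x ≤ wait lam s y := by
      rcases hx.2 y hy with h | h
      · exact h.le
      · exact h.1.le
    have hs := speed_pos (lam := lam) hy
    calc speed lam s.config y * wait lam s x ≤ speed lam s.config y * wait lam s y := by gcongr
      _ = s.left y := by unfold wait; field_simp
  · rw [speed_eq_zero hy]; simpa using h.left_nonneg y

lemma step_of_ringsNext (lam : ℝ≥0) (ω : Env) {s : Snapshot} (h : ∃ x, RingsNext lam s x) :
    ∃ x, RingsNext lam s x ∧ step lam ω s =
      { config := topple x (instr ω x (s.rings x)) s.config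
        rings := Function.update s.rings x (s.rings x + 1)
        left := Function.update (fun y => s.left y - speed lam s.config y * wait lam s x) x
          (gap ω x (s.rings x + 1))
        time := s.time + ENNReal.ofReal (wait lam s x) } :=
  ⟨h.choose, h.choose_spec, by unfold step; rw [dif_pos h]⟩

lemma step_of_not_ringsNext (lam : ℝ≥0) (ω : Env) {s : Snapshot} (h : ¬ ∃ x, RingsNext lam s x) :
    step lam ω s = { s with time := ⊤ } := by
  unfold step; rw [dif_neg h]

lemma SnapshotInv.step {lam : ℝ≥0} {ω : Env} (hg : ∀ x k, 0 < gap ω x k) {M : ℕ} {s : Snapshot}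
    (h : SnapshotInv ω M s) : SnapshotInv ω M (step lam ω s) := by
  by_cases hr : ∃ x, RingsNext lam s x
  · obtain ⟨x, hx, e⟩ := step_of_ringsNext lam ω hr
    rw [e]
    refine ⟨h.legal.step x hx.1, fun y => ?_, fun y hy => ?_, fun y => ?_⟩
    · by_cases hy : y = x
      · subst hy; simpa using (hg _ _).le
      · simpa [hy] using speed_mul_wait_le h hx y
    · by_cases hyx : y = x
      · subst hyx; simpa using hg _ _
      · have h1 := active_topple_ge (η := s.config) hyx (instr ω x (s.rings x))
        have h2 : (s.config y).active = 0 := by simp only at hy; omega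
        have h3 := h.left_pos y h2
        have h4 : speed lam s.config y = 0 := speed_eq_zero (by omega)
        simpa [hyx, h4] using h3
    · by_cases hyx : y = x
      · subst hyx; simp
      · have := h.left_le y
        have h2 := mul_nonneg (speed_nonneg lam s.config y) (wait_nonneg (lam := lam) h x)
        simp [hyx]; linarith
  · rw [step_of_not_ringsNext lam ω hr]
    exact ⟨h.legal, h.left_nonneg, h.left_pos, h.left_le⟩

lemma snapshot_succ (lam : ℝ≥0) (ω : Env) (M n : ℕ) :
    snapshot lam ω M (n + 1) = step lam ω (snapshot lam ω M n) := by
  simp [snapshot, Function.iterate_succ_apply']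

lemma snapshot_zero (lam : ℝ≥0) (ω : Env) (M : ℕ) : snapshot lam ω M 0 = start ω M := rfl

lemma snapshotInv (lam : ℝ≥0) {ω : Env} (hg : ∀ x k, 0 < gap ω x k) (M n : ℕ) :
    SnapshotInv ω M (snapshot lam ω M n) := by
  induction n with
  | zero =>
    refine ⟨.refl, fun x => (hg x 0).le, fun x _ => hg x 0, fun x => le_rfl⟩
  | succ n ih => rw [snapshot_succ]; exact ih.step hg

lemma time_mono (lam : ℝ≥0) (ω : Env) (M : ℕ) :
    Monotone fun n => (snapshot lam ω M n).time := by
  refine monotone_nat_of_le_succ fun n => ?_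
  rw [snapshot_succ]
  by_cases hr : ∃ x, RingsNext lam (snapshot lam ω M n) x
  · obtain ⟨x, hx, e⟩ := step_of_ringsNext lam ω hr
    rw [e]; exact le_self_add
  · rw [step_of_not_ringsNext lam ω hr]; exact le_top

/-- As long as the next ring happens at a finite time, the elapsed internal times grow
linearly. -/
lemma elapsed_succ {lam : ℝ≥0} {ω : Env} (hg : ∀ x k, 0 < gap ω x k) {M n : ℕ}
    (ht : (snapshot lam ω M (n + 1)).time ≠ ⊤) :
    ∃ y, RingsNext lam (snapshot lam ω M n) y ∧
      (snapshot lam ω M n).time ≠ ⊤ ∧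
      (snapshot lam ω M (n + 1)).time.toReal =
        (snapshot lam ω M n).time.toReal + wait lam (snapshot lam ω M n) y ∧
      (snapshot lam ω M (n + 1)).rings = Function.update (snapshot lam ω M n).rings y
        ((snapshot lam ω M n).rings y + 1) ∧
      (∀ x, speed lam (snapshot lam ω M n).config x * wait lam (snapshot lam ω M n) y ≤
        (snapshot lam ω M n).left x) ∧
      ∀ x, elapsed ω (snapshot lam ω M (n + 1)) x = elapsed ω (snapshot lam ω M n) x +
        speed lam (snapshot lam ω M n).config x * wait lam (snapshot lam ω M n) y := by
  rw [snapshot_succ] at ht ⊢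
  set s := snapshot lam ω M n with hs
  have hinv : SnapshotInv ω M s := snapshotInv lam hg M n
  by_cases hr : ∃ x, RingsNext lam s x
  · obtain ⟨x, hx, e⟩ := step_of_ringsNext lam ω hr
    rw [e] at ht ⊢
    simp only [ne_eq, ENNReal.add_eq_top, ENNReal.ofReal_ne_top, or_false] at ht
    refine ⟨x, hx, ht, ?_, rfl, speed_mul_wait_le hinv hx, fun y => ?_⟩
    · simp only
      rw [ENNReal.toReal_add ht (by simp), ENNReal.toReal_ofReal (wait_nonneg hinv x)]
    · by_cases hy : y = x
      · subst hy
        have hsp := speed_pos (lam := lam) hx.1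
        have : speed lam s.config y * wait lam s y = s.left y := by unfold wait; field_simp
        simp [elapsed, clock_succ, this]
      · simp [elapsed, hy]; ring
  · rw [step_of_not_ringsNext lam ω hr] at ht; simp at ht

lemma elapsed_zero (lam : ℝ≥0) (ω : Env) (M : ℕ) (x : ℤ) :
    elapsed ω (snapshot lam ω M 0) x = 0 := by
  simp [elapsed, snapshot_zero, start, clock_succ]

lemma clock_le_elapsed {ω : Env} {M : ℕ} {s : Snapshot} (h : SnapshotInv ω M s) (x : ℤ) :
    clock ω x (s.rings x) ≤ elapsed ω s x := by
  have := h.left_le x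
  rw [elapsed, clock_succ]; linarith

/-! ### Bounds for regular environments -/

/-- Environments in which the dynamics is well behaved. -/
structure Regular (ω : Env) (K : ℝ) : Prop where
  nn : NNInstr ω
  gap_pos : ∀ x k, 0 < gap ω x k
  count_le : ∀ x, ((ω x).1 : ℝ) ≤ K * 2 ^ x.natAbs
  -- The factor 4 makes `exp (k - 4 * clock)` summable in mean, since `e / 5 < 1` (see
  -- `lintegral_excess`). The weight `2 ^ |x|` makes sums over sites converge and at most doubles
  -- from a site to its neighbour.
  rings_le : ∀ x (k : ℕ), (k : ℝ) ≤ 4 * clock ω x k + K * 2 ^ x.natAbs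
  long_gaps : ∀ ε : ℤ, ε = 1 ∨ ε = -1 → ∃ᶠ j : ℕ in atTop, 1 ≤ gap ω (ε * j) 0

lemma Regular.nonneg {ω : Env} {K : ℝ} (h : Regular ω K) : 0 ≤ K := by
  have := h.count_le 0
  have h0 : (0 : ℝ) ≤ ((ω 0).1 : ℝ) := by positivity
  simp at this; linarith

lemma count_start_le (ω : Env) (M : ℕ) (x : ℤ) : ((start ω M).config x).count ≤ (ω x).1 := by
  simp only [start]; split_ifs <;> simp

lemma two_pow_natAbs_le {x y : ℤ} (h : y = x - 1 ∨ y = x + 1) :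
    (2 : ℝ) ^ y.natAbs ≤ 2 * 2 ^ x.natAbs := by
  rw [← pow_succ']
  exact pow_le_pow_right₀ (by norm_num) (by omega)

/-- Exponential a priori bound on the internal times, uniform in the size of the system. -/
noncomputable def timeBound (lam : ℝ≥0) (K : ℝ) (x : ℤ) (t : ℝ) : ℝ :=
  K * 2 ^ x.natAbs * Real.exp (21 * (1 + lam) * t)

lemma elapsed_nonneg {lam : ℝ≥0} {ω : Env} (hg : ∀ x k, 0 < gap ω x k) (M n : ℕ) (x : ℤ) :
    0 ≤ elapsed ω (snapshot lam ω M n) x := by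
  refine le_trans ?_ (clock_le_elapsed (snapshotInv lam hg M n) x)
  exact Finset.sum_nonneg fun j _ => (hg x j).le

/-- Active particles come from the initial ones or from rings of the two neighbours. A neighbour has
rung at most `4 * 2 + 2 = 10` times the bound at `x`, where each 2 is the cost of moving the weight
by one site; hence `21 = 1 + 2 * 10`. -/
lemma Regular.speed_le {lam : ℝ≥0} {ω : Env} {K : ℝ} (h : Regular ω K) {M n : ℕ} {t : ℝ}
    (ht : 0 ≤ t) (hb : ∀ x, elapsed ω (snapshot lam ω M n) x ≤ timeBound lam K x t) (x : ℤ) :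
    speed lam (snapshot lam ω M n).config x ≤ 21 * (1 + lam) * timeBound lam K x t := by
  have hinv := snapshotInv lam h.gap_pos M n
  have h1 := hinv.legal.active_le h.nn x
  have h2 : ((((snapshot lam ω M n).config x).active : ℕ) : ℝ) ≤
      ((ω x).1 : ℝ) + (snapshot lam ω M n).rings (x - 1) + (snapshot lam ω M n).rings (x + 1) := by
    exact_mod_cast h1.trans (by gcongr; exact count_start_le ω M x)
  have hK := h.nonneg
  have hE : 1 ≤ Real.exp (21 * (1 + lam) * t) := Real.one_le_exp (by positivity)
  have hr : ∀ y, y = x - 1 ∨ y = x + 1 → (((snapshot lam ω M n).rings y : ℕ) : ℝ) ≤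
      10 * timeBound lam K x t := by
    intro y hy
    have e1 := h.rings_le y ((snapshot lam ω M n).rings y)
    have e2 := (clock_le_elapsed hinv y).trans (hb y)
    have e3 := two_pow_natAbs_le hy
    have e4 : K * 2 ^ y.natAbs ≤ 2 * (K * 2 ^ x.natAbs) := by nlinarith
    have e5 : timeBound lam K y t ≤ 2 * timeBound lam K x t := by
      unfold timeBound; nlinarith
    have e6 : K * 2 ^ x.natAbs ≤ timeBound lam K x t := by
      unfold timeBound; exact le_mul_of_one_le_right (by positivity) hE
    linarith
  have e7 : ((ω x).1 : ℝ) ≤ timeBound lam K x t := by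
    refine (h.count_le x).trans ?_
    unfold timeBound; exact le_mul_of_one_le_right (by positivity) hE
  have e8 := hr (x - 1) (Or.inl rfl)
  have e9 := hr (x + 1) (Or.inr rfl)
  unfold speed
  have : ((((snapshot lam ω M n).config x).active : ℕ) : ℝ) ≤ 21 * timeBound lam K x t := by
    linarith
  calc (1 + (lam : ℝ)) * _ ≤ (1 + lam) * (21 * timeBound lam K x t) := by gcongr
    _ = _ := by ring

/-- One step of the discrete Grönwall inequality, from `1 + u ≤ exp u`. -/
lemma timeBound_add {lam : ℝ≥0} {K : ℝ} (hK : 0 ≤ K) (x : ℤ) {t δ : ℝ} :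
    timeBound lam K x t + 21 * (1 + lam) * timeBound lam K x t * δ ≤
      timeBound lam K x (t + δ) := by
  unfold timeBound
  rw [mul_add (21 * (1 + (lam : ℝ))), Real.exp_add]
  have := Real.add_one_le_exp (21 * (1 + (lam : ℝ)) * δ)
  have h0 : 0 ≤ K * 2 ^ x.natAbs * Real.exp (21 * (1 + lam) * t) := by positivity
  nlinarith

/-- Grönwall along the rings: as long as all clocks obey the bound, their speeds are at most `21 *
(1 + lam)` times it, so the bound persists until the next ring. It does not involve `M`, which is
what later permits domination as `M → ∞`. -/
lemma Regular.elapsed_le {lam : ℝ≥0} {ω : Env} {K : ℝ} (h : Regular ω K) {M n : ℕ}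
    (ht : (snapshot lam ω M n).time ≠ ⊤) (x : ℤ) :
    elapsed ω (snapshot lam ω M n) x ≤ timeBound lam K x (snapshot lam ω M n).time.toReal := by
  induction n generalizing x with
  | zero =>
    rw [elapsed_zero]
    have := h.nonneg
    unfold timeBound; positivity
  | succ n ih =>
    obtain ⟨y, hy, ht', htime, -, -, hel⟩ := elapsed_succ h.gap_pos ht
    have hw := wait_nonneg (lam := lam) (snapshotInv lam h.gap_pos M n) y
    rw [hel, htime]
    have h1 := h.speed_le ENNReal.toReal_nonneg (ih ht') x
    refine le_trans ?_ (timeBound_add h.nonneg x)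
    have := ih ht' x
    gcongr

end ARW

namespace ARW

/-! ### Absence of explosion -/

/-- The total speed is at most `1 + lam` times the number of particles, and that number does not
grow. -/
lemma sum_elapsed_le {lam : ℝ≥0} {ω : Env} (hn : NNInstr ω) (hg : ∀ x k, 0 < gap ω x k) {M : ℕ}
    {N : ℕ} (hN : ∀ A : Finset ℤ, ∑ x ∈ A, ((start ω M).config x).count ≤ N) {n : ℕ}
    (ht : (snapshot lam ω M n).time ≠ ⊤) (A : Finset ℤ) :
    ∑ x ∈ A, elapsed ω (snapshot lam ω M n) x ≤
      (1 + lam) * N * (snapshot lam ω M n).time.toReal := by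
  induction n with
  | zero => simp only [elapsed_zero, Finset.sum_const_zero]; positivity
  | succ n ih =>
    obtain ⟨y, hy, ht', htime, -, -, hel⟩ := elapsed_succ hg ht
    have hinv := snapshotInv lam hg M n
    have hw := wait_nonneg (lam := lam) hinv y
    simp only [hel, htime, Finset.sum_add_distrib, ← Finset.sum_mul]
    have h1 : ∑ x ∈ A, speed lam (snapshot lam ω M n).config x ≤ (1 + lam) * N := by
      unfold speed
      rw [← Finset.mul_sum]
      gcongr
      have := hinv.legal.sum_count_le hn hN A
      have h2 : ∑ x ∈ A, ((snapshot lam ω M n).config x).active ≤ N :=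
        (Finset.sum_le_sum fun x _ => SiteState.active_le_count _).trans this
      exact_mod_cast h2
    have := ih ht'
    nlinarith [mul_le_mul_of_nonneg_right h1 hw]

lemma exists_sum_count_start_le (ω : Env) (M : ℕ) :
    ∃ N : ℕ, ∀ A : Finset ℤ, ∑ x ∈ A, ((start ω M).config x).count ≤ N := by
  classical
  refine ⟨∑ x ∈ Finset.Icc (-(M : ℤ)) M, ((start ω M).config x).count, fun A => ?_⟩
  have : ∑ x ∈ A, ((start ω M).config x).count =
      ∑ x ∈ A with x ∈ Finset.Icc (-(M : ℤ)) M, ((start ω M).config x).count := by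
    rw [Finset.sum_filter]
    refine Finset.sum_congr rfl fun x _ => ?_
    split_ifs with h
    · rfl
    · have : ¬ |x| ≤ (M : ℤ) := fun h' => h (by simpa [abs_le] using h')
      simp [start, this]
  rw [this]
  exact Finset.sum_le_sum_of_subset fun x hx => (Finset.mem_filter.1 hx).2

/-- Particles leaving an interval have to topple every site that they pass. -/
lemma Legal.spread {ω : Env} (hn : NNInstr ω) {M : ℕ} {η : Config} {k : ℤ → ℕ}
    (h : Legal ω (start ω M).config η k) {x y : ℤ}
    (hxy : ((M : ℤ) < x ∧ x < y) ∨ (y < x ∧ x < -(M : ℤ))) (hy : η y ≠ .num 0 ∨ 0 < k y) :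
    0 < k x := by
  induction h generalizing x y with
  | refl =>
    have : ¬ |y| ≤ (M : ℤ) := fun h' => by have := abs_le.1 h'; omega
    simp [start, this] at hy
  | @step η k w h hw ih =>
    have hw0 : η w ≠ .num 0 := fun e => by rw [e] at hw; simp at hw
    have hgrow : ∀ v, 0 < k v ∨ v = w → 0 < Function.update k w (k w + 1) v := by
      intro v hv
      by_cases hvw : v = w
      · subst hvw; simp
      · simpa [hvw] using hv
    apply hgrow
    by_cases hold : η y ≠ .num 0 ∨ 0 < k y
    · exact Or.inl (ih hxy hold)
    · push Not at hold
      by_cases hyw : y = w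
      · subst hyw; exact absurd hold.1 hw0
      · have hy1 : topple w (instr ω w (k w)) η y ≠ .num 0 := by
          rcases hy with hy | hy
          · exact hy
          · simp [hyw] at hy; omega
        have hy2 : y = w + 1 ∨ y = w + -1 := by
          by_contra hcon
          push Not at hcon
          apply hy1
          rw [← hold.1]
          rcases hn w (k w) with hi | hi | hi <;> rw [hi] <;>
            simp [topple, hyw, hcon.1, hcon.2]
        by_cases hxw : x = w
        · exact Or.inr hxw
        · exact Or.inl (ih (y := w) (by omega) (Or.inl hw0))

/-- Every finite system has finitely many rings in finite time. -/
lemma Regular.exists_lt_time {ω : Env} {K : ℝ} (h : Regular ω K) (lam : ℝ≥0) (M : ℕ) (t : ℝ≥0) :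
    ∃ n, (t : ℝ≥0∞) < (snapshot lam ω M (n + 1)).time := by
  classical
  by_contra hcon
  push Not at hcon
  have hle : ∀ n, (snapshot lam ω M n).time ≤ t := fun n =>
    (time_mono lam ω M n.le_succ).trans (hcon n)
  have hne : ∀ n, (snapshot lam ω M n).time ≠ ⊤ := fun n => ne_top_of_le_ne_top (by simp) (hle n)
  have hle' : ∀ n, (snapshot lam ω M n).time.toReal ≤ t := fun n => by
    simpa using ENNReal.toReal_mono ENNReal.coe_ne_top (hle n)
  obtain ⟨N, hN⟩ := exists_sum_count_start_le ω M
  obtain ⟨C, hC⟩ := exists_nat_gt ((1 + lam) * N * (t : ℝ))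
  have hsum : ∀ n (A : Finset ℤ), ∑ x ∈ A, elapsed ω (snapshot lam ω M n) x < C := by
    intro n A
    refine (sum_elapsed_le h.nn h.gap_pos hN (hne n) A).trans_lt (lt_of_le_of_lt ?_ hC)
    exact mul_le_mul_of_nonneg_left (hle' n) (by positivity)
  have hnn : ∀ n x, 0 ≤ elapsed ω (snapshot lam ω M n) x :=
    fun n x => elapsed_nonneg h.gap_pos M n x
  have hlong : ∀ n x, 0 < (snapshot lam ω M n).rings x →
      gap ω x 0 ≤ elapsed ω (snapshot lam ω M n) x := by
    intro n x hx
    refine le_trans ?_ (clock_le_elapsed (snapshotInv lam h.gap_pos M n) x)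
    calc gap ω x 0 = clock ω x 1 := by simp [clock]
      _ ≤ _ := (clock_strictMono h.gap_pos x).monotone hx
  -- On either side of `[-M, M]` there are `C` sites with first gap at least one. A ring beyond all
  -- of them would require each of them to have rung, hence a total internal time of at least `C`,
  -- which is excluded by `hsum`. So all the rings up to time `t` happen in a fixed box.
  have hbox : ∀ ε : ℤ, ε = 1 ∨ ε = -1 → ∃ R : ℕ, ∀ n (m : ℕ), R < m →
      (snapshot lam ω M n).rings (ε * m) = 0 := by
    intro ε hε
    have hinf := Nat.frequently_atTop_iff_infinite.1
      ((h.long_gaps ε hε).and_eventually (eventually_gt_atTop M))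
    obtain ⟨A, hA, hcard⟩ := hinf.exists_subset_card_eq C
    refine ⟨A.sup id, fun n m hm => ?_⟩
    by_contra hpos
    have hinj : Set.InjOn (fun j : ℕ => ε * (j : ℤ)) A := by
      intro a _ b _ hab
      rcases hε with rfl | rfl <;> simpa using hab
    have h1 : (C : ℝ) ≤ ∑ x ∈ A.image (fun j : ℕ => ε * (j : ℤ)),
        elapsed ω (snapshot lam ω M n) x := by
      rw [Finset.sum_image hinj]
      calc (C : ℝ) = ∑ j ∈ A, (1 : ℝ) := by simp [hcard]
        _ ≤ _ := by
          refine Finset.sum_le_sum fun j hj => ?_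
          have hj' := hA hj
          have hjm : j < m := (Finset.le_sup (f := id) hj).trans_lt hm
          refine hj'.1.trans (hlong n _ ?_)
          refine (snapshotInv lam h.gap_pos M n).legal.spread h.nn (y := ε * m) ?_
            (Or.inr (Nat.pos_of_ne_zero hpos))
          have := hj'.2
          rcases hε with rfl | rfl <;> omega
    exact absurd (hsum n _) (not_lt.2 h1)
  obtain ⟨R1, hR1⟩ := hbox 1 (Or.inl rfl)
  obtain ⟨R2, hR2⟩ := hbox (-1) (Or.inr rfl)
  set R := max R1 R2 with hR
  have hout : ∀ n x, x ∉ Finset.Icc (-(R : ℤ)) R → (snapshot lam ω M n).rings x = 0 := by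
    intro n x hx
    simp only [Finset.mem_Icc, not_and_or, not_le] at hx
    rcases hx with hx | hx
    · have := hR2 n x.natAbs (by omega)
      rwa [show (-1 : ℤ) * x.natAbs = x by omega] at this
    · have := hR1 n x.natAbs (by omega)
      rwa [show (1 : ℤ) * x.natAbs = x by omega] at this
  -- All the times being finite, each step is a genuine ring in the box. The total `n` is thus
  -- unbounded, whereas the clocks bound the number of rings at each of the finitely many sites.
  have htot : ∀ n, ∑ x ∈ Finset.Icc (-(R : ℤ)) R, (snapshot lam ω M n).rings x = n := by
    intro n
    induction n with
    | zero => simp [snapshot_zero, start]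
    | succ n ih =>
      obtain ⟨y, -, -, -, hr, -⟩ := elapsed_succ h.gap_pos (hne (n + 1))
      have hy : y ∈ Finset.Icc (-(R : ℤ)) R := by
        by_contra hy
        have := hout (n + 1) y hy
        rw [hr] at this; simp at this
      rw [← Finset.add_sum_erase _ _ hy] at ih
      rw [hr, Finset.sum_update_of_mem hy, Finset.sdiff_singleton_eq_erase]
      omega
  have hbd : ∀ n, ∀ x ∈ Finset.Icc (-(R : ℤ)) R,
      (((snapshot lam ω M n).rings x : ℕ) : ℝ) ≤ 4 * C + K * 2 ^ R := by
    intro n x hx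
    have h1 := h.rings_le x ((snapshot lam ω M n).rings x)
    have h2 := clock_le_elapsed (snapshotInv lam h.gap_pos M n) x
    have h3 := hsum n {x}
    rw [Finset.sum_singleton] at h3
    have h4 : K * 2 ^ x.natAbs ≤ K * 2 ^ R := by
      refine mul_le_mul_of_nonneg_left ?_ h.nonneg
      refine pow_le_pow_right₀ (by norm_num) ?_
      simp only [Finset.mem_Icc] at hx; omega
    linarith
  obtain ⟨n, hn⟩ := exists_nat_gt (∑ x ∈ Finset.Icc (-(R : ℤ)) R, (4 * C + K * 2 ^ R))
  have := Finset.sum_le_sum (hbd n)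
  rw [← Nat.cast_sum, htot n] at this
  linarith

/-! ### Continuous time -/

/-- Number of rings up to time `t`. -/
noncomputable def ringIndex (lam : ℝ≥0) (ω : Env) (M : ℕ) (t : ℝ≥0) : ℕ :=
  sInf {n | (t : ℝ≥0∞) < (snapshot lam ω M (n + 1)).time}

/-- Odometer of the finite system at time `t`. -/
noncomputable def ringsAt (lam : ℝ≥0) (ω : Env) (M : ℕ) (t : ℝ≥0) : ℤ → ℕ :=
  (snapshot lam ω M (ringIndex lam ω M t)).rings

/-- Speed of the clock at `x` at time `u`. -/
noncomputable def speedAt (lam : ℝ≥0) (ω : Env) (M : ℕ) (x : ℤ) (u : ℝ) : ℝ :=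
  speed lam (finiteConfig lam ω M u.toNNReal) x

/-- Internal time of `x` at real time `t`. -/
noncomputable def internalTime (lam : ℝ≥0) (ω : Env) (M : ℕ) (x : ℤ) (t : ℝ) : ℝ :=
  ∫ u in (0 : ℝ)..t, speedAt lam ω M x u

lemma ringIndex_mono {ω : Env} {K : ℝ} (h : Regular ω K) (lam : ℝ≥0) (M : ℕ) :
    Monotone (ringIndex lam ω M) := by
  intro s t hst
  have h1 : (t : ℝ≥0∞) < (snapshot lam ω M (ringIndex lam ω M t + 1)).time :=
    Nat.sInf_mem (s := {n | (t : ℝ≥0∞) < (snapshot lam ω M (n + 1)).time})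
      (h.exists_lt_time lam M t)
  exact Nat.sInf_le (lt_of_le_of_lt (ENNReal.coe_le_coe.2 hst) h1)

lemma Regular.lt_time {ω : Env} {K : ℝ} (h : Regular ω K) (lam : ℝ≥0) (M : ℕ) (t : ℝ≥0) :
    (t : ℝ≥0∞) < (snapshot lam ω M (ringIndex lam ω M t + 1)).time :=
  Nat.sInf_mem (h.exists_lt_time lam M t)

lemma time_ringIndex_le (lam : ℝ≥0) (ω : Env) (M : ℕ) (t : ℝ≥0) :
    (snapshot lam ω M (ringIndex lam ω M t)).time ≤ t := by
  rcases Nat.eq_zero_or_pos (ringIndex lam ω M t) with h0 | h0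
  · rw [h0]; simp [snapshot_zero, start]
  · have := Nat.notMem_of_lt_sInf (s := {n | (t : ℝ≥0∞) < (snapshot lam ω M (n + 1)).time})
      (m := ringIndex lam ω M t - 1) (by unfold ringIndex at *; omega)
    simp only [Set.mem_ofPred_eq, not_lt] at this
    rwa [Nat.sub_add_cancel h0] at this

lemma ringIndex_eq {lam : ℝ≥0} {ω : Env} {M n : ℕ} {t : ℝ≥0}
    (h1 : (snapshot lam ω M n).time ≤ t) (h2 : (t : ℝ≥0∞) < (snapshot lam ω M (n + 1)).time) :
    ringIndex lam ω M t = n := by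
  refine le_antisymm (Nat.sInf_le h2) ?_
  by_contra hlt
  push Not at hlt
  have h3 : (t : ℝ≥0∞) < (snapshot lam ω M (ringIndex lam ω M t + 1)).time :=
    Nat.sInf_mem (s := {n | (t : ℝ≥0∞) < (snapshot lam ω M (n + 1)).time}) ⟨n, h2⟩
  exact absurd (h3.trans_le (time_mono lam ω M (by omega : ringIndex lam ω M t + 1 ≤ n)))
    (not_lt.2 h1)

lemma finiteConfig_eq (lam : ℝ≥0) (ω : Env) (M : ℕ) (t : ℝ≥0) :
    finiteConfig lam ω M t = (snapshot lam ω M (ringIndex lam ω M t)).config := rfl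

lemma Regular.measurable_speedAt {ω : Env} {K : ℝ} (h : Regular ω K) (lam : ℝ≥0) (M : ℕ) (x : ℤ) :
    Measurable (speedAt lam ω M x) := by
  have h1 : Measurable (ringIndex lam ω M) := (ringIndex_mono h lam M).measurable
  have h2 : Measurable fun n : ℕ => speed lam (snapshot lam ω M n).config x :=
    measurable_of_countable _
  exact h2.comp (h1.comp measurable_real_toNNReal)

lemma speedAt_eq {lam : ℝ≥0} {ω : Env} {M n : ℕ} {u : ℝ} (hu : 0 ≤ u) (x : ℤ)
    (h0 : (snapshot lam ω M n).time ≠ ⊤)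
    (h1 : (snapshot lam ω M n).time.toReal ≤ u)
    (h2 : ENNReal.ofReal u < (snapshot lam ω M (n + 1)).time) :
    speedAt lam ω M x u = speed lam (snapshot lam ω M n).config x := by
  have : ringIndex lam ω M u.toNNReal = n := by
    refine ringIndex_eq ?_ h2
    change _ ≤ ENNReal.ofReal u
    rwa [ENNReal.le_ofReal_iff_toReal_le h0 hu]
  rw [speedAt, finiteConfig_eq, this]

/-- The internal time within one period of constancy. -/
lemma integral_speedAt_piece {lam : ℝ≥0} {ω : Env} {M n : ℕ} {t : ℝ} (x : ℤ)
    (h0 : (snapshot lam ω M n).time ≠ ⊤)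
    (h1 : (snapshot lam ω M n).time.toReal ≤ t)
    (h2 : ENNReal.ofReal t ≤ (snapshot lam ω M (n + 1)).time) :
    IntervalIntegrable (speedAt lam ω M x) volume (snapshot lam ω M n).time.toReal t ∧
    ∫ u in (snapshot lam ω M n).time.toReal..t, speedAt lam ω M x u =
      speed lam (snapshot lam ω M n).config x * (t - (snapshot lam ω M n).time.toReal) := by
  set T := (snapshot lam ω M n).time.toReal with hT
  have hT0 : 0 ≤ T := ENNReal.toReal_nonneg
  have heq : Set.EqOn (fun _ => speed lam (snapshot lam ω M n).config x) (speedAt lam ω M x)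
      (Set.Ioo T t) := by
    intro u hu
    refine (speedAt_eq (hT0.trans hu.1.le) x h0 hu.1.le (lt_of_lt_of_le ?_ h2)).symm
    exact (ENNReal.ofReal_lt_ofReal_iff (by linarith [hu.1, hu.2])).2 hu.2
  constructor
  · rw [intervalIntegrable_iff_integrableOn_Ioo_of_le h1]
    exact (integrableOn_const (by simp)).congr_fun heq measurableSet_Ioo
  · rw [intervalIntegral.integral_of_le h1, integral_Ioc_eq_integral_Ioo,
      ← setIntegral_congr_fun measurableSet_Ioo heq]
    simp [h1, mul_comm]

lemma integral_speedAt_time {lam : ℝ≥0} {ω : Env} (hg : ∀ x k, 0 < gap ω x k) {M n : ℕ} (x : ℤ)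
    (ht : (snapshot lam ω M n).time ≠ ⊤) :
    IntervalIntegrable (speedAt lam ω M x) volume 0 (snapshot lam ω M n).time.toReal ∧
    internalTime lam ω M x (snapshot lam ω M n).time.toReal =
      elapsed ω (snapshot lam ω M n) x := by
  induction n with
  | zero =>
    have h0 : (snapshot lam ω M 0).time = 0 := rfl
    simp [elapsed_zero, internalTime, h0]
  | succ n ih =>
    obtain ⟨y, hy, ht', htime, -, -, hel⟩ := elapsed_succ hg ht
    obtain ⟨i1, e1⟩ := ih ht'
    have hmono : (snapshot lam ω M n).time.toReal ≤ (snapshot lam ω M (n + 1)).time.toReal :=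
      ENNReal.toReal_mono ht (time_mono lam ω M n.le_succ)
    obtain ⟨i2, e2⟩ := integral_speedAt_piece x ht' hmono (by rw [ENNReal.ofReal_toReal ht])
    refine ⟨i1.trans i2, ?_⟩
    unfold internalTime at e1 ⊢
    rw [← intervalIntegral.integral_add_adjacent_intervals i1 i2, e1, e2, hel, htime]
    ring

lemma Regular.internalTime_eq {ω : Env} {K : ℝ} (h : Regular ω K) (lam : ℝ≥0) (M : ℕ) (x : ℤ)
    (t : ℝ≥0) :
    IntervalIntegrable (speedAt lam ω M x) volume 0 t ∧
    internalTime lam ω M x t = elapsed ω (snapshot lam ω M (ringIndex lam ω M t)) x +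
      speedAt lam ω M x t * (t - (snapshot lam ω M (ringIndex lam ω M t)).time.toReal) := by
  have h1 := time_ringIndex_le lam ω M t
  have h2 := h.lt_time lam M t
  have h0 : (snapshot lam ω M (ringIndex lam ω M t)).time ≠ ⊤ := ne_top_of_le_ne_top (by simp) h1
  have h3 : (snapshot lam ω M (ringIndex lam ω M t)).time.toReal ≤ t := by
    simpa using ENNReal.toReal_mono ENNReal.coe_ne_top h1
  obtain ⟨i1, e1⟩ := integral_speedAt_time h.gap_pos x h0
  obtain ⟨i2, e2⟩ := integral_speedAt_piece x h0 h3 (by simpa using h2.le)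
  refine ⟨i1.trans i2, ?_⟩
  unfold internalTime at e1 ⊢
  rw [← intervalIntegral.integral_add_adjacent_intervals i1 i2, e1, e2]
  simp [speedAt, finiteConfig_eq]

lemma speedAt_nonneg (lam : ℝ≥0) (ω : Env) (M : ℕ) (x : ℤ) (u : ℝ) : 0 ≤ speedAt lam ω M x u :=
  speed_nonneg _ _ _

/-- With `Regular.internalTime_le_clock`, this recovers the odometer from the integrated speed.
Unlike individual ring times, integrals of the speed pass easily to the limit `M → ∞`. -/
lemma Regular.clock_le_internalTime {ω : Env} {K : ℝ} (h : Regular ω K) (lam : ℝ≥0) (M : ℕ)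
    (x : ℤ) (t : ℝ≥0) : clock ω x (ringsAt lam ω M t x) ≤ internalTime lam ω M x t := by
  rw [(h.internalTime_eq lam M x t).2]
  have h1 := time_ringIndex_le lam ω M t
  have h3 : (snapshot lam ω M (ringIndex lam ω M t)).time.toReal ≤ t := by
    simpa using ENNReal.toReal_mono ENNReal.coe_ne_top h1
  have h4 := clock_le_elapsed (snapshotInv lam h.gap_pos M (ringIndex lam ω M t)) x
  have h5 := mul_nonneg (speedAt_nonneg lam ω M x t) (sub_nonneg.2 h3)
  unfold ringsAt
  linarith

lemma Regular.internalTime_le_clock {ω : Env} {K : ℝ} (h : Regular ω K) (lam : ℝ≥0) (M : ℕ)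
    (x : ℤ) (t : ℝ≥0) : internalTime lam ω M x t ≤ clock ω x (ringsAt lam ω M t x + 1) := by
  rw [(h.internalTime_eq lam M x t).2]
  have h1 := time_ringIndex_le lam ω M t
  have h2 := h.lt_time lam M t
  have h0 : (snapshot lam ω M (ringIndex lam ω M t)).time ≠ ⊤ := ne_top_of_le_ne_top (by simp) h1
  have h3 : (snapshot lam ω M (ringIndex lam ω M t)).time.toReal ≤ t := by
    simpa using ENNReal.toReal_mono ENNReal.coe_ne_top h1
  set n := ringIndex lam ω M t with hn
  have hinv := snapshotInv lam h.gap_pos M n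
  have hsp : speedAt lam ω M x t = speed lam (snapshot lam ω M n).config x := by
    simp [speedAt, finiteConfig_eq, hn]
  rw [hsp]
  have key : speed lam (snapshot lam ω M n).config x *
      (t - (snapshot lam ω M n).time.toReal) ≤ (snapshot lam ω M n).left x := by
    by_cases hr : ∃ y, RingsNext lam (snapshot lam ω M n) y
    · have hfin : (snapshot lam ω M (n + 1)).time ≠ ⊤ := by
        obtain ⟨y, hy, e⟩ := step_of_ringsNext lam ω hr
        rw [snapshot_succ, e]; simp [h0]
      obtain ⟨y, hy, -, htime, -, hle, -⟩ := elapsed_succ h.gap_pos hfin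
      refine le_trans ?_ (hle x)
      refine mul_le_mul_of_nonneg_left ?_ (speed_nonneg _ _ _)
      have : (t : ℝ) ≤ (snapshot lam ω M (n + 1)).time.toReal := by
        simpa using ENNReal.toReal_mono hfin h2.le
      linarith
    · have hx : ¬ 0 < ((snapshot lam ω M n).config x).active := fun hx =>
        hr (exists_ringsNext hinv.finite_active ⟨x, hx⟩)
      rw [speed_eq_zero hx]; simpa using hinv.left_nonneg x
  unfold elapsed ringsAt
  rw [← hn]
  linarith

lemma Regular.internalTime_le {ω : Env} {K : ℝ} (h : Regular ω K) (lam : ℝ≥0) (M : ℕ)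
    (x : ℤ) (t : ℝ≥0) :
    internalTime lam ω M x t ≤ timeBound lam K x t ∧
      speedAt lam ω M x t ≤ 21 * (1 + lam) * timeBound lam K x t := by
  have h1 := time_ringIndex_le lam ω M t
  have h0 : (snapshot lam ω M (ringIndex lam ω M t)).time ≠ ⊤ := ne_top_of_le_ne_top (by simp) h1
  have h3 : (snapshot lam ω M (ringIndex lam ω M t)).time.toReal ≤ t := by
    simpa using ENNReal.toReal_mono ENNReal.coe_ne_top h1
  have hsp : speedAt lam ω M x t =
      speed lam (snapshot lam ω M (ringIndex lam ω M t)).config x := by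
    simp [speedAt, finiteConfig_eq]
  have hs := h.speed_le (lam := lam) ENNReal.toReal_nonneg (fun y => h.elapsed_le h0 y) x
  have ha := timeBound_add (lam := lam) h.nonneg x
    (t := (snapshot lam ω M (ringIndex lam ω M t)).time.toReal)
    (δ := t - (snapshot lam ω M (ringIndex lam ω M t)).time.toReal)
  rw [add_sub_cancel] at ha
  have hT : 0 ≤ timeBound lam K x (snapshot lam ω M (ringIndex lam ω M t)).time.toReal := by
    have := h.nonneg
    unfold timeBound; positivity
  constructor
  · rw [(h.internalTime_eq lam M x t).2, hsp]
    refine le_trans ?_ ha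
    have := h.elapsed_le h0 x
    have := mul_le_mul_of_nonneg_right hs (sub_nonneg.2 h3)
    linarith
  · rw [hsp]
    refine hs.trans (mul_le_mul_of_nonneg_left ?_ (by positivity))
    refine le_trans ?_ ha
    have : 0 ≤ (t : ℝ) - (snapshot lam ω M (ringIndex lam ω M t)).time.toReal := by linarith
    have : 0 ≤ 21 * (1 + (lam : ℝ)) *
      timeBound lam K x (snapshot lam ω M (ringIndex lam ω M t)).time.toReal *
      (t - (snapshot lam ω M (ringIndex lam ω M t)).time.toReal) := by positivity
    linarith

lemma Regular.intervalIntegrable {ω : Env} {K : ℝ} (h : Regular ω K) (lam : ℝ≥0) (M : ℕ) (x : ℤ)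
    (s t : ℝ≥0) : IntervalIntegrable (speedAt lam ω M x) volume s t :=
  (h.internalTime_eq lam M x s).1.symm.trans (h.internalTime_eq lam M x t).1

lemma Regular.internalTime_sub {ω : Env} {K : ℝ} (h : Regular ω K) (lam : ℝ≥0) (M : ℕ) (x : ℤ)
    (s t : ℝ≥0) : internalTime lam ω M x t - internalTime lam ω M x s =
      ∫ u in (s : ℝ)..t, speedAt lam ω M x u :=
  intervalIntegral.integral_interval_sub_left (h.internalTime_eq lam M x t).1
    (h.internalTime_eq lam M x s).1

lemma legal_ringsAt {ω : Env} {K : ℝ} (h : Regular ω K) (lam : ℝ≥0) (M : ℕ) (t : ℝ≥0) :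
    Legal ω (start ω M).config (finiteConfig lam ω M t) (ringsAt lam ω M t) :=
  (snapshotInv lam h.gap_pos M _).legal

lemma rings_mono {lam : ℝ≥0} {ω : Env} {M : ℕ} (x : ℤ) :
    Monotone fun n => (snapshot lam ω M n).rings x := by
  refine monotone_nat_of_le_succ fun n => ?_
  rw [snapshot_succ]
  by_cases hr : ∃ x, RingsNext lam (snapshot lam ω M n) x
  · obtain ⟨y, hy, e⟩ := step_of_ringsNext lam ω hr
    rw [e]
    by_cases hxy : x = y
    · subst hxy; simp
    · simp [hxy]
  · rw [step_of_not_ringsNext lam ω hr]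

lemma ringsAt_mono {ω : Env} {K : ℝ} (h : Regular ω K) (lam : ℝ≥0) (M : ℕ) (x : ℤ) :
    Monotone fun t => ringsAt lam ω M t x :=
  fun _ _ hst => rings_mono x (ringIndex_mono h lam M hst)

/-- Any legal odometer of a smaller system is exceeded after a finite time that does not depend
on the size of the system. -/
lemma Regular.exists_time_ge {ω : Env} {K : ℝ} (h : Regular ω K) (lam : ℝ≥0) {n : ℕ}
    {η₀ η : Config} {k : ℤ → ℕ} (hl : Legal ω η₀ η k) (h₀ : AllActive η₀)
    (hle : ∀ M, n ≤ M → ∀ x, (η₀ x).count ≤ ((start ω M).config x).count) :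
    ∃ s : ℝ≥0, ∀ M, n ≤ M → ∀ x, k x ≤ ringsAt lam ω M s x := by
  induction hl with
  | refl => exact ⟨0, fun M _ x => Nat.zero_le _⟩
  | @step η k y hl hy ih =>
    obtain ⟨s, hs⟩ := ih
    -- If `y` had not rung once more by time `s'`, its odometer would equal `k y` throughout `[s,
    -- s']`, so `y` would be active there by `Legal.active_mono` and its clock would run at speed at
    -- least one. Its internal time would grow by `gap + 1`, more than the single gap available.
    set s' : ℝ≥0 := s + (gap ω y (k y)).toNNReal + 1 with hs'
    have hss' : s ≤ s' := by rw [hs', add_assoc]; exact le_self_add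
    have hmono : ∀ M u x, s ≤ u → n ≤ M → k x ≤ ringsAt lam ω M u x := fun M u x hu hM =>
      (hs M hM x).trans (ringsAt_mono h lam M x hu)
    refine ⟨s', fun M hM x => ?_⟩
    by_cases hxy : x = y
    · subst hxy
      rw [Function.update_self]
      by_contra hcon
      have hcon' : ringsAt lam ω M s' x = k x := le_antisymm (by omega) (hmono M s' x hss' hM)
      have hact : ∀ u ∈ Set.Icc (s : ℝ) s', (1 : ℝ) ≤ speedAt lam ω M x u := by
        intro u hu
        have hu1 : s ≤ u.toNNReal := NNReal.le_toNNReal_of_coe_le hu.1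
        have hu2 : u.toNNReal ≤ s' := Real.toNNReal_le_iff_le_coe.2 hu.2
        have e : k x = ringsAt lam ω M u.toNNReal x :=
          le_antisymm (hmono M _ x hu1 hM) ((ringsAt_mono h lam M x hu2).trans hcon'.le)
        have ha := hl.active_mono h.nn (legal_ringsAt h lam M u.toNNReal) h₀
          (start_allActive ω M) (hle M hM) (fun z => hmono M _ z hu1 hM) e hy
        have ha' : (1 : ℝ) ≤ ((finiteConfig lam ω M u.toNNReal x).active : ℝ) := by
          exact_mod_cast ha
        have hl0 : (0 : ℝ) ≤ lam := lam.2
        unfold speedAt speed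
        nlinarith
      have hint := h.internalTime_sub lam M x s s'
      have hge : ((s' : ℝ) - s) ≤ ∫ u in (s : ℝ)..s', speedAt lam ω M x u := by
        have := intervalIntegral.integral_mono_on (μ := volume) (a := (s : ℝ)) (b := s')
          (f := fun _ => (1 : ℝ)) (by exact_mod_cast hss') (by simp)
          (h.intervalIntegrable lam M x s s') hact
        simpa using this
      have h1 := h.internalTime_le_clock lam M x s'
      have h2 := h.clock_le_internalTime lam M x s
      have h3 := (clock_strictMono h.gap_pos x).monotone (hs M hM x)
      rw [hcon', clock_succ] at h1
      have h4 : (s' : ℝ) = s + gap ω x (k x) + 1 := by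
        simp [hs', (h.gap_pos x (k x)).le]
      linarith
    · rw [Function.update_of_ne hxy]
      exact hmono M s' x hss' hM

end ARW

namespace ARW

/-! ### Fixation contradicts unbounded odometers -/

lemma eq_of_clock_bounds {ω : Env} (hg : ∀ x k, 0 < gap ω x k) {x : ℤ} {a b : ℕ} {v : ℝ}
    (h1 : clock ω x a ≤ v) (h2 : v ≤ clock ω x (a + 1)) (h3 : clock ω x b < v)
    (h4 : v < clock ω x (b + 1)) : a = b := by
  have e1 := (clock_strictMono hg x).lt_iff_lt.1 (h1.trans_lt h4)
  have e2 := (clock_strictMono hg x).lt_iff_lt.1 (h3.trans_le h2)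
  omega

/-- Environments where the rings of the neighbours of the origin are never in linear relation with
those of the origin. -/
def Generic (ω : Env) : Prop :=
  ∀ y : ℤ, y = 1 ∨ y = -1 → ∀ a b j j' k k' : ℕ, 0 < a → 0 < b → j < j' → k < k' →
    a * (clock ω y j' - clock ω y j) ≠ b * (clock ω 0 k' - clock ω 0 k)

/-- A putative limit of the odometers after the state around the origin became constant, with the
clock of `x` running at speed `β x`. -/
structure LimitRings (ω : Env) (t₀ : ℝ) (β α : ℤ → ℝ) (l : ℝ → ℤ → ℕ) : Prop where
  lower : ∀ x, |x| ≤ 1 → ∀ s, t₀ ≤ s → clock ω x (l s x) ≤ α x + β x * (s - t₀)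
  upper : ∀ x, |x| ≤ 1 → ∀ s, t₀ ≤ s → α x + β x * (s - t₀) ≤ clock ω x (l s x + 1)
  mono : ∀ x s t, s ≤ t → l s x ≤ l t x
  -- Mass balance at the origin when its particle number is constant.
  balance : ∃ c : ℤ, ∀ s, t₀ ≤ s → (sent ω 0 1 (l s 0) : ℤ) + sent ω 0 (-1) (l s 0) =
    c + sent ω (-1) 1 (l s (-1)) + sent ω 1 (-1) (l s 1)

/-- Strictly between two ring times the two bounds determine `l · y` in a whole neighbourhood of
`s`, where it is then constant. An increase across `s` can only occur if the internal time of `y` is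
exactly a ring time. -/
lemma LimitRings.exists_tie {ω : Env} (hg : ∀ x k, 0 < gap ω x k) {t₀ : ℝ} {β α : ℤ → ℝ}
    {l : ℝ → ℤ → ℕ} (hl : LimitRings ω t₀ β α l) {y : ℤ} (hy : |y| ≤ 1) (hβ : 0 ≤ β y) {s : ℝ}
    (hs : t₀ < s) (hinc : ∀ ε, 0 < ε → ε ≤ s - t₀ → l (s - ε) y < l (s + ε) y) :
    ∃ j, α y + β y * (s - t₀) = clock ω y j := by
  by_contra hcon
  push Not at hcon
  have h1 := lt_of_le_of_ne (hl.lower y hy s hs.le) (hcon _).symm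
  have h2 := lt_of_le_of_ne (hl.upper y hy s hs.le) (hcon _)
  set v := α y + β y * (s - t₀) with hv
  set d := min (v - clock ω y (l s y)) (clock ω y (l s y + 1) - v) with hd
  have hd0 : 0 < d := lt_min (by linarith) (by linarith)
  set ε := min (s - t₀) (d / (2 * (β y + 1))) with hε
  have hε0 : 0 < ε := lt_min (by linarith) (by positivity)
  have hε1 : ε ≤ s - t₀ := min_le_left _ _
  have hε2 : β y * ε < d := by
    have : ε ≤ d / (2 * (β y + 1)) := min_le_right _ _
    calc β y * ε ≤ (β y + 1) * (d / (2 * (β y + 1))) := by gcongr; linarith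
      _ = d / 2 := by field_simp
      _ < d := by linarith
  have hd1 : d ≤ v - clock ω y (l s y) := min_le_left _ _
  have hd2 : d ≤ clock ω y (l s y + 1) - v := min_le_right _ _
  have hβε : 0 ≤ β y * ε := by positivity
  have e1 : l (s - ε) y = l s y := by
    refine eq_of_clock_bounds hg (hl.lower y hy _ (by linarith)) (hl.upper y hy _ (by linarith))
      ?_ ?_ <;> nlinarith
  have e2 : l (s + ε) y = l s y := by
    refine eq_of_clock_bounds hg (hl.lower y hy _ (by linarith)) (hl.upper y hy _ (by linarith))
      ?_ ?_ <;> nlinarith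
  have := hinc ε hε0 hε1
  omega

/-- At the time when the origin completes its ring number `k`, counted from zero, its outflow grows
by one. If neither neighbour rang at that time, the inflow would be unchanged and the balance
violated. -/
lemma LimitRings.exists_increase {ω : Env} (hn : NNInstr ω) (hg : ∀ x k, 0 < gap ω x k) {t₀ : ℝ}
    {β α : ℤ → ℝ} {l : ℝ → ℤ → ℕ} (hl : LimitRings ω t₀ β α l) (hβ : 0 < β 0) {k : ℕ}
    (hj : instr ω 0 k ≠ .sleep) :
    ∃ y : ℤ, (y = 1 ∨ y = -1) ∧ ∀ ε, 0 < ε →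
      ε ≤ (t₀ + (clock ω 0 (k + 1) - α 0) / β 0) - t₀ →
      l ((t₀ + (clock ω 0 (k + 1) - α 0) / β 0) - ε) y <
        l ((t₀ + (clock ω 0 (k + 1) - α 0) / β 0) + ε) y := by
  set s := t₀ + (clock ω 0 (k + 1) - α 0) / β 0 with hs
  have hsβ : β 0 * (s - t₀) = clock ω 0 (k + 1) - α 0 := by rw [hs]; field_simp; ring
  by_contra hcon
  push Not at hcon
  obtain ⟨ε1, h10, h11, h12⟩ := hcon 1 (Or.inl rfl)
  obtain ⟨ε2, h20, h21, h22⟩ := hcon (-1) (Or.inr rfl)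
  have g1 := hg 0 k
  have g2 := hg 0 (k + 1)
  have c1 := clock_succ ω 0 k
  have c2 := clock_succ ω 0 (k + 1)
  set d := min (gap ω 0 k) (gap ω 0 (k + 1)) with hd
  have hd0 : 0 < d := lt_min g1 g2
  have hd1 : d ≤ gap ω 0 k := min_le_left _ _
  have hd2 : d ≤ gap ω 0 (k + 1) := min_le_right _ _
  set ε := min (min ε1 ε2) (d / (2 * β 0)) with hε
  have hε0 : 0 < ε := lt_min (lt_min h10 h20) (by positivity)
  have e1 : ε ≤ ε1 := (min_le_left _ _).trans (min_le_left _ _)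
  have e2 : ε ≤ ε2 := (min_le_left _ _).trans (min_le_right _ _)
  have e3 : β 0 * ε < d := by
    have : ε ≤ d / (2 * β 0) := min_le_right _ _
    calc β 0 * ε ≤ β 0 * (d / (2 * β 0)) := by gcongr
      _ = d / 2 := by field_simp
      _ < d := by linarith
  have hβε : 0 < β 0 * ε := by positivity
  have m0 : l (s - ε) 0 = k := by
    refine eq_of_clock_bounds hg (hl.lower 0 (by simp) _ (by linarith))
      (hl.upper 0 (by simp) _ (by linarith)) ?_ ?_ <;> nlinarith
  have m1 : l (s + ε) 0 = k + 1 := by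
    refine eq_of_clock_bounds hg (hl.lower 0 (by simp) _ (by linarith))
      (hl.upper 0 (by simp) _ (by linarith)) ?_ ?_ <;> nlinarith
  have n1 : l (s - ε) 1 = l (s + ε) 1 := by
    refine le_antisymm (hl.mono _ _ _ (by linarith)) ?_
    exact (hl.mono 1 _ _ (by linarith)).trans (h12.trans (hl.mono 1 _ _ (by linarith)))
  have n2 : l (s - ε) (-1) = l (s + ε) (-1) := by
    refine le_antisymm (hl.mono _ _ _ (by linarith)) ?_
    exact (hl.mono (-1) _ _ (by linarith)).trans (h22.trans (hl.mono (-1) _ _ (by linarith)))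
  obtain ⟨c, hc⟩ := hl.balance
  have b1 := hc (s - ε) (by linarith)
  have b2 := hc (s + ε) (by linarith)
  rw [m0, n1, n2] at b1
  rw [m1, sent_succ, sent_succ] at b2
  rcases hn 0 k with h | h | h
  · exact hj h
  · simp [h] at b2; omega
  · simp [h] at b2; omega

/-- If `y` is active, the time between the two coincidences, measured on both clocks, gives a
relation with integer coefficients `a 0` and `a y`, the factor `1 + lam` being common; `Generic`
forbids it. If the clock of `y` is frozen, it stands at a ring time `clock ω y j`, and `l · y` can
only take the values `j - 1` and `j`, so it cannot increase twice. -/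
lemma LimitRings.false_of_pair {ω : Env} (hg : ∀ x k, 0 < gap ω x k) (hgen : Generic ω)
    {lam : ℝ≥0} {t₀ : ℝ} {a : ℤ → ℕ} {α : ℤ → ℝ} {l : ℝ → ℤ → ℕ}
    (hl : LimitRings ω t₀ (fun x => (1 + lam) * a x) α l) (ha : 0 < a 0) {y : ℤ}
    (hy : y = 1 ∨ y = -1) {k k' : ℕ} (hkk : k < k') (hk : α 0 < clock ω 0 k) {s s' : ℝ}
    (hs : s = t₀ + (clock ω 0 (k + 1) - α 0) / ((1 + lam) * a 0))
    (hs' : s' = t₀ + (clock ω 0 (k' + 1) - α 0) / ((1 + lam) * a 0))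
    (hi : ∀ ε, 0 < ε → ε ≤ s - t₀ → l (s - ε) y < l (s + ε) y)
    (hi' : ∀ ε, 0 < ε → ε ≤ s' - t₀ → l (s' - ε) y < l (s' + ε) y) : False := by
  have hy1 : |y| ≤ 1 := by rcases hy with rfl | rfl <;> simp
  have hmono := clock_strictMono hg 0
  have hc1 : clock ω 0 k < clock ω 0 (k + 1) := hmono (by omega)
  have hc2 : clock ω 0 (k + 1) < clock ω 0 (k' + 1) := hmono (by omega)
  have hβ : 0 < (1 + (lam : ℝ)) * a 0 := by positivity
  have hts : t₀ < s := by
    rw [hs]; have := div_pos (sub_pos.2 (hk.trans hc1)) hβ; linarith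
  have hss : s < s' := by
    rw [hs, hs']; gcongr
  obtain ⟨j, hj⟩ := hl.exists_tie hg hy1 (by positivity) hts hi
  obtain ⟨j', hj'⟩ := hl.exists_tie hg hy1 (by positivity) (hts.trans hss) hi'
  have e1 : (1 + (lam : ℝ)) * a 0 * (s' - s) = clock ω 0 (k' + 1) - clock ω 0 (k + 1) := by
    rw [hs, hs']; field_simp; ring
  rcases Nat.eq_zero_or_pos (a y) with h0 | h0
  · simp only [h0, Nat.cast_zero, mul_zero, zero_mul, add_zero] at hj hj'
    set ε := min ((s' - s) / 2) (s - t₀) with hε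
    have hε0 : 0 < ε := lt_min (by linarith) (by linarith)
    have hε1 : ε ≤ (s' - s) / 2 := min_le_left _ _
    have hε2 : ε ≤ s - t₀ := min_le_right _ _
    have i1 := hi ε hε0 hε2
    have i2 := hi' ε hε0 (by linarith)
    have i3 := hl.mono y (s + ε) (s' - ε) (by linarith)
    have low := hl.upper y hy1 (s - ε) (by linarith)
    have upp := hl.lower y hy1 (s' + ε) (by linarith)
    simp only [h0, Nat.cast_zero, mul_zero, zero_mul, add_zero, hj] at low upp
    have l1 := (clock_strictMono hg y).le_iff_le.1 low
    have l2 := (clock_strictMono hg y).le_iff_le.1 upp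
    omega
  · have e2 : (1 + (lam : ℝ)) * a y * (s' - s) = clock ω y j' - clock ω y j := by
      rw [← hj, ← hj']; ring
    have hjj : j < j' := by
      refine (clock_strictMono hg y).lt_iff_lt.1 ?_
      have : 0 < (1 + (lam : ℝ)) * a y * (s' - s) :=
        mul_pos (by positivity) (by linarith)
      linarith
    refine hgen y hy (a 0) (a y) j j' (k + 1) (k' + 1) ha h0 hjj (by omega) ?_
    rw [← e1, ← e2]; ring

/-- Pigeonhole: three jumps from the origin are compensated by two neighbours. Only rings beyond the
internal time reached at `t₀` are considered. -/
lemma LimitRings.false {ω : Env} {K : ℝ} (h : Regular ω K) (hgen : Generic ω)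
    (hjump : ∃ᶠ k in atTop, instr ω 0 k ≠ .sleep)
    {lam : ℝ≥0} {t₀ : ℝ} {a : ℤ → ℕ} {α : ℤ → ℝ} {l : ℝ → ℤ → ℕ}
    (hl : LimitRings ω t₀ (fun x => (1 + lam) * a x) α l) (ha : 0 < a 0) : False := by
  have hev : ∀ᶠ k : ℕ in atTop, α 0 < clock ω 0 k := by
    obtain ⟨n, hn⟩ := exists_nat_gt (4 * α 0 + K)
    filter_upwards [eventually_ge_atTop n] with k hk
    have h1 := h.rings_le 0 k
    have h2 : (n : ℝ) ≤ k := by exact_mod_cast hk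
    simp only [Int.natAbs_zero, pow_zero, mul_one] at h1
    linarith
  have hβ : 0 < (1 + (lam : ℝ)) * a 0 := by positivity
  have hinf := Nat.frequently_atTop_iff_infinite.1 (hjump.and_eventually hev)
  obtain ⟨k1, hk1, -⟩ := hinf.exists_gt 0
  obtain ⟨k2, hk2, h12⟩ := hinf.exists_gt k1
  obtain ⟨k3, hk3, h23⟩ := hinf.exists_gt k2
  obtain ⟨y1, hy1, i1⟩ := hl.exists_increase h.nn h.gap_pos hβ hk1.1
  obtain ⟨y2, hy2, i2⟩ := hl.exists_increase h.nn h.gap_pos hβ hk2.1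
  obtain ⟨y3, hy3, i3⟩ := hl.exists_increase h.nn h.gap_pos hβ hk3.1
  have key : y1 = y2 ∨ y1 = y3 ∨ y2 = y3 := by omega
  rcases key with rfl | rfl | rfl
  · exact hl.false_of_pair h.gap_pos hgen ha hy1 h12 hk1.2 rfl rfl i1 i2
  · exact hl.false_of_pair h.gap_pos hgen ha hy1 (h12.trans h23) hk1.2 rfl rfl i1 i3
  · exact hl.false_of_pair h.gap_pos hgen ha hy2 h23 hk2.2 rfl rfl i2 i3

/-- Once the state of `x` is constant, its internal time grows linearly, in the limit of large
systems. -/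
lemma Regular.tendsto_internalTime_sub {ω : Env} {K : ℝ} (h : Regular ω K) {lam : ℝ≥0} {x : ℤ}
    {c : SiteState} {t₀ : ℝ≥0} (hc : ∀ t, t₀ ≤ t → HasState lam ω t x c) {s : ℝ≥0} (hs : t₀ ≤ s) :
    Tendsto (fun M => internalTime lam ω M x s - internalTime lam ω M x t₀) atTop
      (𝓝 ((1 + lam) * c.active * (s - t₀))) := by
  simp only [h.internalTime_sub]
  have e : (1 + (lam : ℝ)) * c.active * (s - t₀) =
      ∫ u in (t₀ : ℝ)..s, (1 + (lam : ℝ)) * c.active := by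
    rw [intervalIntegral.integral_const]; simp [mul_comm]
  have hle : (t₀ : ℝ) ≤ s := hs
  rw [e]
  refine intervalIntegral.tendsto_integral_filter_of_dominated_convergence
    (fun _ => 21 * (1 + lam) * timeBound lam K x s) ?_ ?_ ?_ ?_
  · exact Eventually.of_forall fun M => (h.measurable_speedAt lam M x).aestronglyMeasurable
  · refine Eventually.of_forall fun M => Eventually.of_forall fun u hu => ?_
    rw [Set.uIoc_of_le hle] at hu
    have hu0 : 0 ≤ u := t₀.2.trans hu.1.le
    rw [Real.norm_of_nonneg (speedAt_nonneg _ _ _ _ _)]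
    have := (h.internalTime_le lam M x ⟨u, hu0⟩).2
    refine this.trans ?_
    have := h.nonneg
    unfold timeBound
    gcongr
    exact hu.2
  · simp
  · refine Eventually.of_forall fun u hu => ?_
    rw [Set.uIoc_of_le hle] at hu
    have hu1 : t₀ ≤ u.toNNReal := NNReal.le_toNNReal_of_coe_le hu.1.le
    refine tendsto_const_nhds.congr' ?_
    filter_upwards [hc _ hu1] with M hM
    simp [speedAt, speed, hM]

/-- Uniformity in `M` makes the odometer constant along an ultrafilter on the system sizes. -/
lemma Regular.ringsAt_le {ω : Env} {K : ℝ} (h : Regular ω K) (lam : ℝ≥0) (x : ℤ) (t : ℝ≥0) :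
    ∃ B : ℕ, ∀ M, ringsAt lam ω M t x ≤ B := by
  obtain ⟨B, hB⟩ := exists_nat_ge (4 * timeBound lam K x t + K * 2 ^ x.natAbs)
  refine ⟨B, fun M => ?_⟩
  have h1 := h.rings_le x (ringsAt lam ω M t x)
  have h2 := (h.clock_le_internalTime lam M x t).trans (h.internalTime_le lam M x t).1
  have : ((ringsAt lam ω M t x : ℕ) : ℝ) ≤ B := by linarith
  exact_mod_cast this

lemma internalTime_nonneg (lam : ℝ≥0) (ω : Env) (M : ℕ) (x : ℤ) (t : ℝ≥0) :
    0 ≤ internalTime lam ω M x t :=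
  intervalIntegral.integral_nonneg t.2 fun u _ => speedAt_nonneg lam ω M x u

/-- Legal sequences of topplings from finitely many particles topple the origin arbitrarily
often. -/
def Unstable (ω : Env) : Prop :=
  ∀ J : ℕ, ∃ (n : ℕ) (η₀ η : Config) (k : ℤ → ℕ), Legal ω η₀ η k ∧ AllActive η₀ ∧
    (∀ M, n ≤ M → ∀ x, (η₀ x).count ≤ ((start ω M).config x).count) ∧ J ≤ k 0

/-- Fixation provides, for each time separately, a state reached for all large `M`, without
uniformity in time. Integrals of the speed nevertheless converge by domination, which is enough in
both cases, according to whether the eventual state of the origin has active particles. -/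
theorem Regular.not_fixates {ω : Env} {K : ℝ} (h : Regular ω K) (hgen : Generic ω)
    (hjump : ∃ᶠ k in atTop, instr ω 0 k ≠ .sleep) (hun : Unstable ω) (lam : ℝ≥0) :
    ¬ Fixates lam ω := by
  intro hfix
  choose c hc using hfix
  have hc' : ∀ x, ∃ t, ∀ s, t ≤ s → HasState lam ω s x (c x) := fun x => eventually_atTop.1 (hc x)
  choose T hT using hc'
  set t₀ : ℝ≥0 := max (T 0) (max (T 1) (T (-1))) with ht₀
  have hst : ∀ x : ℤ, |x| ≤ 1 → ∀ t, t₀ ≤ t → HasState lam ω t x (c x) := by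
    intro x hx t ht
    have hx' : x = 0 ∨ x = 1 ∨ x = -1 := by have := abs_le.1 hx; omega
    refine hT x t (le_trans ?_ ht)
    rcases hx' with rfl | rfl | rfl <;> simp [ht₀]
  have hlim : ∀ x : ℤ, |x| ≤ 1 → ∀ s, t₀ ≤ s → Tendsto
      (fun M => internalTime lam ω M x s - internalTime lam ω M x t₀) atTop
      (𝓝 ((1 + lam) * (c x).active * (s - t₀))) :=
    fun x hx s hs => h.tendsto_internalTime_sub (hst x hx) hs
  rcases Nat.eq_zero_or_pos (c 0).active with h0 | h0
  -- By `rings_le`, such a `J` forces `clock ω 0 J` beyond `timeBound lam K 0 t₀ + 1`, whereas the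
  -- internal time of the origin grows by less than one after `t₀` when `M` is large.
  · obtain ⟨J, hJ⟩ := exists_nat_gt (4 * (timeBound lam K 0 t₀ + 1) + K)
    obtain ⟨n, η₀, η, k, hl, hη₀, hle, hk⟩ := hun J
    obtain ⟨s, hs⟩ := h.exists_time_ge lam hl hη₀ hle
    have hlim0 := hlim 0 (by simp) (max s t₀) (le_max_right _ _)
    rw [h0] at hlim0
    simp only [Nat.cast_zero, mul_zero, zero_mul] at hlim0
    have hev := (hlim0.eventually_lt_const (by norm_num : (0 : ℝ) < 1)).and
      (eventually_ge_atTop n)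
    obtain ⟨M, hM1, hM2⟩ := hev.exists
    have h1 := (hs M hM2 0).trans (ringsAt_mono h lam M 0 (le_max_left s t₀))
    have h2 := h.clock_le_internalTime lam M 0 (max s t₀)
    have h3 := (clock_strictMono h.gap_pos 0).monotone (hk.trans h1)
    have h4 := h.rings_le 0 J
    have h5 := (h.internalTime_le lam M 0 t₀).1
    simp only [Int.natAbs_zero, pow_zero, mul_one] at h4
    linarith
  -- The internal times at `t₀` need not converge as `M → ∞`. Limits are taken along a nonprincipal
  -- ultrafilter, where bounded reals converge and bounded integers become constant.
  · have hα : ∀ x, ∃ α, Tendsto (fun M => internalTime lam ω M x t₀) (hyperfilter ℕ) (𝓝 α) := by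
      intro x
      have hmem : ∀ M, internalTime lam ω M x t₀ ∈ Set.Icc 0 (timeBound lam K x t₀) :=
        fun M => ⟨internalTime_nonneg lam ω M x t₀, (h.internalTime_le lam M x t₀).1⟩
      obtain ⟨α, -, hα⟩ := isCompact_Icc.ultrafilter_le_nhds
        ((hyperfilter ℕ).map fun M => internalTime lam ω M x t₀)
        (by
          rw [Ultrafilter.coe_map, le_principal_iff]
          exact Filter.mem_map.2 (Eventually.of_forall hmem))
      exact ⟨α, hα⟩
    choose α hα using hα
    have hl : ∀ (s : ℝ≥0) (x : ℤ), ∃ l, ∀ᶠ M in (hyperfilter ℕ : Filter ℕ),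
        ringsAt lam ω M s x = l := by
      intro s x
      obtain ⟨B, hB⟩ := h.ringsAt_le lam x s
      have := (Ultrafilter.finite_biUnion_mem_iff (f := hyperfilter ℕ) (Set.finite_Iic B)
        (s := fun l => {M | ringsAt lam ω M s x = l})).1 ?_
      · obtain ⟨l, -, hl⟩ := this
        exact ⟨l, hl⟩
      · refine Filter.mem_of_superset Filter.univ_mem fun M _ => ?_
        simpa using hB M
    choose l hl using hl
    have hT' : ∀ x : ℤ, |x| ≤ 1 → ∀ s : ℝ, (t₀ : ℝ) ≤ s →
        Tendsto (fun M => internalTime lam ω M x s.toNNReal) (hyperfilter ℕ)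
          (𝓝 (α x + (1 + lam) * (c x).active * (s - t₀))) := by
      intro x hx s hs
      have hs0 : 0 ≤ s := t₀.2.trans hs
      have h1 := (hlim x hx s.toNNReal (NNReal.le_toNNReal_of_coe_le hs)).mono_left
        Nat.hyperfilter_le_atTop
      rw [Real.coe_toNNReal s hs0] at h1
      have h2 := (hα x).add h1
      rw [Real.coe_toNNReal s hs0]
      refine h2.congr fun M => ?_
      ring
    refine LimitRings.false (t₀ := t₀) (α := α) (a := fun x => (c x).active)
      (l := fun s x => l s.toNNReal x) (lam := lam) h hgen hjump ⟨?_, ?_, ?_, ?_⟩ h0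
    · intro x hx s hs
      refine ge_of_tendsto (hT' x hx s hs) ?_
      filter_upwards [hl s.toNNReal x] with M hM
      rw [← hM]
      exact h.clock_le_internalTime lam M x s.toNNReal
    · intro x hx s hs
      refine le_of_tendsto (hT' x hx s hs) ?_
      filter_upwards [hl s.toNNReal x] with M hM
      rw [← hM]
      exact h.internalTime_le_clock lam M x s.toNNReal
    · intro x s t hst
      obtain ⟨M, h1, h2⟩ := ((hl s.toNNReal x).and (hl t.toNNReal x)).exists
      rw [← h1, ← h2]
      exact ringsAt_mono h lam M x (Real.toNNReal_le_toNNReal hst)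
    -- The constant is the initial minus the final number of particles at the origin.
    · refine ⟨((ω 0).1 : ℤ) - (c 0).count, fun s hs => ?_⟩
      have hc0 := (hst 0 (by simp) s.toNNReal (NNReal.le_toNNReal_of_coe_le hs)).filter_mono
        Nat.hyperfilter_le_atTop
      obtain ⟨M, h1, h2, h3, h4⟩ := ((hl s.toNNReal 0).and ((hl s.toNNReal 1).and
        ((hl s.toNNReal (-1)).and hc0))).exists
      have hb := (legal_ringsAt h lam M s.toNNReal).balance h.nn 0
      have hstart : ((start ω M).config 0).count = (ω 0).1 := by simp [start]
      rw [hstart, h4, h1] at hb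
      simp only [zero_sub, zero_add, h2, h3] at hb
      omega

end ARW

namespace ARW

/-! ### Product measures -/

section Product

variable {ι α A : Type*} [MeasurableSpace α] [MeasurableSpace A]

/-- Updating one coordinate of a product measure by a map that preserves its law, with the help of
independent randomness, preserves the product measure. -/
lemma measurePreserving_update [DecidableEq ι] {ν : Measure α} [IsProbabilityMeasure ν]
    {q : Measure A} [IsProbabilityMeasure q] {φ : α × A → α}
    (hφ : MeasurePreserving φ (ν.prod q) ν) (i : ι) :
    MeasurePreserving (fun z : (ι → α) × A => Function.update z.1 i (φ (z.1 i, z.2)))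
      ((Measure.infinitePi fun _ : ι => ν).prod q) (Measure.infinitePi fun _ : ι => ν) := by
  have hm : Measurable (fun z : (ι → α) × A => Function.update z.1 i (φ (z.1 i, z.2))) := by
    refine measurable_pi_lambda _ fun j => ?_
    by_cases hj : j = i
    · subst hj
      simp only [Function.update_self]
      exact hφ.measurable.comp (by fun_prop)
    · simp only [ne_eq, hj, not_false_eq_true, Function.update_of_ne]
      fun_prop
  refine ⟨hm, Measure.eq_infinitePi _ fun s t ht => ?_⟩
  have hbox : MeasurableSet (Set.pi (s : Set ι) t) :=
    MeasurableSet.pi s.countable_toSet fun j _ => ht j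
  rw [Measure.map_apply hm hbox, Measure.prod_apply_symm (hm hbox)]
  by_cases hi : i ∈ s
  · have key : ∀ a : A, (Measure.infinitePi fun _ : ι => ν)
        ((fun ω : ι → α => (ω, a)) ⁻¹' ((fun z : (ι → α) × A =>
          Function.update z.1 i (φ (z.1 i, z.2))) ⁻¹' Set.pi s t)) =
        (∏ j ∈ s.erase i, ν (t j)) * ν ((fun e => (e, a)) ⁻¹' (φ ⁻¹' t i)) := by
      intro a
      have hset : ((fun ω : ι → α => (ω, a)) ⁻¹' ((fun z : (ι → α) × A =>
          Function.update z.1 i (φ (z.1 i, z.2))) ⁻¹' Set.pi s t)) =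
          Set.pi s (Function.update t i ((fun e => (e, a)) ⁻¹' (φ ⁻¹' t i))) := by
        ext ω
        simp only [Set.mem_preimage, Set.mem_pi, Finset.mem_coe]
        refine forall₂_congr fun j _ => ?_
        by_cases hj : j = i
        · subst hj; simp
        · simp [hj]
      rw [hset, Measure.infinitePi_pi, ← Finset.mul_prod_erase s _ hi, mul_comm]
      · congr 1
        · refine Finset.prod_congr rfl fun j hj => ?_
          rw [Function.update_of_ne (Finset.ne_of_mem_erase hj)]
        · simp
      · intro j _
        by_cases hj : j = i
        · subst hj
          simp only [Function.update_self]
          exact measurable_prodMk_right (hφ.measurable (ht j))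
        · simpa [hj] using ht j
    simp only [key]
    rw [lintegral_const_mul, ← Measure.prod_apply_symm (hφ.measurable (ht i)),
      hφ.measure_preimage (ht i).nullMeasurableSet, Finset.prod_erase_mul _ _ hi]
    exact measurable_measure_prodMk_right (hφ.measurable (ht i))
  · have hset : ∀ a : A, ((fun ω : ι → α => (ω, a)) ⁻¹' ((fun z : (ι → α) × A =>
        Function.update z.1 i (φ (z.1 i, z.2))) ⁻¹' Set.pi s t)) = Set.pi s t := by
      intro a
      ext ω
      simp only [Set.mem_preimage, Set.mem_pi, Finset.mem_coe]
      refine forall₂_congr fun j hj => ?_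
      have : j ≠ i := fun h => hi (h ▸ hj)
      simp [this]
    simp only [hset]
    rw [Measure.infinitePi_pi _ (fun j _ => ht j)]
    simp

/-- An event of positive probability happens infinitely often along i.i.d. trials. -/
lemma ae_frequently_mem {ν : Measure α} [IsProbabilityMeasure ν] {S : Set α}
    (hS : MeasurableSet S) (hpos : ν S ≠ 0) {f : ℕ → ι} (hf : Function.Injective f) :
    ∀ᵐ ω ∂(Measure.infinitePi fun _ : ι => ν), ∃ᶠ j in atTop, ω (f j) ∈ S := by
  classical
  have h1 : ν Sᶜ < 1 := by
    rw [prob_compl_eq_one_sub hS]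
    exact ENNReal.sub_lt_self (by simp) (by simp) hpos
  have h2 : ∀ m : ℕ, ∀ᵐ ω ∂(Measure.infinitePi fun _ : ι => ν), ∃ j, m ≤ j ∧ ω (f j) ∈ S := by
    intro m
    rw [ae_iff]
    have hle : ∀ l : ℕ, (Measure.infinitePi fun _ : ι => ν)
        {ω | ¬ ∃ j, m ≤ j ∧ ω (f j) ∈ S} ≤ ν Sᶜ ^ l := by
      intro l
      have hsub : {ω : ι → α | ¬ ∃ j, m ≤ j ∧ ω (f j) ∈ S} ⊆
          Set.pi ((Finset.Ico m (m + l)).image f : Finset ι) (fun _ => Sᶜ) := by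
        intro ω hω i hi
        obtain ⟨j, hj, rfl⟩ := Finset.mem_image.1 (Finset.mem_coe.1 hi)
        intro hjS
        exact hω ⟨j, (Finset.mem_Ico.1 hj).1, hjS⟩
      refine (measure_mono hsub).trans ?_
      rw [Measure.infinitePi_pi _ (fun _ _ => hS.compl), Finset.prod_const,
        Finset.card_image_of_injective _ hf]
      simp
    exact le_antisymm (ge_of_tendsto' (ENNReal.tendsto_pow_atTop_nhds_zero_of_lt_one h1) hle)
      zero_le
  filter_upwards [ae_all_iff.2 h2] with ω hω
  rw [frequently_atTop]
  exact hω

/-- Expectation of a product of functions of the first coordinates of an i.i.d. sequence. -/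
lemma lintegral_prod_infinitePi {ν : Measure α} [IsProbabilityMeasure ν] {f : α → ℝ≥0∞}
    (hf : Measurable f) (s : Finset ι) :
    ∫⁻ ω, ∏ i ∈ s, f (ω i) ∂(Measure.infinitePi fun _ : ι => ν) = (∫⁻ a, f a ∂ν) ^ s.card := by
  rw [lintegral_prod_eq_prod_lintegral_of_indepFun s (fun i (ω : ι → α) => f (ω i))
    (iIndepFun_infinitePi (P := fun _ : ι => ν) (X := fun _ => f) fun _ => hf)
    (fun i => hf.comp (measurable_pi_apply i)), Finset.prod_congr rfl, Finset.prod_const]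
  intro i _
  exact (measurePreserving_eval_infinitePi (fun _ : ι => ν) i).lintegral_comp hf

end Product

/-! ### Elementary computations with the laws involved -/

lemma expLaw_eq : expLaw = volume.withDensity (exponentialPDF 1) := rfl

lemma lintegral_exp_neg_expLaw :
    ∫⁻ x, ENNReal.ofReal (Real.exp (-(4 * x))) ∂expLaw = ENNReal.ofReal (1 / 5) := by
  have hm : Measurable (exponentialPDF 1) := (measurable_exponentialPDFReal 1).ennreal_ofReal
  rw [expLaw_eq, lintegral_withDensity_eq_lintegral_mul _ hm (by fun_prop)]
  have : ∀ x, (exponentialPDF 1 * fun x => ENNReal.ofReal (Real.exp (-(4 * x)))) x =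
      ENNReal.ofReal (1 / 5) * exponentialPDF 5 x := by
    intro x
    rw [Pi.mul_apply]
    rcases lt_or_ge x 0 with hx | hx
    · simp [exponentialPDF_of_neg hx]
    · rw [exponentialPDF_of_nonneg hx, exponentialPDF_of_nonneg hx,
        ← ENNReal.ofReal_mul (by positivity), ← ENNReal.ofReal_mul (by positivity)]
      congr 1
      rw [one_mul, ← Real.exp_add, ← mul_assoc]
      norm_num
      ring_nf
  simp only [this]
  have hm5 : Measurable (exponentialPDF 5) := (measurable_exponentialPDFReal 5).ennreal_ofReal
  rw [lintegral_const_mul _ hm5, lintegral_exponentialPDF_eq_one (by norm_num), mul_one]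

lemma expLaw_singleton (v : ℝ) : expLaw {v} = 0 :=
  withDensity_absolutelyContinuous _ _ (by simp)

lemma ae_pos_expLaw : ∀ᵐ x ∂expLaw, 0 < x := by
  have h := cdf_expMeasure_eq (r := 1) one_pos 0
  have hp : IsProbabilityMeasure (expMeasure 1) := isProbabilityMeasure_expMeasure one_pos
  rw [cdf_eq_real] at h
  simp only [le_refl, mul_zero, neg_zero, Real.exp_zero, sub_self, if_true] at h
  rw [ae_iff]
  have e : {a : ℝ | ¬ 0 < a} = Set.Iic 0 := by ext; simp
  rw [e]
  exact (measureReal_eq_zero_iff).1 h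

lemma expLaw_Ici_one_ne_zero : expLaw (Set.Ici 1) ≠ 0 := by
  intro h
  have hc := cdf_expMeasure_eq (r := 1) one_pos 1
  have hp : IsProbabilityMeasure (expMeasure 1) := isProbabilityMeasure_expMeasure one_pos
  rw [cdf_eq_real] at hc
  have h1 : (expMeasure 1).real (Set.Iic 1) = 1 := by
    have h2 : expMeasure 1 (Set.Iic 1)ᶜ = 0 :=
      measure_mono_null (by intro x hx; simp at hx ⊢; exact hx.le) h
    rw [measureReal_def, (prob_compl_eq_zero_iff measurableSet_Iic).1 h2]; simp
  rw [h1] at hc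
  have := Real.exp_pos (-1)
  norm_num at hc
  linarith

lemma lintegral_pow_poissonMeasure (mu : ℝ≥0) {a : ℝ} (ha : 0 ≤ a) :
    ∫⁻ n, ENNReal.ofReal (a ^ n) ∂(poissonMeasure mu) =
      ENNReal.ofReal (Real.exp (mu * (a - 1))) := by
  rw [poissonMeasure, lintegral_sum_measure]
  simp only [lintegral_smul_measure, lintegral_dirac, smul_eq_mul]
  have hs : HasSum (fun n : ℕ => Real.exp (-mu) * (mu : ℝ) ^ n / n.factorial * a ^ n)
      (Real.exp (mu * (a - 1))) := by
    have h := (NormedSpace.expSeries_div_hasSum_exp ((mu : ℝ) * a)).mul_left (Real.exp (-mu))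
    rw [← Real.exp_eq_exp_ℝ, ← Real.exp_add] at h
    rw [show (mu : ℝ) * (a - 1) = -mu + mu * a by ring]
    refine h.congr_fun fun n => ?_
    rw [mul_pow]; ring
  rw [← hs.tsum_eq, ENNReal.ofReal_tsum_of_nonneg (fun n => by positivity) hs.summable]
  refine tsum_congr fun n => ?_
  rw [← ENNReal.ofReal_mul (by positivity)]

/-- The crude estimate `n ≤ 2 ^ n` suffices, since only finite bounds on means are needed. -/
lemma lintegral_poissonMeasure_le (mu : ℝ≥0) :
    ∫⁻ n, (n : ℝ≥0∞) ∂(poissonMeasure mu) ≤ ENNReal.ofReal (Real.exp mu) := by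
  have h := lintegral_pow_poissonMeasure mu (a := 2) (by norm_num)
  rw [show (mu : ℝ) * (2 - 1) = mu by ring] at h
  rw [← h]
  refine lintegral_mono fun n => ?_
  rw [← ENNReal.ofReal_natCast]
  exact ENNReal.ofReal_le_ofReal (by exact_mod_cast (Nat.lt_two_pow_self).le)

lemma lintegral_instructionLaw (p : PMF ℤ) (hp : NearestNeighbour p) (lam : ℝ≥0)
    (f : Instruction → ℝ≥0∞) :
    ∫⁻ i, f i ∂(instructionLaw p lam) =
      (lam / (1 + lam) : ℝ≥0) * f .sleep + (1 / (1 + lam) : ℝ≥0) *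
        (p 1 * f (.jump 1) + p (-1) * f (.jump (-1))) := by
  have hm : ∀ g : Instruction → ℝ≥0∞, Measurable g := fun g => measurable_from_top
  have hj : Measurable Instruction.jump := measurable_from_top
  rw [instructionLaw, lintegral_add_measure, lintegral_smul_measure, lintegral_smul_measure,
    lintegral_dirac' _ (hm f), ← PMF.toMeasure_map _ _ hj, lintegral_map (hm f) hj,
    lintegral_countable']
  simp only [PMF.toMeasure_apply_singleton _ _ (measurableSet_singleton _)]
  have h : ∑' z : ℤ, f (.jump z) * p z = p 1 * f (.jump 1) + p (-1) * f (.jump (-1)) := by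
    rw [tsum_eq_sum (s := {1, -1}), Finset.sum_pair (by norm_num), mul_comm, mul_comm (f _)]
    intro z hz
    rw [hp z, mul_zero]
    intro h1
    have : z = 1 ∨ z = -1 := by have := eq_or_eq_neg_of_abs_eq h1; tauto
    simp at hz; tauto
  rw [h]
  rfl

lemma ae_instructionLaw (p : PMF ℤ) (hp : NearestNeighbour p) (lam : ℝ≥0) :
    ∀ᵐ i ∂(instructionLaw p lam), i = .sleep ∨ i = .jump 1 ∨ i = .jump (-1) := by
  classical
  rw [ae_iff, ← lintegral_indicator_one (by trivial), lintegral_instructionLaw p hp]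
  simp

lemma instructionLaw_ne_sleep (p : PMF ℤ) (hp : NearestNeighbour p) (lam : ℝ≥0) :
    instructionLaw p lam {.sleep}ᶜ ≠ 0 := by
  intro h
  have h1 : instructionLaw p lam {.sleep} = 1 := (prob_compl_eq_zero_iff (by trivial)).1 h
  rw [← lintegral_indicator_one (by trivial), lintegral_instructionLaw p hp] at h1
  simp only [Set.mem_singleton_iff, Set.indicator_of_mem, Pi.one_apply, mul_one, reduceCtorEq,
    not_false_eq_true, Set.indicator_of_notMem, mul_zero, add_zero] at h1
  have h2 : lam / (1 + lam) = 1 := by exact_mod_cast h1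
  have h3 : (1 : ℝ≥0) + lam ≠ 0 := by positivity
  rw [div_eq_one_iff_eq h3] at h2
  have h4 : (lam : ℝ) = 1 + lam := by exact_mod_cast h2
  linarith

end ARW

namespace ARW

/-! ### Almost sure regularity of the environment -/

variable {p : PMF ℤ} {lam mu : ℝ≥0}

instance (p : PMF ℤ) (lam mu : ℝ≥0) : IsProbabilityMeasure (law p lam mu) := by
  unfold law; infer_instance

/-- Law of an instruction and a gap. -/
noncomputable def markLaw (p : PMF ℤ) (lam : ℝ≥0) : Measure (Instruction × ℝ) :=
  (instructionLaw p lam).prod expLaw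

instance (p : PMF ℤ) (lam : ℝ≥0) : IsProbabilityMeasure (markLaw p lam) := by
  unfold markLaw; infer_instance

/-- Replace the instruction and the gap of the `k`-th ring at `x`. -/
def replace (x : ℤ) (k : ℕ) (z : Env × (Instruction × ℝ)) : Env :=
  Function.update z.1 x ((z.1 x).1, Function.update (z.1 x).2 k z.2)

/-- Resampling a single mark takes the place of conditioning on all the others. It serves both for
`ae_generic` and for the one-step estimates of the sweep. -/
lemma measurePreserving_replace (p : PMF ℤ) (lam mu : ℝ≥0) (x : ℤ) (k : ℕ) :
    MeasurePreserving (replace x k) ((law p lam mu).prod (markLaw p lam)) (law p lam mu) := by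
  have h1 := measurePreserving_update (ι := ℕ) (ν := markLaw p lam) (q := markLaw p lam)
    (φ := fun z => z.2) measurePreserving_snd k
  have h2 : MeasurePreserving
      (fun z : SiteEnv × (Instruction × ℝ) => (z.1.1, Function.update z.1.2 k z.2))
      ((siteLaw p lam mu).prod (markLaw p lam)) (siteLaw p lam mu) := by
    have h3 := (measurePreserving_prodAssoc (poissonMeasure mu)
      (Measure.infinitePi fun _ : ℕ => markLaw p lam) (markLaw p lam))
    exact ((MeasurePreserving.id (poissonMeasure mu)).prod h1).comp h3
  exact measurePreserving_update h2 x

lemma measurePreserving_mark (p : PMF ℤ) (lam mu : ℝ≥0) (x : ℤ) (k : ℕ) :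
    MeasurePreserving (fun ω : Env => (ω x).2 k) (law p lam mu) (markLaw p lam) :=
  (measurePreserving_eval_infinitePi (fun _ : ℕ => markLaw p lam) k).comp
    (measurePreserving_snd.comp
      (measurePreserving_eval_infinitePi (fun _ : ℤ => siteLaw p lam mu) x))

lemma measurePreserving_instr (p : PMF ℤ) (lam mu : ℝ≥0) (x : ℤ) (k : ℕ) :
    MeasurePreserving (fun ω : Env => instr ω x k) (law p lam mu) (instructionLaw p lam) :=
  measurePreserving_fst.comp (measurePreserving_mark p lam mu x k)

lemma measurePreserving_gap (p : PMF ℤ) (lam mu : ℝ≥0) (x : ℤ) (k : ℕ) :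
    MeasurePreserving (fun ω : Env => gap ω x k) (law p lam mu) expLaw :=
  measurePreserving_snd.comp (measurePreserving_mark p lam mu x k)

lemma measurePreserving_count (p : PMF ℤ) (lam mu : ℝ≥0) (x : ℤ) :
    MeasurePreserving (fun ω : Env => (ω x).1) (law p lam mu) (poissonMeasure mu) :=
  measurePreserving_fst.comp (measurePreserving_eval_infinitePi (fun _ : ℤ => siteLaw p lam mu) x)

@[fun_prop]
lemma measurable_gap (x : ℤ) (k : ℕ) : Measurable fun ω : Env => gap ω x k := by
  unfold gap; fun_prop

@[fun_prop]
lemma measurable_clock (x : ℤ) (k : ℕ) : Measurable fun ω : Env => clock ω x k := by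
  unfold clock; fun_prop

lemma ae_nnInstr (hp : NearestNeighbour p) : ∀ᵐ ω ∂(law p lam mu), NNInstr ω :=
  ae_all_iff.2 fun x => ae_all_iff.2 fun k =>
    (measurePreserving_instr p lam mu x k).quasiMeasurePreserving.ae (ae_instructionLaw p hp lam)

lemma ae_gap_pos : ∀ᵐ ω ∂(law p lam mu), ∀ x k, 0 < gap ω x k :=
  ae_all_iff.2 fun x => ae_all_iff.2 fun k =>
    (measurePreserving_gap p lam mu x k).quasiMeasurePreserving.ae ae_pos_expLaw

lemma ae_long_gaps : ∀ᵐ ω ∂(law p lam mu), ∀ ε : ℤ, ε = 1 ∨ ε = -1 →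
    ∃ᶠ j : ℕ in atTop, 1 ≤ gap ω (ε * j) 0 := by
  have hm : Measurable fun e : SiteEnv => (e.2 0).2 := by fun_prop
  have hpos : siteLaw p lam mu ((fun e : SiteEnv => (e.2 0).2) ⁻¹' Set.Ici 1) ≠ 0 := by
    have h : MeasurePreserving (fun e : SiteEnv => (e.2 0).2) (siteLaw p lam mu) expLaw :=
      measurePreserving_snd.comp ((measurePreserving_eval_infinitePi
        (fun _ : ℕ => (instructionLaw p lam).prod expLaw) 0).comp measurePreserving_snd)
    rw [h.measure_preimage measurableSet_Ici.nullMeasurableSet]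
    exact expLaw_Ici_one_ne_zero
  refine ae_all_iff.2 fun ε => ?_
  by_cases hε : ε = 1 ∨ ε = -1
  · have hinj : Function.Injective fun j : ℕ => ε * (j : ℤ) := by
      intro a b hab
      rcases hε with rfl | rfl <;> simpa using hab
    filter_upwards [ae_frequently_mem (hm measurableSet_Ici) hpos hinj] with ω hω _
    exact hω
  · exact Eventually.of_forall fun ω h => absurd h hε

lemma ae_frequently_jump (hp : NearestNeighbour p) :
    ∀ᵐ ω ∂(law p lam mu), ∃ᶠ k in atTop, instr ω 0 k ≠ .sleep := by
  have hm : Measurable fun m : Instruction × ℝ => m.1 := measurable_fst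
  have hS : MeasurableSet ({.sleep}ᶜ : Set Instruction) := by trivial
  have hpos : markLaw p lam (Prod.fst ⁻¹' {.sleep}ᶜ) ≠ 0 := by
    have h : MeasurePreserving Prod.fst (markLaw p lam) (instructionLaw p lam) :=
      measurePreserving_fst
    rw [h.measure_preimage hS.nullMeasurableSet]
    exact instructionLaw_ne_sleep p hp lam
  have h := ae_frequently_mem (ι := ℕ) (ν := markLaw p lam) (hm hS) hpos Function.injective_id
  have hmp : MeasurePreserving (fun ω : Env => (ω 0).2) (law p lam mu)
      (Measure.infinitePi fun _ : ℕ => markLaw p lam) :=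
    measurePreserving_snd.comp (measurePreserving_eval_infinitePi (fun _ : ℤ => siteLaw p lam mu) 0)
  filter_upwards [hmp.quasiMeasurePreserving.ae h] with ω hω
  exact hω

/-! ### Effect of resampling one mark; genericity and growth bounds -/

lemma gap_replace (ω : Env) (m : Instruction × ℝ) (x y : ℤ) (k j : ℕ) :
    gap (replace x k (ω, m)) y j = if y = x ∧ j = k then m.2 else gap ω y j := by
  by_cases hy : y = x
  · subst hy
    by_cases hj : j = k
    · subst hj; simp [gap, replace]
    · simp [gap, replace, hj]
  · simp [gap, replace, hy]

lemma instr_replace (ω : Env) (m : Instruction × ℝ) (x y : ℤ) (k j : ℕ) :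
    instr (replace x k (ω, m)) y j = if y = x ∧ j = k then m.1 else instr ω y j := by
  by_cases hy : y = x
  · subst hy
    by_cases hj : j = k
    · subst hj; simp [instr, replace]
    · simp [instr, replace, hj]
  · simp [instr, replace, hy]

lemma count_replace (ω : Env) (m : Instruction × ℝ) (x y : ℤ) (k : ℕ) :
    (replace x k (ω, m) y).1 = (ω y).1 := by
  by_cases hy : y = x
  · subst hy; simp [replace]
  · simp [replace, hy]

lemma clock_replace_of_ne (ω : Env) (m : Instruction × ℝ) {x y : ℤ} (h : y ≠ x) (k j : ℕ) :
    clock (replace x k (ω, m)) y j = clock ω y j :=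
  Finset.sum_congr rfl fun i _ => by rw [gap_replace, if_neg (by tauto)]

lemma clock_replace_of_le (ω : Env) (m : Instruction × ℝ) (x : ℤ) {k j : ℕ} (h : j ≤ k) :
    clock (replace x k (ω, m)) x j = clock ω x j :=
  Finset.sum_congr rfl fun i hi => by
    rw [gap_replace, if_neg]
    have := Finset.mem_range.1 hi
    omega

/-- Only the right-hand side involves the last gap at the origin, with coefficient `b ≠ 0`. Given
everything else, the relation prescribes the value of this gap, and the exponential law has no
atoms. -/
lemma ae_generic : ∀ᵐ ω ∂(law p lam mu), Generic ω := by
  have key : ∀ y : ℤ, (y = 1 ∨ y = -1) → ∀ a b j j' k k' : ℕ, 0 < b → k < k' →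
      ∀ᵐ ω ∂(law p lam mu),
        (a : ℝ) * (clock ω y j' - clock ω y j) ≠ b * (clock ω 0 k' - clock ω 0 k) := by
    intro y hy a b j j' k k' hb hk
    obtain ⟨l, rfl⟩ : ∃ l, k' = l + 1 := ⟨k' - 1, by omega⟩
    have hy0 : y ≠ 0 := by rcases hy with rfl | rfl <;> norm_num
    have hE : MeasurableSet {ω : Env | (a : ℝ) * (clock ω y j' - clock ω y j) =
        b * (clock ω 0 (l + 1) - clock ω 0 k)} := measurableSet_eq_fun (by fun_prop) (by fun_prop)
    have hmp := measurePreserving_replace p lam mu 0 l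
    rw [ae_iff]
    simp only [ne_eq, not_not]
    rw [← hmp.measure_preimage hE.nullMeasurableSet,
      Measure.measure_prod_null (hmp.measurable hE)]
    refine Eventually.of_forall fun ω => ?_
    have hsub : Prod.mk ω ⁻¹' (replace 0 l ⁻¹' {ω : Env |
        (a : ℝ) * (clock ω y j' - clock ω y j) = b * (clock ω 0 (l + 1) - clock ω 0 k)}) ⊆
        Prod.snd ⁻¹' {a * (clock ω y j' - clock ω y j) / b + clock ω 0 k - clock ω 0 l} := by
      intro m hm
      simp only [Set.mem_preimage, Set.mem_ofPred_eq, clock_replace_of_ne _ _ hy0, clock_succ,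
        clock_replace_of_le _ _ _ le_rfl, clock_replace_of_le _ _ _ (Nat.lt_succ_iff.1 hk),
        gap_replace, and_self, if_true] at hm
      simp only [Set.mem_preimage, Set.mem_singleton_iff]
      have hb' : (b : ℝ) ≠ 0 := by positivity
      field_simp
      linarith
    refine measure_mono_null hsub ?_
    have h : MeasurePreserving Prod.snd (markLaw p lam) expLaw := measurePreserving_snd
    rw [h.measure_preimage (measurableSet_singleton _).nullMeasurableSet]
    exact expLaw_singleton _
  have h : ∀ᵐ ω ∂(law p lam mu), ∀ y : ℤ, ∀ a b j j' k k' : ℕ, (y = 1 ∨ y = -1) → 0 < b → k < k' →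
      (a : ℝ) * (clock ω y j' - clock ω y j) ≠ b * (clock ω 0 k' - clock ω 0 k) := by
    simp only [ae_all_iff]
    intro y a b j j' k k'
    exact fun h1 h2 h3 => key y h1 a b j j' k k' h2 h3
  filter_upwards [h] with ω hω y hy a b j j' k k' _ hb _ hk
  exact hω y a b j j' k k' hy hb hk

/-- Dominates all the differences between the number of rings and four times the clock. -/
noncomputable def excess (ω : Env) (x : ℤ) : ℝ≥0∞ :=
  ∑' k : ℕ, ENNReal.ofReal (Real.exp (k - 4 * clock ω x k))

lemma measurable_excess (x : ℤ) : Measurable fun ω => excess ω x := by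
  unfold excess
  refine Measurable.tsum fun k => ?_
  fun_prop

lemma exp_div_five_lt_one : ENNReal.ofReal (Real.exp 1 * (1 / 5)) < 1 := by
  rw [ENNReal.ofReal_lt_one]
  have := Real.exp_one_lt_d9
  linarith

/-- Each gap contributes the factor `E[exp (1 - 4X)] = e / 5 < 1` to the mean, so the series is
geometric. -/
lemma lintegral_excess (x : ℤ) : ∫⁻ ω, excess ω x ∂(law p lam mu) =
    (1 - ENNReal.ofReal (Real.exp 1 * (1 / 5)))⁻¹ := by
  have hmp : MeasurePreserving (fun ω : Env => (ω x).2) (law p lam mu)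
      (Measure.infinitePi fun _ : ℕ => markLaw p lam) :=
    measurePreserving_snd.comp (measurePreserving_eval_infinitePi (fun _ : ℤ => siteLaw p lam mu) x)
  have hf : Measurable fun m : Instruction × ℝ => ENNReal.ofReal (Real.exp (1 - 4 * m.2)) := by
    fun_prop
  have h1 : ∀ k : ℕ, ∫⁻ ω, ENNReal.ofReal (Real.exp (k - 4 * clock ω x k)) ∂(law p lam mu) =
      ENNReal.ofReal (Real.exp 1 * (1 / 5)) ^ k := by
    intro k
    have e : ∀ ω : Env, ENNReal.ofReal (Real.exp (k - 4 * clock ω x k)) =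
        ∏ j ∈ Finset.range k, ENNReal.ofReal (Real.exp (1 - 4 * ((ω x).2 j).2)) := by
      intro ω
      rw [← ENNReal.ofReal_prod_of_nonneg (fun _ _ => (Real.exp_pos _).le), ← Real.exp_sum]
      congr 2
      simp [clock, gap, Finset.mul_sum]
    simp only [e]
    have h2 := hmp.lintegral_comp (f := fun s : ℕ → Instruction × ℝ =>
      ∏ j ∈ Finset.range k, ENNReal.ofReal (Real.exp (1 - 4 * (s j).2))) (by fun_prop)
    rw [h2, lintegral_prod_infinitePi hf, Finset.card_range]
    congr 1
    have h3 : MeasurePreserving Prod.snd (markLaw p lam) expLaw := measurePreserving_snd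
    rw [h3.lintegral_comp (f := fun g : ℝ => ENNReal.ofReal (Real.exp (1 - 4 * g))) (by fun_prop),
      ENNReal.ofReal_mul (Real.exp_pos 1).le, ← lintegral_exp_neg_expLaw,
      ← lintegral_const_mul _ (by fun_prop)]
    refine lintegral_congr fun g => ?_
    rw [← ENNReal.ofReal_mul (Real.exp_pos 1).le, ← Real.exp_add, sub_eq_add_neg]
  unfold excess
  rw [lintegral_tsum (fun k => by fun_prop)]
  simp only [h1]
  exact ENNReal.tsum_geometric _

lemma tsum_half_pow_natAbs_ne_top : ∑' x : ℤ, (2⁻¹ : ℝ≥0∞) ^ x.natAbs ≠ ⊤ := by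
  have hs : Summable fun x : ℤ => ((2⁻¹ : ℝ≥0) ^ x.natAbs) := by
    have hg : Summable fun n : ℕ => (2⁻¹ : ℝ≥0) ^ n :=
      NNReal.summable_geometric (inv_lt_one_of_one_lt₀ (by norm_num))
    rw [← NNReal.summable_coe] at hg ⊢
    refine Summable.of_nat_of_neg (f := fun x : ℤ => (((2⁻¹ : ℝ≥0) ^ x.natAbs : ℝ≥0) : ℝ)) ?_ ?_
    · exact hg
    · simpa only [Int.natAbs_neg, Int.natAbs_natCast] using hg
  have h := ENNReal.tsum_coe_ne_top_iff_summable.2 hs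
  have e : ∀ x : ℤ, (((2⁻¹ : ℝ≥0) ^ x.natAbs : ℝ≥0) : ℝ≥0∞) = 2⁻¹ ^ x.natAbs := by
    intro x
    rw [ENNReal.coe_pow, ENNReal.coe_inv (by norm_num)]
    rfl
  simpa only [e] using h

/-- The sum over the sites of `2 ^ (-|x|)` times the particle number plus the excess has finite
mean. Its almost surely finite value serves as `K`. -/
lemma ae_exists_bounds : ∀ᵐ ω ∂(law p lam mu), ∃ K : ℝ,
    (∀ x, ((ω x).1 : ℝ) ≤ K * 2 ^ x.natAbs) ∧
    ∀ x (k : ℕ), (k : ℝ) ≤ 4 * clock ω x k + K * 2 ^ x.natAbs := by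
  have hfin : ∫⁻ ω, ∑' x : ℤ, (2⁻¹ : ℝ≥0∞) ^ x.natAbs * (((ω x).1 : ℝ≥0∞) + excess ω x)
      ∂(law p lam mu) ≠ ⊤ := by
    have hmc : ∀ x, Measurable fun ω : Env => ((ω x).1 : ℝ≥0∞) := by
      intro x
      exact (measurable_from_top (f := fun n : ℕ => (n : ℝ≥0∞))).comp (by fun_prop)
    have hm : ∀ x, Measurable fun ω : Env => ((ω x).1 : ℝ≥0∞) + excess ω x :=
      fun x => (hmc x).add (measurable_excess x)
    rw [lintegral_tsum (fun x => ((hm x).const_mul _).aemeasurable)]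
    refine ne_top_of_le_ne_top (b := ∑' x : ℤ, (2⁻¹ : ℝ≥0∞) ^ x.natAbs *
      (ENNReal.ofReal (Real.exp mu) + (1 - ENNReal.ofReal (Real.exp 1 * (1 / 5)))⁻¹)) ?_ ?_
    · rw [ENNReal.tsum_mul_right]
      refine ENNReal.mul_ne_top tsum_half_pow_natAbs_ne_top (ENNReal.add_ne_top.2 ⟨by simp, ?_⟩)
      rw [ENNReal.inv_ne_top]
      exact (tsub_pos_of_lt exp_div_five_lt_one).ne'
    · refine ENNReal.tsum_le_tsum fun x => ?_
      rw [lintegral_const_mul _ (hm x), lintegral_add_left (hmc x), lintegral_excess]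
      gcongr
      have := (measurePreserving_count p lam mu x).lintegral_comp
        (measurable_from_top (f := fun n : ℕ => (n : ℝ≥0∞)))
      rw [this]
      exact lintegral_poissonMeasure_le mu
  have hmeas : AEMeasurable (fun ω : Env => ∑' x : ℤ, (2⁻¹ : ℝ≥0∞) ^ x.natAbs *
      (((ω x).1 : ℝ≥0∞) + excess ω x)) (law p lam mu) := by
    refine (Measurable.tsum fun x => ?_).aemeasurable
    refine Measurable.const_mul (Measurable.add ?_ (measurable_excess x)) _
    exact (measurable_from_top (f := fun n : ℕ => (n : ℝ≥0∞))).comp (by fun_prop)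
  filter_upwards [ae_lt_top' hmeas hfin] with ω hω
  set W := ∑' x : ℤ, (2⁻¹ : ℝ≥0∞) ^ x.natAbs * (((ω x).1 : ℝ≥0∞) + excess ω x) with hW
  have hx : ∀ x, ((ω x).1 : ℝ≥0∞) + excess ω x ≤ W * 2 ^ x.natAbs := by
    intro x
    have h1 : (2⁻¹ : ℝ≥0∞) ^ x.natAbs * (((ω x).1 : ℝ≥0∞) + excess ω x) ≤ W :=
      ENNReal.le_tsum (f := fun x : ℤ => (2⁻¹ : ℝ≥0∞) ^ x.natAbs *
        (((ω x).1 : ℝ≥0∞) + excess ω x)) x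
    calc ((ω x).1 : ℝ≥0∞) + excess ω x
        = ((2⁻¹ : ℝ≥0∞) ^ x.natAbs * (((ω x).1 : ℝ≥0∞) + excess ω x)) * 2 ^ x.natAbs := by
          rw [mul_right_comm, ← mul_pow, ENNReal.inv_mul_cancel (by simp) (by simp), one_pow,
            one_mul]
      _ ≤ _ := by gcongr
  have hreal : ∀ (x : ℤ) (r : ℝ), ENNReal.ofReal r ≤ W * 2 ^ x.natAbs → r ≤ W.toReal * 2 ^ x.natAbs := by
    intro x r hr
    have h := ENNReal.toReal_mono (ENNReal.mul_ne_top hω.ne (by simp)) hr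
    rw [ENNReal.toReal_mul, ENNReal.toReal_pow, ENNReal.toReal_ofNat] at h
    exact (Real.le_coe_toNNReal r).trans h
  refine ⟨W.toReal, fun x => hreal x _ ?_, fun x k => ?_⟩
  · rw [ENNReal.ofReal_natCast]
    exact le_self_add.trans (hx x)
  · have h1 : Real.exp (k - 4 * clock ω x k) ≤ W.toReal * 2 ^ x.natAbs := by
      refine hreal x _ (le_trans ?_ (le_add_self.trans (hx x)))
      exact ENNReal.le_tsum (f := fun k : ℕ => ENNReal.ofReal (Real.exp (k - 4 * clock ω x k))) k
    -- A single term of the excess bounds its exponent, through `r ≤ exp r`.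
    have := Real.add_one_le_exp (k - 4 * clock ω x k)
    linarith

lemma ae_regular (hp : NearestNeighbour p) : ∀ᵐ ω ∂(law p lam mu), ∃ K, Regular ω K := by
  filter_upwards [ae_nnInstr hp, ae_gap_pos, ae_long_gaps, ae_exists_bounds] with ω h1 h2 h3 h4
  obtain ⟨K, hK, hK'⟩ := h4
  exact ⟨K, h1, h2, hK, hK', h3⟩

end ARW

namespace ARW

/-! ### The sweeping strategy on the box `[0, n]` -/

/-- Phases of the sweep: spreading the particles until no site of the box has two of them; carrying
the particle that was at `i`, presently at `z`, with `f` failures so far; or finished. -/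
inductive SweepPhase where
  | level
  | walk (i z : ℤ) (f : ℕ)
  | done (f : ℕ)

/-- State of the sweep. -/
structure SweepState where
  config : Config
  odo : ℤ → ℕ
  phase : SweepPhase

/-- Sites of the box with at least two particles. -/
def Crowded (n : ℕ) (η : Config) (y : ℤ) : Prop := 0 ≤ y ∧ y ≤ n ∧ 2 ≤ (η y).count

/-- The first active single particle in `[i, n]`. -/
def IsFirst (n : ℕ) (η : Config) (i y : ℤ) : Prop :=
  i ≤ y ∧ y ≤ n ∧ η y = .num 1 ∧ ∀ w, i ≤ w → w < y → η w ≠ .num 1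

open Classical in
/-- Start carrying the first particle in `[i, n]`. -/
noncomputable def launch (n : ℕ) (η : Config) (i : ℤ) (f : ℕ) : SweepPhase :=
  if h : ∃ y, IsFirst n η i y then .walk h.choose h.choose f else .done f

open Classical in
/-- Continue spreading, or start the sweep. -/
noncomputable def settle (n : ℕ) (η : Config) : SweepPhase :=
  if ∃ y, Crowded n η y then .level else launch n η 0 0

open Classical in
/-- The site toppled next. -/
noncomputable def SweepState.target (n : ℕ) (S : SweepState) : Option ℤ :=
  match S.phase with
  | .level => if h : ∃ y, Crowded n S.config y then some h.choose else none
  | .walk _ z _ => some z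
  | .done _ => none

open Classical in
/-- The phase after the instruction `a` has been executed at the target; `η` is the configuration
before and `η'` the one after that. -/
noncomputable def nextPhase (n : ℕ) (η η' : Config) (a : Instruction) : SweepPhase → SweepPhase
  | .level => settle n η'
  | .walk i z f =>
    match a with
    | .sleep => if z ≤ i then launch n η' (i + 1) (f + 1) else .walk i z f
    | .jump d =>
      if z + d < 0 ∨ n < z + d ∨ (i < z + d ∧ η (z + d) = .num 0) then launch n η' (i + 1) f
      else .walk i (z + d) f
  | .done f => .done f

/-- Execution of the instruction `a` at `y`. -/
noncomputable def SweepState.next (n : ℕ) (S : SweepState) (y : ℤ) (a : Instruction) :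
    SweepState where
  config := topple y a S.config
  odo := Function.update S.odo y (S.odo y + 1)
  phase := nextPhase n S.config (topple y a S.config) a S.phase

/-- One step of the sweep. -/
noncomputable def SweepState.advance (n : ℕ) (ω : Env) (S : SweepState) : SweepState :=
  match S.target n with
  | none => S
  | some y => S.next n y (instr ω y (S.odo y))

/-- The initial particles in the box. -/
def boxConfig (n : ℕ) (ω : Env) : Config :=
  fun y => if 0 ≤ y ∧ y ≤ n then .num (ω y).1 else .num 0

/-- The sweep after `m` steps. -/
noncomputable def sweep (n : ℕ) (ω : Env) : ℕ → SweepState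
  | 0 => ⟨boxConfig n ω, 0, settle n (boxConfig n ω)⟩
  | m + 1 => (sweep n ω m).advance n ω

/-- Linear functional of the particle numbers in the box and next to it. -/
noncomputable def linCount (n : ℕ) (φ : ℤ → ℝ) (η : Config) : ℝ :=
  ∑ y ∈ Finset.Icc (-1 : ℤ) (n + 1), φ y * (η y).count

lemma linCount_sleep (n : ℕ) (φ : ℤ → ℝ) (η : Config) (y : ℤ) :
    linCount n φ (topple y .sleep η) = linCount n φ η := by
  simp only [linCount, count_topple_sleep]

lemma linCount_jump {n : ℕ} (φ : ℤ → ℝ) {η : Config} {y d : ℤ} (h0 : 0 ≤ y) (hn : y ≤ n)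
    (hy : 0 < (η y).count) (hd : d = 1 ∨ d = -1) :
    linCount n φ (topple y (.jump d) η) = linCount n φ η - φ y + φ (y + d) := by
  have hd0 : d ≠ 0 := by rcases hd with rfl | rfl <;> norm_num
  have e : ∀ w, φ w * ((topple y (.jump d) η w).count : ℝ) = φ w * ((η w).count : ℝ) -
      (if w = y then φ w else 0) + (if w = y + d then φ w else 0) := by
    intro w
    rw [count_topple_jump hd0]
    by_cases h1 : w = y
    · subst h1
      have : (((η w).count - 1 : ℕ) : ℝ) = (η w).count - 1 := by
        rw [Nat.cast_sub hy]; simp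
      simp [this, hd0]; ring
    · by_cases h2 : w = y + d
      · subst h2; simp [hd0]; ring
      · simp [h1, h2]
  simp only [linCount, e, Finset.sum_add_distrib, Finset.sum_sub_distrib, Finset.sum_ite_eq',
    Finset.mem_Icc]
  rw [if_pos (by omega), if_pos (by omega)]

/-- Indicator of `[0, i]`. -/
noncomputable def leftWeight (i y : ℤ) : ℝ := if 0 ≤ y ∧ y ≤ i then 1 else 0

/-- The invariants of the phases. -/
def PhaseInv (n : ℕ) (η : Config) : SweepPhase → Prop
  | .level => (∀ y : ℤ, 0 ≤ y → y ≤ n → η y ≠ .rho) ∧ ∃ y, Crowded n η y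
  | .walk i z f => 0 ≤ i ∧ i ≤ n ∧ 0 ≤ z ∧ z ≤ n ∧ 0 < (η z).active ∧
      (i < z → η z = .num 2) ∧
      (∀ y, i < y → y ≤ n → y ≠ z → η y = .num 0 ∨ η y = .num 1) ∧
      linCount n (leftWeight i) η ≤ f + if z ≤ i then 1 else 0
  | .done f => linCount n (leftWeight n) η ≤ f

lemma exists_isFirst {n : ℕ} {η : Config} {i y : ℤ} (h1 : i ≤ y) (h2 : y ≤ n)
    (h3 : η y = .num 1) : ∃ w, IsFirst n η i w := by
  obtain ⟨w, ⟨hw1, hw2, hw3⟩, hmin⟩ := Int.exists_least_of_bdd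
    (P := fun w => i ≤ w ∧ w ≤ n ∧ η w = .num 1) ⟨i, fun z hz => hz.1⟩ ⟨y, h1, h2, h3⟩
  refine ⟨w, hw1, hw2, hw3, fun v hv hvw hv1 => ?_⟩
  have := hmin v ⟨hv, by omega, hv1⟩
  omega

/-- The sites passed over before the first single particle are empty, so advancing to it adds to the
left region only that particle, which is the carried one. If there is none, all of `[i, n]` is empty
and the count is already final. -/
lemma phaseInv_launch {n : ℕ} {η : Config} {i : ℤ} {f : ℕ} (hi : 0 ≤ i)
    (hη : ∀ y, i ≤ y → y ≤ n → η y = .num 0 ∨ η y = .num 1)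
    (hf : linCount n (leftWeight (i - 1)) η ≤ f) : PhaseInv n η (launch n η i f) := by
  unfold launch
  split_ifs with h
  · obtain ⟨h1, h2, h3, h4⟩ := h.choose_spec
    set y := h.choose with hy
    refine ⟨by omega, h2, by omega, h2, by simp [h3], fun h => absurd h (lt_irrefl _),
      fun w hw hw' _ => hη w (by omega) hw', ?_⟩
    rw [if_pos le_rfl]
    refine le_trans ?_ (add_le_add_left hf 1)
    have e : ∀ w ∈ Finset.Icc (-1 : ℤ) (n + 1), leftWeight y w * ((η w).count : ℝ) ≤
        leftWeight (i - 1) w * ((η w).count : ℝ) + if w = y then 1 else 0 := by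
      intro w _
      unfold leftWeight
      by_cases hwy : w = y
      · subst hwy
        rw [h3, if_neg (c := 0 ≤ y ∧ y ≤ i - 1) (by omega)]; simp
        split_ifs <;> simp
      · by_cases hw1 : w ≤ i - 1
        · by_cases hw0 : 0 ≤ w
          · rw [if_pos (by omega), if_pos (by omega)]; simp [hwy]
          · rw [if_neg (by omega), if_neg (by omega)]; simp [hwy]
        · rw [if_neg (c := 0 ≤ w ∧ w ≤ i - 1) (by omega)]
          split_ifs with hw2
          · have := (hη w (by omega) (by omega)).resolve_right (h4 w (by omega) (by omega))
            simp [this]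
          · simp
    refine (Finset.sum_le_sum e).trans ?_
    rw [Finset.sum_add_distrib, Finset.sum_ite_eq', if_pos (Finset.mem_Icc.2 (by omega))]
    rfl
  · refine le_trans (Finset.sum_le_sum fun w _ => ?_) hf
    unfold leftWeight
    by_cases hw1 : w ≤ i - 1
    · by_cases hw0 : 0 ≤ w ∧ w ≤ n
      · rw [if_pos hw0, if_pos (by omega)]
      · rw [if_neg hw0, zero_mul]; split_ifs <;> simp
    · rw [if_neg (c := 0 ≤ w ∧ w ≤ i - 1) (by omega)]
      split_ifs with hw2
      · have := (hη w (by omega) hw2.2).resolve_right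
          fun h1 => h (exists_isFirst (by omega) hw2.2 h1)
        simp [this]
      · simp

lemma phaseInv_settle {n : ℕ} {η : Config} (hη : ∀ y : ℤ, 0 ≤ y → y ≤ n → η y ≠ .rho) :
    PhaseInv n η (settle n η) := by
  unfold settle
  split_ifs with h
  · exact ⟨hη, h⟩
  · refine phaseInv_launch le_rfl (fun y h0 hn => ?_) ?_
    · have h1 : ¬ 2 ≤ (η y).count := fun h2 => h ⟨y, h0, hn, h2⟩
      cases hy : η y with
      | num m => rw [hy] at h1; simp at h1 ⊢; omega
      | rho => exact absurd hy (hη y h0 hn)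
    · refine le_of_eq ?_
      simp only [Nat.cast_zero]
      refine Finset.sum_eq_zero fun w _ => ?_
      unfold leftWeight
      rw [if_neg (by omega), zero_mul]

/-- The target is an active site of the box. -/
lemma PhaseInv.target_spec {n : ℕ} {S : SweepState} (h : PhaseInv n S.config S.phase) {y : ℤ}
    (hy : S.target n = some y) : 0 ≤ y ∧ y ≤ n ∧ 0 < (S.config y).active := by
  unfold SweepState.target at hy
  cases hp : S.phase with
  | level =>
    rw [hp] at hy h
    obtain ⟨h1, h2⟩ := h
    simp only [dif_pos h2, Option.some.injEq] at hy
    obtain ⟨h3, h4, h5⟩ := h2.choose_spec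
    rw [hy] at h3 h4 h5
    refine ⟨h3, h4, ?_⟩
    cases hη : S.config y with
    | num m => rw [hη] at h5; simp at h5 ⊢; omega
    | rho => exact absurd hη (h1 y h3 h4)
  | walk i z f =>
    rw [hp] at hy h
    simp only [Option.some.injEq] at hy
    subst hy
    exact ⟨h.2.2.1, h.2.2.2.1, h.2.2.2.2.1⟩
  | done f => rw [hp] at hy; simp at hy

lemma SiteState.add_ne_rho (s : SiteState) : s.add ≠ .rho := by cases s <;> simp [SiteState.add]

lemma SiteState.add_active (s : SiteState) : 0 < s.add.active := by
  cases s <;> simp [SiteState.add]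

lemma topple_jump_apply {η : Config} {x y d : ℤ} (hd : d ≠ 0) :
    topple x (.jump d) η y =
      if y = x then (η x).remove else if y = x + d then (η y).add else η y := by
  by_cases hy : y = x
  · subst hy
    have : y ≠ y + d := by omega
    simp [topple, this, hd]
  · by_cases hy' : y = x + d
    · subst hy'; simp [topple, hd]
    · simp [topple, hy, hy']

/-- A particle dropped into a hole to the right of `i` becomes an active single particle and is
carried later; one that leaves the box is no longer counted. A sleep at `z ≤ i` is booked as a
failure whether or not it takes effect, so the number of failures dominates the number of particles
left behind. -/
lemma PhaseInv.next {n : ℕ} {S : SweepState} (h : PhaseInv n S.config S.phase) {y : ℤ}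
    (hy : S.target n = some y) {a : Instruction} (ha : a = .sleep ∨ a = .jump 1 ∨ a = .jump (-1)) :
    PhaseInv n (S.next n y a).config (S.next n y a).phase := by
  obtain ⟨hy0, hyn, hact⟩ := h.target_spec hy
  have ha' : a = .sleep ∨ ∃ d, (d = 1 ∨ d = -1) ∧ a = .jump d := by
    rcases ha with h | h | h
    · exact Or.inl h
    · exact Or.inr ⟨1, Or.inl rfl, h⟩
    · exact Or.inr ⟨-1, Or.inr rfl, h⟩
  simp only [SweepState.next]
  cases hp : S.phase with
  | level =>
    rw [hp] at h
    obtain ⟨h1, h2⟩ := h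
    have hcr : Crowded n S.config y := by
      have : h2.choose = y := by simpa [SweepState.target, hp, h2] using hy
      rw [← this]; exact h2.choose_spec
    simp only [nextPhase]
    refine phaseInv_settle fun w hw0 hwn => ?_
    rcases ha' with rfl | ⟨d, hd, rfl⟩
    · by_cases hwy : w = y
      · subst hwy
        cases hη : S.config w with
        | num m =>
          have h3 := hcr.2.2
          rw [hη] at h3
          have : m ≠ 1 := by simp at h3; omega
          simp [topple, hη, SiteState.sleep, this]
        | rho => exact absurd hη (h1 w hw0 hwn)
      · simpa [topple, hwy] using h1 w hw0 hwn
    · have hd0 : d ≠ 0 := by rcases hd with rfl | rfl <;> norm_num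
      rw [topple_jump_apply hd0]
      split_ifs with h3 h4
      · cases S.config y <;> simp [SiteState.remove]
      · exact SiteState.add_ne_rho _
      · exact h1 w hw0 hwn
  | walk i z f =>
    rw [hp] at h
    have hzy : z = y := by simpa [SweepState.target, hp] using hy
    subst hzy
    obtain ⟨hi0, hin, -, -, -, h2, h3, h4⟩ := h
    rcases ha' with rfl | ⟨d, hd, rfl⟩
    · simp only [nextPhase]
      split_ifs with hzi
      · refine phaseInv_launch (by omega) (fun w hw hwn => ?_) ?_
        · have hwz : w ≠ z := by omega
          simpa [topple, hwz] using h3 w (by omega) hwn hwz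
        · rw [add_sub_cancel_right, linCount_sleep]
          simpa [hzi] using h4
      -- To the right of `i` the carried particle shares its site with a second active one, so the
      -- sleep attempt has no effect.
      · have : topple z .sleep S.config = S.config := by
          simp only [topple, h2 (by omega), SiteState.sleep]
          simp [← h2 (show i < z by omega)]
        rw [this]
        exact ⟨hi0, hin, hy0, hyn, hact, h2, h3, h4⟩
    · have hd0 : d ≠ 0 := by rcases hd with rfl | rfl <;> norm_num
      -- Apart from the carried particle, at most `f` particles lie in `[0, i]`; the carried one is
      -- counted according to where it lands.
      have hlin : linCount n (leftWeight i) (topple z (.jump d) S.config) ≤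
          f + if 0 ≤ z + d ∧ z + d ≤ i then 1 else 0 := by
        rw [linCount_jump _ hy0 hyn (SiteState.count_pos_of_active hact) hd]
        simp only [leftWeight]
        by_cases hzi : z ≤ i
        · rw [if_pos (⟨hy0, hzi⟩ : 0 ≤ z ∧ z ≤ i)]
          rw [if_pos hzi] at h4
          linarith
        · rw [if_neg (c := 0 ≤ z ∧ z ≤ i) (by omega)]
          rw [if_neg hzi] at h4
          linarith
      have hright : ∀ w, i < w → w ≤ n → w ≠ z + d →
          topple z (.jump d) S.config w = .num 0 ∨ topple z (.jump d) S.config w = .num 1 := by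
        intro w hw hwn hwd
        rw [topple_jump_apply hd0]
        by_cases hwz : w = z
        · subst hwz
          rw [if_pos rfl, h2 hw]
          exact Or.inr rfl
        · rw [if_neg hwz, if_neg hwd]
          exact h3 w hw hwn hwz
      have happ : topple z (.jump d) S.config (z + d) = (S.config (z + d)).add := by
        rw [topple_jump_apply hd0, if_neg (by omega), if_pos rfl]
      simp only [nextPhase]
      split_ifs with hquit
      · refine phaseInv_launch (by omega) (fun w hw hwn => ?_) ?_
        · by_cases hwd : w = z + d
          · subst hwd
            have h5 : S.config (z + d) = .num 0 := by
              rcases hquit with h | h | h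
              · omega
              · omega
              · exact h.2
            rw [happ, h5]
            exact Or.inr rfl
          · exact hright w (by omega) hwn hwd
        · rw [add_sub_cancel_right]
          refine hlin.trans (le_of_eq ?_)
          rw [if_neg (by omega), add_zero]
      · push Not at hquit
        obtain ⟨s1, s2, s3⟩ := hquit
        refine ⟨hi0, hin, s1, s2, by rw [happ]; exact SiteState.add_active _, fun hlt => ?_,
          hright, hlin.trans (le_of_eq ?_)⟩
        · have h5 := (h3 (z + d) hlt s2 (by omega)).resolve_left (s3 hlt)
          rw [happ, h5]
          rfl
        · simp [s1]
  | done f => simp [SweepState.target, hp] at hy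

/-- All the invariants of the sweep. -/
structure SweepInv (n : ℕ) (ω : Env) (S : SweepState) : Prop where
  legal : Legal ω (boxConfig n ω) S.config S.odo
  phase : PhaseInv n S.config S.phase
  odo_eq_zero : ∀ y : ℤ, ¬ (0 ≤ y ∧ y ≤ n) → S.odo y = 0
  total : linCount n 1 S.config = linCount n 1 (boxConfig n ω)

lemma sweepInv {ω : Env} (hω : NNInstr ω) (n m : ℕ) : SweepInv n ω (sweep n ω m) := by
  induction m with
  | zero =>
    refine ⟨.refl, phaseInv_settle fun y _ _ => ?_, fun _ _ => rfl, rfl⟩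
    change boxConfig n ω y ≠ .rho
    unfold boxConfig; split_ifs <;> simp
  | succ m ih =>
    change SweepInv n ω ((sweep n ω m).advance n ω)
    unfold SweepState.advance
    cases ht : (sweep n ω m).target n with
    | none => exact ih
    | some y =>
      obtain ⟨hy0, hyn, hact⟩ := ih.phase.target_spec ht
      have hi := hω y ((sweep n ω m).odo y)
      refine ⟨ih.legal.step y hact, ih.phase.next ht hi, fun w hw => ?_, ?_⟩
      · have hwy : w ≠ y := fun h => hw (h ▸ ⟨hy0, hyn⟩)
        simpa [SweepState.next, hwy] using ih.odo_eq_zero w hw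
      · rw [← ih.total]
        simp only [SweepState.next]
        have hc := SiteState.count_pos_of_active hact
        rcases hi with h | h | h <;> rw [h]
        · exact linCount_sleep _ _ _ _
        · rw [linCount_jump _ hy0 hyn hc (Or.inl rfl)]; simp
        · rw [linCount_jump _ hy0 hyn hc (Or.inr rfl)]; simp

/-- When the sweep is finished, the particles that did not fail left the box. -/
lemma SweepInv.total_le {n : ℕ} {ω : Env} (hω : NNInstr ω) {S : SweepState}
    (h : SweepInv n ω S) {f : ℕ} (hf : S.phase = .done f) :
    linCount n 1 (boxConfig n ω) ≤ f + (S.config (-1)).count + S.odo n := by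
  have hp := h.phase
  rw [hf] at hp
  -- Site `n + 1` is never toppled, so its particles are jumps to the right from `n`, at most as
  -- many as the topplings of `n`.
  have hb := h.legal.balance hω (n + 1)
  rw [h.odo_eq_zero (n + 1) (by omega), h.odo_eq_zero (n + 1 + 1) (by omega)] at hb
  have h0 : (boxConfig n ω (n + 1)).count = 0 := by
    unfold boxConfig; rw [if_neg (by omega)]; rfl
  have hs := sent_le ω n 1 (S.odo n)
  simp only [sent_zero, add_zero, h0, zero_add, add_sub_cancel_right] at hb
  have hle : (((S.config (n + 1)).count : ℕ) : ℝ) ≤ S.odo n := by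
    rw [hb]; exact_mod_cast hs
  rw [← h.total]
  have e : linCount n 1 S.config ≤ linCount n (leftWeight n) S.config +
      ((S.config (-1)).count + (S.config (n + 1)).count) := by
    have e1 : ∀ y ∈ Finset.Icc (-1 : ℤ) (n + 1), (1 : ℤ → ℝ) y * ((S.config y).count : ℝ) ≤
        leftWeight n y * ((S.config y).count : ℝ) +
          ((if y = -1 then ((S.config y).count : ℝ) else 0) +
            if y = n + 1 then ((S.config y).count : ℝ) else 0) := by
      intro y hy
      rw [Finset.mem_Icc] at hy
      unfold leftWeight
      by_cases h1 : y = -1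
      · subst h1
        rw [if_neg (by omega), if_pos rfl, if_neg (by omega)]; simp
      · by_cases h2 : y = n + 1
        · subst h2
          rw [if_neg (by omega), if_neg (by omega), if_pos rfl]; simp
        · rw [if_pos (by omega), if_neg h1, if_neg h2]; simp
    refine (Finset.sum_le_sum e1).trans (le_of_eq ?_)
    rw [Finset.sum_add_distrib, Finset.sum_add_distrib, Finset.sum_ite_eq', Finset.sum_ite_eq',
      if_pos (by simp; omega), if_pos (by simp; omega)]
    rfl
  have hp' : linCount n (leftWeight n) S.config ≤ f := hp
  linarith

lemma SweepInv.exists_done {n : ℕ} {ω : Env} {S : SweepState} (h : SweepInv n ω S)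
    (ht : S.target n = none) : ∃ f, S.phase = .done f := by
  have hp := h.phase
  unfold SweepState.target at ht
  cases hS : S.phase with
  | level =>
    rw [hS] at hp ht
    have h2 := hp.2
    simp [h2] at ht
  | walk i z f => rw [hS] at ht; simp at ht
  | done f => exact ⟨f, rfl⟩

/-- As long as the sweep is not finished, each step topples a site of the box. -/
lemma sum_odo_of_target_ne_none {ω : Env} (hω : NNInstr ω) (n m : ℕ)
    (h : (sweep n ω m).target n ≠ none) :
    ∑ y ∈ Finset.Icc (0 : ℤ) n, (sweep n ω m).odo y = m := by
  induction m with
  | zero => simp [sweep]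
  | succ m ih =>
    have hadv : sweep n ω (m + 1) = (sweep n ω m).advance n ω := rfl
    cases ht : (sweep n ω m).target n with
    | none =>
      rw [hadv, SweepState.advance, ht] at h
      exact absurd ht h
    | some y =>
      have ih' := ih (by simp [ht])
      obtain ⟨hy0, hyn, -⟩ := (sweepInv hω n m).phase.target_spec ht
      have hy : y ∈ Finset.Icc (0 : ℤ) n := Finset.mem_Icc.2 ⟨hy0, hyn⟩
      rw [hadv, SweepState.advance, ht]
      simp only [SweepState.next]
      rw [← Finset.add_sum_erase _ _ hy] at ih'
      rw [Finset.sum_update_of_mem hy, Finset.sdiff_singleton_eq_erase]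
      omega

end ARW

namespace ARW

/-! ### The sweep as a random process -/

variable {p : PMF ℤ} {lam mu : ℝ≥0}

/-- The discrete σ-algebra is adequate because only countably many states can be reached in a given
number of steps (`sweep_discrete`). -/
instance : MeasurableSpace SweepState := ⊤

instance : Countable Instruction := by
  refine Function.Injective.countable (β := Option ℤ)
    (f := fun i => match i with | .sleep => none | .jump z => some z) ?_
  intro a b h
  cases a <;> cases b <;> simp_all

lemma measurable_instr (x : ℤ) (k : ℕ) : Measurable fun ω : Env => instr ω x k := by
  unfold instr; fun_prop

lemma measurable_of_countable_range {Ω S : Type*} [MeasurableSpace Ω] [MeasurableSpace S]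
    {f : Ω → S} (hc : (Set.range f).Countable) (hf : ∀ s, MeasurableSet (f ⁻¹' {s})) :
    Measurable f := by
  intro B _
  have : f ⁻¹' B = ⋃ s ∈ Set.range f ∩ B, f ⁻¹' {s} := by
    ext ω
    simp
  rw [this]
  exact MeasurableSet.biUnion (hc.mono Set.inter_subset_left) fun s _ => hf s

lemma sweep_discrete (n m : ℕ) :
    (Set.range fun ω => sweep n ω m).Countable ∧ Measurable fun ω => sweep n ω m := by
  induction m with
  | zero =>
    set g : (Fin (n + 1) → ℕ) → SweepState := fun c =>
      let η : Config := fun y => if h : 0 ≤ y ∧ y ≤ n then .num (c ⟨y.toNat, by omega⟩) else .num 0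
      ⟨η, 0, settle n η⟩ with hg
    have e : (fun ω => sweep n ω 0) = g ∘ fun (ω : Env) (j : Fin (n + 1)) => (ω (j : ℕ)).1 := by
      funext ω
      have : boxConfig n ω = fun y : ℤ => if h : 0 ≤ y ∧ y ≤ n then
          .num (ω (((⟨y.toNat, by omega⟩ : Fin (n + 1)) : ℕ) : ℤ)).1 else .num 0 := by
        funext y
        unfold boxConfig
        split_ifs with h
        · have : ((y.toNat : ℕ) : ℤ) = y := by omega
          simp [this]
        · rfl
      simp only [sweep, this, hg, Function.comp]
    constructor
    · rw [e]
      exact (Set.countable_range g).mono (Set.range_comp_subset_range _ _)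
    · rw [e]
      exact (measurable_of_countable g).comp (by fun_prop)
  | succ m ih =>
    obtain ⟨hc, hm⟩ := ih
    set N : SweepState → Instruction → SweepState := fun S a =>
      match S.target n with
      | none => S
      | some y => S.next n y a with hN
    set read : SweepState → Env → Instruction := fun S ω =>
      instr ω ((S.target n).getD 0) (S.odo ((S.target n).getD 0)) with hread
    have e : ∀ ω, sweep n ω (m + 1) = N (sweep n ω m) (read (sweep n ω m) ω) := by
      intro ω
      change (sweep n ω m).advance n ω = _
      simp only [SweepState.advance, hN, hread]
      cases (sweep n ω m).target n <;> rfl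
    have hc' : (Set.range fun ω => sweep n ω (m + 1)).Countable := by
      refine (hc.image2 (Set.countable_univ (α := Instruction)) N).mono ?_
      rintro _ ⟨ω, rfl⟩
      exact ⟨_, ⟨ω, rfl⟩, _, trivial, (e ω).symm⟩
    refine ⟨hc', measurable_of_countable_range hc' fun s => ?_⟩
    -- Once the preceding state is fixed, the instruction read next sits at a deterministic place,
    -- which reduces each fibre to a countable union of measurable pieces.
    have : (fun ω => sweep n ω (m + 1)) ⁻¹' {s} = ⋃ S ∈ Set.range fun ω => sweep n ω m,
        (fun ω => sweep n ω m) ⁻¹' {S} ∩ (fun ω => read S ω) ⁻¹' {a | N S a = s} := by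
      ext ω
      simp only [Set.mem_preimage, Set.mem_singleton_iff, e, Set.mem_range, Set.iUnion_exists,
        Set.iUnion_iUnion_eq', Set.mem_iUnion, Set.mem_inter_iff, Set.mem_ofPred_eq]
      constructor
      · intro h
        exact ⟨ω, rfl, h⟩
      · rintro ⟨ω', h1, h2⟩
        rw [h1]; exact h2
    rw [this]
    refine MeasurableSet.biUnion hc fun S _ => (hm (by trivial)).inter ?_
    exact measurable_instr _ _ (by trivial)

lemma odo_mono (n : ℕ) (ω : Env) (y : ℤ) : Monotone fun m => (sweep n ω m).odo y := by
  refine monotone_nat_of_le_succ fun m => ?_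
  change _ ≤ ((sweep n ω m).advance n ω).odo y
  unfold SweepState.advance
  cases (sweep n ω m).target n with
  | none => exact le_rfl
  | some z =>
    simp only [SweepState.next]
    by_cases h : y = z
    · subst h; simp
    · simp [h]

/-- The sweep only depends on the initial particles and on the instructions already used. -/
lemma sweep_congr (n : ℕ) {ω ω' : Env} (h0 : ∀ y, (ω y).1 = (ω' y).1) (m : ℕ)
    (h : ∀ y j, j < (sweep n ω m).odo y → instr ω y j = instr ω' y j) :
    sweep n ω m = sweep n ω' m := by
  induction m with
  | zero =>
    have : boxConfig n ω = boxConfig n ω' := by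
      funext y; simp [boxConfig, h0]
    simp [sweep, this]
  | succ m ih =>
    have ih' := ih fun y j hj => h y j (hj.trans_le (odo_mono n ω y m.le_succ))
    change (sweep n ω m).advance n ω = (sweep n ω' m).advance n ω'
    rw [← ih']
    unfold SweepState.advance
    cases ht : (sweep n ω m).target n with
    | none => rfl
    | some y =>
      simp only
      rw [h]
      change _ < ((sweep n ω m).advance n ω).odo y
      simp [SweepState.advance, ht, SweepState.next]

/-- The site and the index of the instruction used next. -/
noncomputable def SweepState.query (n : ℕ) (S : SweepState) : Option (ℤ × ℕ) :=
  (S.target n).map fun y => (y, S.odo y)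

/-- The instruction about to be read has not influenced the past of the sweep. This is the form in
which the Markov property is used. -/
lemma sweep_replace (n m : ℕ) (ω : Env) (a : Instruction × ℝ) {y : ℤ} {j : ℕ}
    (h : (sweep n ω m).query n = some (y, j)) :
    sweep n (replace y j (ω, a)) m = sweep n ω m := by
  refine (sweep_congr n (fun z => (count_replace ω a y z j).symm) m fun z i hi => ?_).symm
  rw [instr_replace, if_neg]
  rintro ⟨rfl, rfl⟩
  simp only [SweepState.query, Option.map_eq_some_iff, Prod.mk.injEq] at h
  obtain ⟨w, -, rfl, h2⟩ := h
  omega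

lemma replace_replace (y : ℤ) (j : ℕ) (ω : Env) (a : Instruction × ℝ) :
    replace y j (replace y j (ω, a), (ω y).2 j) = ω := by
  simp [replace]

lemma sweep_replace_iff (n m : ℕ) (ω : Env) (a : Instruction × ℝ) (y : ℤ) (j : ℕ) :
    (sweep n (replace y j (ω, a)) m).query n = some (y, j) ↔
      (sweep n ω m).query n = some (y, j) := by
  constructor
  · intro h
    have := sweep_replace n m (replace y j (ω, a)) ((ω y).2 j) h
    rw [replace_replace] at this
    rw [this]; exact h
  · intro h
    rw [sweep_replace n m ω a h]; exact h

/-- Mean of a function of an instruction. -/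
noncomputable def stepMean (p : PMF ℤ) (lam : ℝ≥0) (f : Instruction → ℝ) : ℝ :=
  lam / (1 + lam) * f .sleep +
    1 / (1 + lam) * ((p 1).toReal * f (.jump 1) + (p (-1)).toReal * f (.jump (-1)))

lemma lintegral_instructionLaw_ofReal (hp : NearestNeighbour p) {f : Instruction → ℝ}
    (hf : ∀ a, 0 ≤ f a) :
    ∫⁻ a, ENNReal.ofReal (f a) ∂(instructionLaw p lam) = ENNReal.ofReal (stepMean p lam f) := by
  have h1 : ∀ z, p z = ENNReal.ofReal (p z).toReal := fun z =>
    (ENNReal.ofReal_toReal (p.apply_ne_top z)).symm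
  have h2 : ∀ r : ℝ≥0, (r : ℝ≥0∞) = ENNReal.ofReal r := fun r => ENNReal.ofReal_coe_nnreal.symm
  have h3 := hf .sleep
  have h4 := hf (.jump 1)
  have h5 := hf (.jump (-1))
  rw [lintegral_instructionLaw p hp, h1 1, h1 (-1), h2 (lam / (1 + lam)), h2 (1 / (1 + lam)),
    ← ENNReal.ofReal_mul (by positivity), ← ENNReal.ofReal_mul (by positivity),
    ← ENNReal.ofReal_mul (by positivity), ← ENNReal.ofReal_add (by positivity) (by positivity),
    ← ENNReal.ofReal_mul (by positivity), ← ENNReal.ofReal_add (by positivity) (by positivity)]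
  simp [stepMean]

/-- Nonnegative functions that decrease in mean at each step are supermartingales. -/
lemma lintegral_sweep_succ_le (hp : NearestNeighbour p) {n : ℕ} {Ψ : SweepState → ℝ}
    (h0 : ∀ S, 0 ≤ Ψ S)
    (hstep : ∀ S y, PhaseInv n S.config S.phase → S.target n = some y →
      stepMean p lam (fun a => Ψ (S.next n y a)) ≤ Ψ S) (m : ℕ) :
    ∫⁻ ω, ENNReal.ofReal (Ψ (sweep n ω (m + 1))) ∂(law p lam mu) ≤
      ∫⁻ ω, ENNReal.ofReal (Ψ (sweep n ω m)) ∂(law p lam mu) := by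
  have hmeas : ∀ m, Measurable fun ω => ENNReal.ofReal (Ψ (sweep n ω m)) := fun m =>
    (measurable_from_top (f := fun S => ENNReal.ofReal (Ψ S))).comp (sweep_discrete n m).2
  -- The space is partitioned according to the place of the next instruction. On each piece this
  -- place is fixed, and resampling the instruction there preserves both the law and the piece.
  set D : Option (ℤ × ℕ) → Set Env := fun c => {ω | (sweep n ω m).query n = c} with hD
  have hDm : ∀ c, MeasurableSet (D c) := fun c => (sweep_discrete n m).2
    (show MeasurableSet {S : SweepState | S.query n = c} by trivial)
  have hDd : Pairwise (Function.onFun Disjoint D) := by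
    intro c c' hcc
    refine Set.disjoint_left.2 fun ω h1 h2 => hcc ?_
    exact h1.symm.trans h2
  have hDu : ⋃ c, D c = Set.univ := by
    ext ω; simp [hD]
  have hsplit : ∀ g : Env → ℝ≥0∞, ∫⁻ ω, g ω ∂(law p lam mu) =
      ∑' c, ∫⁻ ω in D c, g ω ∂(law p lam mu) := by
    intro g
    rw [← lintegral_iUnion hDm hDd, hDu, Measure.restrict_univ]
  rw [hsplit, hsplit (fun ω => ENNReal.ofReal (Ψ (sweep n ω m)))]
  refine ENNReal.tsum_le_tsum fun c => ?_
  cases c with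
  | none =>
    refine setLIntegral_mono' (hDm none) fun ω hω => ?_
    have ht : (sweep n ω m).target n = none := by
      simpa [hD, SweepState.query] using hω
    change ENNReal.ofReal (Ψ ((sweep n ω m).advance n ω)) ≤ _
    rw [SweepState.advance, ht]
  | some c =>
    obtain ⟨y, j⟩ := c
    rw [← lintegral_indicator (hDm _), ← lintegral_indicator (hDm _)]
    have hmp := measurePreserving_replace p lam mu y j
    rw [← hmp.lintegral_comp ((hmeas (m + 1)).indicator (hDm _)), lintegral_prod]
    · refine lintegral_mono_ae ?_
      filter_upwards [ae_nnInstr hp] with ω hω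
      by_cases hmem : ω ∈ D (some (y, j))
      · have hq : (sweep n ω m).query n = some (y, j) := hmem
        have ht : (sweep n ω m).target n = some y ∧ (sweep n ω m).odo y = j := by
          simp only [SweepState.query, Option.map_eq_some_iff, Prod.mk.injEq] at hq
          obtain ⟨w, h1, rfl, h2⟩ := hq
          exact ⟨h1, h2⟩
        rw [Set.indicator_of_mem hmem]
        have e : ∀ a : Instruction × ℝ, (D (some (y, j))).indicator
            (fun ω => ENNReal.ofReal (Ψ (sweep n ω (m + 1)))) (replace y j (ω, a)) =
            ENNReal.ofReal (Ψ ((sweep n ω m).next n y a.1)) := by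
          intro a
          have hmem' : replace y j (ω, a) ∈ D (some (y, j)) :=
            (sweep_replace_iff n m ω a y j).2 hq
          rw [Set.indicator_of_mem hmem']
          change ENNReal.ofReal (Ψ ((sweep n (replace y j (ω, a)) m).advance n _)) = _
          rw [sweep_replace n m ω a hq, SweepState.advance, ht.1]
          simp only
          rw [ht.2, instr_replace, if_pos ⟨rfl, rfl⟩]
        simp only [e]
        have hfst : MeasurePreserving Prod.fst (markLaw p lam) (instructionLaw p lam) :=
          measurePreserving_fst
        rw [hfst.lintegral_comp (f := fun a : Instruction =>
          ENNReal.ofReal (Ψ ((sweep n ω m).next n y a))) measurable_from_top,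
          lintegral_instructionLaw_ofReal hp (fun a => h0 _)]
        exact ENNReal.ofReal_le_ofReal (hstep _ _ (sweepInv hω n m).phase ht.1)
      · have e : ∀ a : Instruction × ℝ, (D (some (y, j))).indicator
            (fun ω => ENNReal.ofReal (Ψ (sweep n ω (m + 1)))) (replace y j (ω, a)) = 0 := by
          intro a
          refine Set.indicator_of_notMem (fun h => hmem ?_) _
          exact (sweep_replace_iff n m ω a y j).1 h
        simp only [e, lintegral_zero, zero_le]
    · exact (((hmeas (m + 1)).indicator (hDm _)).comp hmp.measurable).aemeasurable

lemma lintegral_sweep_le (hp : NearestNeighbour p) {n : ℕ} {Ψ : SweepState → ℝ}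
    (h0 : ∀ S, 0 ≤ Ψ S)
    (hstep : ∀ S y, PhaseInv n S.config S.phase → S.target n = some y →
      stepMean p lam (fun a => Ψ (S.next n y a)) ≤ Ψ S) (m : ℕ) :
    ∫⁻ ω, ENNReal.ofReal (Ψ (sweep n ω m)) ∂(law p lam mu) ≤
      ∫⁻ ω, ENNReal.ofReal (Ψ (sweep n ω 0)) ∂(law p lam mu) := by
  induction m with
  | zero => exact le_rfl
  | succ m ih => exact (lintegral_sweep_succ_le hp h0 hstep m).trans ih

end ARW

namespace ARW

/-! ### Potentials of the sweep -/

variable {p : PMF ℤ} {lam mu : ℝ≥0}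

lemma toReal_add_toReal (hp : NearestNeighbour p) : (p 1).toReal + (p (-1)).toReal = 1 := by
  have h := p.tsum_coe
  rw [tsum_eq_sum (s := {1, -1}), Finset.sum_pair (by norm_num)] at h
  · rw [← ENNReal.toReal_add (p.apply_ne_top _) (p.apply_ne_top _), h]; rfl
  · intro z hz
    refine hp z fun h1 => ?_
    have : z = 1 ∨ z = -1 := eq_or_eq_neg_of_abs_eq h1
    simp at hz; tauto

lemma rate_add_rate (lam : ℝ≥0) : (lam : ℝ) / (1 + lam) + 1 / (1 + lam) = 1 := by
  have : (1 : ℝ) + lam ≠ 0 := by positivity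
  field_simp
  ring

lemma stepMean_mono {f g : Instruction → ℝ} (h1 : f .sleep ≤ g .sleep)
    (h2 : f (.jump 1) ≤ g (.jump 1)) (h3 : f (.jump (-1)) ≤ g (.jump (-1))) :
    stepMean p lam f ≤ stepMean p lam g := by
  unfold stepMean
  gcongr

lemma stepMean_const (hp : NearestNeighbour p) (c : ℝ) : stepMean p lam (fun _ => c) = c := by
  have h1 := toReal_add_toReal hp
  have h2 := rate_add_rate lam
  unfold stepMean
  rw [← add_mul, h1, one_mul, ← add_mul, h2, one_mul]

lemma stepMean_mul_const (f : Instruction → ℝ) (c : ℝ) :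
    stepMean p lam (fun a => f a * c) = stepMean p lam f * c := by
  unfold stepMean; ring

lemma stepMean_add (f g : Instruction → ℝ) :
    stepMean p lam (fun a => f a + g a) = stepMean p lam f + stepMean p lam g := by
  unfold stepMean; ring

/-- An effective jump moves exactly one particle, from `y` to a neighbour, so the mean change is the
generator of the walk applied to `φ` at `y`. -/
lemma stepMean_linCount (hp : NearestNeighbour p) {n : ℕ} (φ : ℤ → ℝ) {S : SweepState} {y : ℤ}
    (h : PhaseInv n S.config S.phase) (hy : S.target n = some y) :
    stepMean p lam (fun a => linCount n φ (S.next n y a).config) = linCount n φ S.config +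
      1 / (1 + lam) * ((p 1).toReal * φ (y + 1) + (p (-1)).toReal * φ (y - 1) - φ y) := by
  obtain ⟨h0, h1, h2⟩ := h.target_spec hy
  have hc := SiteState.count_pos_of_active h2
  have e1 := toReal_add_toReal hp
  have e2 := rate_add_rate lam
  simp only [stepMean, SweepState.next, linCount_sleep,
    linCount_jump φ h0 h1 hc (Or.inl rfl), linCount_jump φ h0 h1 hc (Or.inr rfl)]
  have e3 : (lam : ℝ) / (1 + lam) = 1 - 1 / (1 + lam) := by linarith
  have e4 : (p (-1)).toReal = 1 - (p 1).toReal := by linarith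
  rw [e3, e4, ← sub_eq_add_neg]
  ring

lemma linCount_nonneg {n : ℕ} {φ : ℤ → ℝ} (hφ : ∀ y : ℤ, -1 ≤ y → y ≤ n + 1 → 0 ≤ φ y) (η : Config) :
    0 ≤ linCount n φ η :=
  Finset.sum_nonneg fun y hy => by
    rw [Finset.mem_Icc] at hy
    exact mul_nonneg (hφ y hy.1 hy.2) (by positivity)

/-- Ratio of the jump probabilities against and along the drift. -/
noncomputable def ratio (p : PMF ℤ) : ℝ := (p (-1)).toReal / (p 1).toReal

lemma ratio_nonneg (p : PMF ℤ) : 0 ≤ ratio p := by unfold ratio; positivity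

lemma ratio_lt_one (hd : (p (-1)).toReal < (p 1).toReal) : ratio p < 1 := by
  have : 0 < (p 1).toReal := lt_of_le_of_lt ENNReal.toReal_nonneg hd
  unfold ratio
  rwa [div_lt_one this]

/-- Weight that controls the particles leaving the box against the drift. -/
noncomputable def leftExitWeight (p : PMF ℤ) (y : ℤ) : ℝ := ratio p ^ (y + 1).toNat

/-- The powers of `ratio p` are harmonic for the jump law, as in the gambler's ruin, so this
functional is in fact a martingale. -/
lemma leftExit_step (hp : NearestNeighbour p) (hd : (p (-1)).toReal < (p 1).toReal) {n : ℕ}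
    {S : SweepState} {y : ℤ} (h : PhaseInv n S.config S.phase) (hy : S.target n = some y) :
    stepMean p lam (fun a => linCount n (leftExitWeight p) (S.next n y a).config) ≤
      linCount n (leftExitWeight p) S.config := by
  rw [stepMean_linCount hp _ h hy]
  obtain ⟨h0, -, -⟩ := h.target_spec hy
  have hq : 0 < (p 1).toReal := lt_of_le_of_lt ENNReal.toReal_nonneg hd
  have e1 := toReal_add_toReal hp
  obtain ⟨k, rfl⟩ := Int.eq_ofNat_of_zero_le h0
  have t1 : ((k : ℤ) + 1 + 1).toNat = k + 2 := by omega
  have t2 : ((k : ℤ) - 1 + 1).toNat = k := by omega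
  have t3 : ((k : ℤ) + 1).toNat = k + 1 := by omega
  have hr : (p 1).toReal * ratio p = (p (-1)).toReal := by unfold ratio; field_simp
  have : (p 1).toReal * leftExitWeight p (k + 1) + (p (-1)).toReal * leftExitWeight p (k - 1) -
      leftExitWeight p k = 0 := by
    simp only [leftExitWeight, t1, t2, t3]
    have : (p 1).toReal * ratio p ^ (k + 2) + (p (-1)).toReal * ratio p ^ k - ratio p ^ (k + 1) =
      ratio p ^ k * (ratio p * ((p 1).toReal * ratio p) + (p (-1)).toReal - ratio p) := by ring
    rw [this, hr, show ratio p * (p (-1)).toReal + (p (-1)).toReal - ratio p =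
      (p (-1)).toReal - ratio p * (1 - (p (-1)).toReal) by ring,
      show 1 - (p (-1)).toReal = (p 1).toReal by linarith, mul_comm (ratio p) (p 1).toReal, hr]
    ring
  rw [this]; simp

/-- Potential that controls the number of steps. -/
noncomputable def stepsPotential (p : PMF ℤ) (lam : ℝ≥0) (n : ℕ) (S : SweepState) : ℝ :=
  linCount n (fun y => n + 1 - y) S.config +
    1 / (1 + lam) * ((p 1).toReal - (p (-1)).toReal) *
      ((∑ y ∈ Finset.Icc (0 : ℤ) n, S.odo y : ℕ) : ℝ)

/-- Each toppling lowers the mean distance of the particles to `n + 1` by the drift divided by `1 +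
lam`, which the term counting topplings compensates exactly. -/
lemma stepsPotential_step (hp : NearestNeighbour p) {n : ℕ}
    {S : SweepState} {y : ℤ} (h : PhaseInv n S.config S.phase) (hy : S.target n = some y) :
    stepMean p lam (fun a => stepsPotential p lam n (S.next n y a)) ≤
      stepsPotential p lam n S := by
  obtain ⟨h0, h1, -⟩ := h.target_spec hy
  have hmem : y ∈ Finset.Icc (0 : ℤ) n := Finset.mem_Icc.2 ⟨h0, h1⟩
  have e1 := toReal_add_toReal hp
  have e : ∀ a, ((∑ w ∈ Finset.Icc (0 : ℤ) n, (S.next n y a).odo w : ℕ) : ℝ) =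
      ((∑ w ∈ Finset.Icc (0 : ℤ) n, S.odo w : ℕ) : ℝ) + 1 := by
    intro a
    have : ∑ w ∈ Finset.Icc (0 : ℤ) n, (S.next n y a).odo w =
        ∑ w ∈ Finset.Icc (0 : ℤ) n, S.odo w + 1 := by
      simp only [SweepState.next]
      rw [Finset.sum_update_of_mem hmem, Finset.sdiff_singleton_eq_erase,
        ← Finset.add_sum_erase _ _ hmem]
      omega
    rw [this]; push_cast; ring
  simp only [stepsPotential, e]
  rw [stepMean_add, stepMean_linCount hp _ h hy, stepMean_const hp]
  push_cast
  have e4 : (p (-1)).toReal = 1 - (p 1).toReal := by linarith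
  rw [e4]
  apply le_of_eq
  ring

/-- Bounds for the probability that the carried particle fails, as a function of its displacement:
supersolutions of the corresponding difference equation. -/
structure FailureBound (p : PMF ℤ) (lam : ℝ≥0) (h : ℤ → ℝ) : Prop where
  nonneg : ∀ y, 0 ≤ h y
  left : ∀ y, y ≤ 0 → lam / (1 + lam) +
    1 / (1 + lam) * ((p 1).toReal * h (y + 1) + (p (-1)).toReal * h (y - 1)) ≤ h y
  right : ∀ y, 0 < y → (p 1).toReal * h (y + 1) + (p (-1)).toReal * h (y - 1) ≤ h y

/-- Exponential potential for the number of failures. -/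
noncomputable def failPotential (n : ℕ) (θ : ℝ) (h : ℤ → ℝ) : SweepPhase → ℝ
  | .level => (1 + (Real.exp θ - 1) * h 0) ^ (n + 1)
  | .walk i z f => Real.exp θ ^ f * (1 + (Real.exp θ - 1) * h (z - i)) *
      (1 + (Real.exp θ - 1) * h 0) ^ (n - i).toNat
  | .done f => Real.exp θ ^ f

/-! ### Exponential moments of the number of failures -/

section Fail

variable {n : ℕ} {θ : ℝ} {h : ℤ → ℝ}

lemma FailureBound.one_le (hh : FailureBound p lam h) (hθ : 0 ≤ θ) (y : ℤ) :
    1 ≤ 1 + (Real.exp θ - 1) * h y := by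
  have := mul_nonneg (sub_nonneg.2 (Real.one_le_exp hθ)) (hh.nonneg y)
  linarith

lemma failPotential_nonneg (hh : FailureBound p lam h) (hθ : 0 ≤ θ) (P : SweepPhase) :
    0 ≤ failPotential n θ h P := by
  have h1 := hh.one_le hθ
  have h0 : ∀ y, 0 ≤ 1 + (Real.exp θ - 1) * h y := fun y => zero_le_one.trans (h1 y)
  cases P with
  | level => exact pow_nonneg (h0 0) _
  | walk i z f =>
    exact mul_nonneg (mul_nonneg (by positivity) (h0 _)) (pow_nonneg (h0 0) _)
  | done f => exact pow_nonneg (Real.exp_pos θ).le f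

/-- At most `n + 1 - i` carries remain, each contributing the factor `1 + (exp θ - 1) * h 0 ≥ 1`;
holes only reduce their number. -/
lemma failPotential_launch (hh : FailureBound p lam h) (hθ : 0 ≤ θ) {η : Config} {i : ℤ} {f : ℕ} :
    failPotential n θ h (launch n η i f) ≤
      Real.exp θ ^ f * (1 + (Real.exp θ - 1) * h 0) ^ (n + 1 - i).toNat := by
  have h1 := hh.one_le hθ 0
  unfold launch
  split_ifs with hex
  · obtain ⟨e1, e2, -, -⟩ := hex.choose_spec
    simp only [failPotential, sub_self]
    rw [mul_assoc, ← pow_succ']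
    gcongr
    omega
  · simp only [failPotential]
    exact le_mul_of_one_le_right (by positivity) (one_le_pow₀ h1)

lemma failPotential_settle (hh : FailureBound p lam h) (hθ : 0 ≤ θ) {η : Config} :
    failPotential n θ h (settle n η) ≤ (1 + (Real.exp θ - 1) * h 0) ^ (n + 1) := by
  unfold settle
  split_ifs
  · exact le_rfl
  · refine (failPotential_launch hh hθ).trans (le_of_eq ?_)
    rw [pow_zero, one_mul]
    congr 1

/-- A failure multiplies `exp (θ f)` by `1 + (exp θ - 1) * 1` and any other end of the carry by `1`,
at most `1 + (exp θ - 1) * h`. So the boundary values of `h` are one at a failure and nonnegative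
elsewhere, and the inequalities of `FailureBound` are exactly what the mean over the next
instruction requires. -/
lemma failPotential_step (hp : NearestNeighbour p) (hh : FailureBound p lam h) (hθ : 0 ≤ θ)
    {S : SweepState} {y : ℤ} (hI : PhaseInv n S.config S.phase) (hy : S.target n = some y) :
    stepMean p lam (fun a => failPotential n θ h (S.next n y a).phase) ≤
      failPotential n θ h S.phase := by
  have hc : 0 ≤ Real.exp θ - 1 := sub_nonneg.2 (Real.one_le_exp hθ)
  have h1 := hh.one_le hθ
  simp only [SweepState.next]
  cases hp' : S.phase with
  | level =>
    simp only [nextPhase]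
    refine (stepMean_mono (g := fun _ => (1 + (Real.exp θ - 1) * h 0) ^ (n + 1))
      (failPotential_settle hh hθ) (failPotential_settle hh hθ)
      (failPotential_settle hh hθ)).trans ?_
    rw [stepMean_const hp]
    exact le_rfl
  | done f => simp [SweepState.target, hp'] at hy
  | walk i z f =>
    have hin : i ≤ n := by rw [hp'] at hI; exact hI.2.1
    set R := (1 + (Real.exp θ - 1) * h 0) ^ (n - i).toNat with hR
    have hR0 : 0 ≤ R := pow_nonneg (zero_le_one.trans (h1 0)) _
    have hlaunch : ∀ (η : Config) g, failPotential n θ h (launch n η (i + 1) g) ≤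
        Real.exp θ ^ g * R := by
      intro η g
      refine (failPotential_launch hh hθ).trans (le_of_eq ?_)
      rw [hR]
      congr 2
      omega
    have hjump : ∀ d, failPotential n θ h (nextPhase n S.config (topple y (.jump d) S.config)
        (.jump d) (.walk i z f)) ≤ (1 + (Real.exp θ - 1) * h (z + d - i)) * (Real.exp θ ^ f * R) := by
      intro d
      simp only [nextPhase]
      split_ifs
      · refine (hlaunch _ f).trans ?_
        exact le_mul_of_one_le_left (by positivity) (h1 _)
      · simp only [failPotential]
        apply le_of_eq
        ring
    have hE : failPotential n θ h (.walk i z f) =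
        (1 + (Real.exp θ - 1) * h (z - i)) * (Real.exp θ ^ f * R) := by
      simp only [failPotential]; ring
    have e1 := toReal_add_toReal hp
    have e2 := rate_add_rate lam
    have t1 : z + 1 - i = z - i + 1 := by ring
    have t2 : z + -1 - i = z - i - 1 := by ring
    by_cases hzi : z ≤ i
    · have hsleep : failPotential n θ h (nextPhase n S.config (topple y .sleep S.config)
          .sleep (.walk i z f)) ≤ Real.exp θ * (Real.exp θ ^ f * R) := by
        simp only [nextPhase, if_pos hzi]
        refine (hlaunch _ (f + 1)).trans (le_of_eq ?_)
        ring
      refine (stepMean_mono (p := p) (lam := lam) (g := fun a => (match a with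
        | .sleep => Real.exp θ
        | .jump d => 1 + (Real.exp θ - 1) * h (z + d - i)) * (Real.exp θ ^ f * R))
        hsleep (hjump 1) (hjump (-1))).trans ?_
      rw [stepMean_mul_const, hE]
      refine mul_le_mul_of_nonneg_right ?_ (by positivity)
      simp only [stepMean, t1, t2]
      have hl := mul_le_mul_of_nonneg_left (hh.left (z - i) (by omega)) hc
      have e3 : (lam : ℝ) / (1 + lam) = 1 - 1 / (1 + lam) := by linarith
      have e4 : (p (-1)).toReal = 1 - (p 1).toReal := by linarith
      rw [e3, e4] at hl ⊢
      linarith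
    · have hsleep : failPotential n θ h (nextPhase n S.config (topple y .sleep S.config)
          .sleep (.walk i z f)) ≤ (1 + (Real.exp θ - 1) * h (z - i)) * (Real.exp θ ^ f * R) := by
        simp only [nextPhase, if_neg hzi]
        exact hE.le
      refine (stepMean_mono (p := p) (lam := lam) (g := fun a => (match a with
        | .sleep => 1 + (Real.exp θ - 1) * h (z - i)
        | .jump d => 1 + (Real.exp θ - 1) * h (z + d - i)) * (Real.exp θ ^ f * R))
        hsleep (hjump 1) (hjump (-1))).trans ?_
      rw [stepMean_mul_const, hE]
      refine mul_le_mul_of_nonneg_right ?_ (by positivity)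
      simp only [stepMean, t1, t2]
      have hinv : 0 ≤ 1 / (1 + (lam : ℝ)) := by positivity
      have hl := mul_le_mul_of_nonneg_left
        (mul_le_mul_of_nonneg_left (hh.right (z - i) (by omega)) hc) hinv
      have e3 : (lam : ℝ) / (1 + lam) = 1 - 1 / (1 + lam) := by linarith
      have e4 : (p (-1)).toReal = 1 - (p 1).toReal := by linarith
      rw [e4] at hl ⊢
      rw [e3]
      linarith

/-- Exponential potential for the number of failures minus the number of particles. -/
noncomputable def lossPotential (n : ℕ) (θ : ℝ) (h : ℤ → ℝ) (S : SweepState) : ℝ :=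
  failPotential n θ h S.phase * Real.exp (-(θ * linCount n 1 S.config))

/-- The particle number in `[-1, n + 1]` is conserved, so the additional factor is constant along
the sweep and carries the initial Poisson randomness into the estimate. -/
lemma lossPotential_step (hp : NearestNeighbour p) (hh : FailureBound p lam h) (hθ : 0 ≤ θ)
    {S : SweepState} {y : ℤ} (hI : PhaseInv n S.config S.phase) (hy : S.target n = some y) :
    stepMean p lam (fun a => lossPotential n θ h (S.next n y a)) ≤ lossPotential n θ h S := by
  obtain ⟨h0, h1, h2⟩ := hI.target_spec hy
  have hc := SiteState.count_pos_of_active h2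
  have e : stepMean p lam (fun a => lossPotential n θ h (S.next n y a)) =
      stepMean p lam (fun a => failPotential n θ h (S.next n y a).phase *
        Real.exp (-(θ * linCount n 1 S.config))) := by
    simp only [stepMean, lossPotential]
    have c1 : linCount n 1 (S.next n y .sleep).config = linCount n 1 S.config :=
      linCount_sleep _ _ _ _
    have c2 : linCount n 1 (S.next n y (.jump 1)).config = linCount n 1 S.config := by
      simp only [SweepState.next]
      rw [linCount_jump _ h0 h1 hc (Or.inl rfl)]; simp
    have c3 : linCount n 1 (S.next n y (.jump (-1))).config = linCount n 1 S.config := by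
      simp only [SweepState.next]
      rw [linCount_jump _ h0 h1 hc (Or.inr rfl)]; simp
    rw [c1, c2, c3]
  rw [e, stepMean_mul_const]
  exact mul_le_mul_of_nonneg_right (failPotential_step hp hh hθ hI hy) (Real.exp_pos _).le

end Fail

/-! ### Initial values of the potentials -/

lemma lintegral_linCount_box (n : ℕ) {φ : ℤ → ℝ} (hφ : ∀ y : ℤ, -1 ≤ y → y ≤ n + 1 → 0 ≤ φ y) :
    ∫⁻ ω, ENNReal.ofReal (linCount n φ (boxConfig n ω)) ∂(law p lam mu) ≤
      ENNReal.ofReal ((∑ y ∈ Finset.Icc (-1 : ℤ) (n + 1), φ y) * Real.exp mu) := by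
  have hm : ∀ y : ℤ, Measurable fun ω : Env => ((ω y).1 : ℝ≥0∞) := fun y =>
    (measurable_from_top (f := fun k : ℕ => (k : ℝ≥0∞))).comp (by fun_prop)
  have h1 : ∀ ω : Env, ENNReal.ofReal (linCount n φ (boxConfig n ω)) ≤
      ∑ y ∈ Finset.Icc (-1 : ℤ) (n + 1), ENNReal.ofReal (φ y) * ((ω y).1 : ℝ≥0∞) := by
    intro ω
    unfold linCount
    have hn : ∀ y ∈ Finset.Icc (-1 : ℤ) (n + 1), 0 ≤ φ y := fun y hy =>
      hφ y (Finset.mem_Icc.1 hy).1 (Finset.mem_Icc.1 hy).2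
    rw [ENNReal.ofReal_sum_of_nonneg fun y hy => mul_nonneg (hn y hy) (by positivity)]
    refine Finset.sum_le_sum fun y hy => ?_
    rw [ENNReal.ofReal_mul (hn y hy), ENNReal.ofReal_natCast]
    gcongr
    unfold boxConfig
    split_ifs <;> simp
  refine (lintegral_mono h1).trans ?_
  rw [lintegral_finsetSum _ fun y _ => (hm y).const_mul _, Finset.sum_mul,
    ENNReal.ofReal_sum_of_nonneg]
  · refine Finset.sum_le_sum fun y hy => ?_
    rw [lintegral_const_mul _ (hm y),
      ENNReal.ofReal_mul (hφ y (Finset.mem_Icc.1 hy).1 (Finset.mem_Icc.1 hy).2)]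
    gcongr
    rw [(measurePreserving_count p lam mu y).lintegral_comp
      (measurable_from_top (f := fun k : ℕ => (k : ℝ≥0∞)))]
    exact lintegral_poissonMeasure_le mu
  · intro y hy
    exact mul_nonneg (hφ y (Finset.mem_Icc.1 hy).1 (Finset.mem_Icc.1 hy).2) (Real.exp_pos _).le

lemma linCount_one_box (n : ℕ) (ω : Env) :
    linCount n 1 (boxConfig n ω) = ∑ y ∈ Finset.Icc (0 : ℤ) n, ((ω y).1 : ℝ) := by
  unfold linCount
  symm
  refine (Finset.sum_subset_zero_on_sdiff (fun y hy => ?_) (fun y hy => ?_) fun y hy => ?_)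
  · rw [Finset.mem_Icc] at hy ⊢; omega
  · rw [Finset.mem_sdiff, Finset.mem_Icc, Finset.mem_Icc] at hy
    unfold boxConfig
    rw [if_neg (by tauto)]
    simp
  · rw [Finset.mem_Icc] at hy
    unfold boxConfig
    rw [if_pos hy]
    simp

lemma lintegral_exp_neg_total (n : ℕ) (θ : ℝ) :
    ∫⁻ ω, ENNReal.ofReal (Real.exp (-(θ * linCount n 1 (boxConfig n ω)))) ∂(law p lam mu) =
      ENNReal.ofReal (Real.exp (mu * (Real.exp (-θ) - 1))) ^ (n + 1) := by
  have e : ∀ ω : Env, ENNReal.ofReal (Real.exp (-(θ * linCount n 1 (boxConfig n ω)))) =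
      ∏ y ∈ Finset.Icc (0 : ℤ) n, ENNReal.ofReal (Real.exp (-θ) ^ (ω y).1) := by
    intro ω
    rw [linCount_one_box, ← ENNReal.ofReal_prod_of_nonneg fun _ _ => by positivity]
    congr 1
    simp_rw [← Real.exp_nat_mul]
    rw [← Real.exp_sum, Finset.mul_sum, ← Finset.sum_neg_distrib]
    congr 1
    refine Finset.sum_congr rfl fun y _ => by ring
  simp only [e]
  have hf : Measurable fun e : SiteEnv => ENNReal.ofReal (Real.exp (-θ) ^ e.1) :=
    (measurable_from_top (f := fun k : ℕ => ENNReal.ofReal (Real.exp (-θ) ^ k))).comp measurable_fst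
  have h1 := lintegral_prod_infinitePi (ι := ℤ) (ν := siteLaw p lam mu) hf (Finset.Icc (0 : ℤ) n)
  have h2 : MeasurePreserving Prod.fst (siteLaw p lam mu) (poissonMeasure mu) :=
    measurePreserving_fst
  rw [h2.lintegral_comp (f := fun k : ℕ => ENNReal.ofReal (Real.exp (-θ) ^ k))
    measurable_from_top, lintegral_pow_poissonMeasure mu (Real.exp_pos _).le] at h1
  refine h1.trans ?_
  congr 1
  simp

end ARW

namespace ARW

/-! ### The sweep sends many particles through the end of the box -/

variable {p : PMF ℤ} {lam mu : ℝ≥0}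

/-- Markov's inequality for a nonnegative supermartingale at a fixed step. -/
lemma law_sweep_ge_le (hp : NearestNeighbour p) {n : ℕ} {Ψ : SweepState → ℝ}
    (h0 : ∀ S, 0 ≤ Ψ S)
    (hstep : ∀ S y, PhaseInv n S.config S.phase → S.target n = some y →
      stepMean p lam (fun a => Ψ (S.next n y a)) ≤ Ψ S) {C c : ℝ} (hc : 0 < c)
    (hC : ∫⁻ ω, ENNReal.ofReal (Ψ (sweep n ω 0)) ∂(law p lam mu) ≤ ENNReal.ofReal C) (m : ℕ) :
    law p lam mu {ω | c ≤ Ψ (sweep n ω m)} ≤ ENNReal.ofReal (C / c) := by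
  have hm : Measurable fun ω => ENNReal.ofReal (Ψ (sweep n ω m)) :=
    (measurable_from_top (f := fun S => ENNReal.ofReal (Ψ S))).comp (sweep_discrete n m).2
  have h1 : law p lam mu {ω | c ≤ Ψ (sweep n ω m)} ≤
      law p lam mu {ω | ENNReal.ofReal c ≤ ENNReal.ofReal (Ψ (sweep n ω m))} :=
    measure_mono fun ω hω => ENNReal.ofReal_le_ofReal hω
  refine h1.trans ((meas_ge_le_lintegral_div hm.aemeasurable (by simpa using hc)
    ENNReal.ofReal_ne_top).trans ?_)
  rw [ENNReal.ofReal_div_of_pos hc]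
  gcongr
  exact (lintegral_sweep_le hp h0 hstep m).trans hC

/-- An unfinished sweep has made `m` topplings, so its potential is at least `κ * m`, while its mean
is at most the initial one, whatever `m`. -/
lemma law_target_ne_none_le (hp : NearestNeighbour p) (hd : (p (-1)).toReal < (p 1).toReal)
    (n : ℕ) {δ : ℝ} (hδ : 0 < δ) :
    ∃ m, law p lam mu {ω | (sweep n ω m).target n ≠ none} ≤ ENNReal.ofReal δ := by
  set κ : ℝ := 1 / (1 + lam) * ((p 1).toReal - (p (-1)).toReal) with hκ
  have hκ0 : 0 < κ := mul_pos (by positivity) (sub_pos.2 hd)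
  have hφ : ∀ y : ℤ, -1 ≤ y → y ≤ n + 1 → (0 : ℝ) ≤ n + 1 - y := fun y _ h => by
    have : (y : ℝ) ≤ n + 1 := by exact_mod_cast h
    linarith
  set C : ℝ := (∑ y ∈ Finset.Icc (-1 : ℤ) (n + 1), ((n : ℝ) + 1 - y)) * Real.exp mu with hC
  obtain ⟨m, hm⟩ := exists_nat_gt (max (C / (κ * δ)) 0)
  have hm0 : (0 : ℝ) < m := (le_max_right _ _).trans_lt hm
  refine ⟨m, ?_⟩
  have h1 : law p lam mu {ω | κ * m ≤ stepsPotential p lam n (sweep n ω m)} ≤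
      ENNReal.ofReal (C / (κ * m)) := by
    refine law_sweep_ge_le hp (fun S => ?_) (fun S y => stepsPotential_step hp) (by positivity) ?_ m
    · exact add_nonneg (linCount_nonneg hφ _) (by positivity)
    · refine le_trans (le_of_eq ?_) (lintegral_linCount_box (p := p) (lam := lam) n hφ)
      simp [stepsPotential, sweep]
  refine (measure_mono_ae ?_).trans (h1.trans (ENNReal.ofReal_le_ofReal ?_))
  · filter_upwards [ae_nnInstr (lam := lam) (mu := mu) hp] with ω hω ht
    change κ * m ≤ stepsPotential p lam n (sweep n ω m)
    unfold stepsPotential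
    rw [sum_odo_of_target_ne_none hω n m ht]
    have := linCount_nonneg hφ (sweep n ω m).config
    linarith
  · have := (le_max_left _ _).trans_lt hm
    rw [div_lt_iff₀ (by positivity)] at this
    rw [div_le_iff₀ (by positivity)]
    linarith

lemma sum_leftExitWeight_le (hd : (p (-1)).toReal < (p 1).toReal) (n : ℕ) :
    ∑ y ∈ Finset.Icc (-1 : ℤ) (n + 1), leftExitWeight p y ≤ (1 - ratio p)⁻¹ := by
  have h0 := ratio_nonneg p
  have h1 := ratio_lt_one hd
  have e : ∑ y ∈ Finset.Icc (-1 : ℤ) (n + 1), leftExitWeight p y =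
      ∑ k ∈ Finset.range (n + 3), ratio p ^ k := by
    refine Finset.sum_bij' (fun y _ => (y + 1).toNat) (fun k _ => (k : ℤ) - 1) ?_ ?_ ?_ ?_ ?_
    · intro y hy; rw [Finset.mem_Icc] at hy; rw [Finset.mem_range]; omega
    · intro k hk; rw [Finset.mem_range] at hk; rw [Finset.mem_Icc]; omega
    · intro y hy; rw [Finset.mem_Icc] at hy; omega
    · intro k hk; omega
    · intro y hy; rfl
  rw [e, ← tsum_geometric_of_lt_one h0 h1]
  exact (summable_geometric_of_lt_one h0 h1).sum_le_tsum _ fun k _ => pow_nonneg h0 k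

/-- The weight equals one at `-1` and is summable along the box, so the mean number of particles
lost on the left is bounded uniformly in `n`. -/
lemma law_leftExit_le (hp : NearestNeighbour p) (hd : (p (-1)).toReal < (p 1).toReal)
    (n m : ℕ) {c : ℝ} (hc : 0 < c) :
    law p lam mu {ω | c ≤ ((sweep n ω m).config (-1)).count} ≤
      ENNReal.ofReal ((1 - ratio p)⁻¹ * Real.exp mu / c) := by
  have h0 : ∀ y : ℤ, 0 ≤ leftExitWeight p y := fun y => pow_nonneg (ratio_nonneg p) _
  refine le_trans (measure_mono fun ω hω => ?_) (law_sweep_ge_le (lam := lam) (mu := mu) hp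
    (Ψ := fun S => linCount n (leftExitWeight p) S.config)
    (fun S => linCount_nonneg (fun y _ _ => h0 y) _) (fun S y => leftExit_step hp hd) hc
    ((lintegral_linCount_box n fun y _ _ => h0 y).trans (ENNReal.ofReal_le_ofReal
      (mul_le_mul_of_nonneg_right (sum_leftExitWeight_le hd n) (Real.exp_pos _).le))) m)
  refine le_trans (b := (((sweep n ω m).config (-1)).count : ℝ)) hω ?_
  unfold linCount
  refine le_trans (le_of_eq ?_) (Finset.single_le_sum
    (f := fun y => leftExitWeight p y * (((sweep n ω m).config y).count : ℝ))
    (fun y _ => mul_nonneg (h0 y) (by positivity))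
    (Finset.mem_Icc.2 ⟨le_rfl, by omega⟩ : (-1 : ℤ) ∈ Finset.Icc (-1 : ℤ) (n + 1)))
  simp [leftExitWeight]

/-- The exponent comes from `1 + u ≤ exp u` for the failure factor and from the Laplace transform of
`n + 1` independent Poisson numbers. -/
lemma law_lossPotential_le (hp : NearestNeighbour p) {h : ℤ → ℝ} (hh : FailureBound p lam h)
    {θ : ℝ} (hθ : 0 ≤ θ) (n m : ℕ) {c : ℝ} (hc : 0 < c) :
    law p lam mu {ω | c ≤ lossPotential n θ h (sweep n ω m)} ≤ ENNReal.ofReal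
      (Real.exp ((n + 1 : ℕ) * ((Real.exp θ - 1) * h 0 + mu * (Real.exp (-θ) - 1))) / c) := by
  refine law_sweep_ge_le (Ψ := lossPotential n θ h) hp
    (fun S => mul_nonneg (failPotential_nonneg hh hθ _) (Real.exp_pos _).le)
    (fun S y => lossPotential_step hp hh hθ) hc ?_ m
  have hA : 0 ≤ 1 + (Real.exp θ - 1) * h 0 := zero_le_one.trans (hh.one_le hθ 0)
  have h1 : ∀ ω : Env, ENNReal.ofReal (lossPotential n θ h (sweep n ω 0)) ≤
      ENNReal.ofReal ((1 + (Real.exp θ - 1) * h 0) ^ (n + 1)) *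
        ENNReal.ofReal (Real.exp (-(θ * linCount n 1 (boxConfig n ω)))) := by
    intro ω
    rw [← ENNReal.ofReal_mul (by positivity)]
    refine ENNReal.ofReal_le_ofReal ?_
    exact mul_le_mul_of_nonneg_right (failPotential_settle hh hθ) (Real.exp_pos _).le
  refine (lintegral_mono h1).trans ?_
  rw [lintegral_const_mul' _ _ ENNReal.ofReal_ne_top, lintegral_exp_neg_total,
    ← ENNReal.ofReal_pow (Real.exp_pos _).le, ← ENNReal.ofReal_mul (by positivity)]
  refine ENNReal.ofReal_le_ofReal ?_
  rw [Real.exp_nat_mul, Real.exp_add, mul_pow]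
  gcongr
  linarith [Real.add_one_le_exp ((Real.exp θ - 1) * h 0)]

/-- At the end the particles are failures, left exits or right exits. If both kinds of exits number
less than `c`, then the failures minus the particles exceed `-2 * c`. -/
lemma SweepInv.exp_lt_lossPotential {n : ℕ} {ω : Env} (hω : NNInstr ω) {S : SweepState}
    (hS : SweepInv n ω S) (ht : S.target n = none) {θ c : ℝ} (hθ : 0 < θ) (h : ℤ → ℝ)
    (h1 : ((S.config (-1)).count : ℝ) < c) (h2 : (S.odo n : ℝ) < c) :
    Real.exp (-(2 * θ * c)) ≤ lossPotential n θ h S := by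
  obtain ⟨f, hf⟩ := hS.exists_done ht
  have h3 := hS.total_le hω hf
  rw [← hS.total] at h3
  unfold lossPotential
  rw [hf]
  simp only [failPotential]
  rw [← Real.exp_nat_mul, ← Real.exp_add, Real.exp_le_exp]
  have : 0 ≤ θ * (2 * c + f - linCount n 1 S.config) := mul_nonneg hθ.le (by linarith)
  linarith

/-- A Chernoff bound. Few topplings at `n` require an unfinished sweep, many exits on the left, or
nearly as many failures as particles, and each of these events has vanishing probability. -/
lemma tendsto_law_sweep_lt (hp : NearestNeighbour p) (hd : (p (-1)).toReal < (p 1).toReal)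
    {h : ℤ → ℝ} (hh : FailureBound p lam h) (h1 : h 0 ≤ 1) (hmu : h 0 < mu) :
    ∃ γ > (0 : ℝ), ∃ m : ℕ → ℕ, Tendsto (fun n : ℕ =>
      law p lam mu {ω | ((sweep n ω (m n)).odo n : ℝ) < γ * (n + 1 : ℕ)}) atTop (𝓝 0) := by
  have hh0 := hh.nonneg 0
  -- Any `b > 1` with `b * h 0 < mu` would do; this one works because `h 0 ≤ 1`. With `exp θ = b`
  -- the exponent per site is `-σ = -((b - 1) / b) * (mu - b * h 0) < 0`.
  set b : ℝ := 1 + (mu - h 0) / 2 with hb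
  have hb1 : 1 < b := by rw [hb]; linarith
  have hbh : b * h 0 < mu := by rw [hb]; nlinarith
  set θ := Real.log b with hθ
  have hθ0 : 0 < θ := Real.log_pos hb1
  have hexp : Real.exp θ = b := Real.exp_log (by linarith)
  set σ : ℝ := -((Real.exp θ - 1) * h 0 + mu * (Real.exp (-θ) - 1)) with hσ
  have hσ0 : 0 < σ := by
    rw [hσ, Real.exp_neg, hexp]
    have : -((b - 1) * h 0 + mu * (b⁻¹ - 1)) = (b - 1) / b * (mu - b * h 0) := by
      field_simp; ring
    rw [this]
    exact mul_pos (div_pos (by linarith) (by linarith)) (by linarith)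
  -- Then `2 * θ * γ = σ / 2`, so passing to the threshold costs only half of the exponential rate
  -- `σ`.
  set γ := σ / (4 * θ) with hγ
  have hγ0 : 0 < γ := by positivity
  have hm : ∀ n : ℕ, ∃ m, law p lam mu {ω | (sweep n ω m).target n ≠ none} ≤
      ENNReal.ofReal (1 / ((n : ℝ) + 1)) := fun n => law_target_ne_none_le hp hd n (by positivity)
  choose m hm using hm
  refine ⟨γ, hγ0, m, ?_⟩
  set D := (1 - ratio p)⁻¹ * Real.exp mu with hD
  have hbound : ∀ n : ℕ, law p lam mu {ω | ((sweep n ω (m n)).odo n : ℝ) < γ * (n + 1 : ℕ)} ≤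
      ENNReal.ofReal (1 / ((n : ℝ) + 1)) + ENNReal.ofReal (D / γ * (1 / ((n : ℝ) + 1))) +
        ENNReal.ofReal (Real.exp (-(σ / 2)) ^ (n + 1)) := by
    intro n
    have hc : 0 < γ * (n + 1 : ℕ) := by positivity
    have hB := law_leftExit_le (lam := lam) (mu := mu) hp hd n (m n) hc
    have hC := law_lossPotential_le (mu := mu) hp hh hθ0.le n (m n)
      (Real.exp_pos (-(2 * θ * (γ * (n + 1 : ℕ)))))
    refine (measure_mono_ae (t := ({ω | (sweep n ω (m n)).target n ≠ none} ∪
      {ω | γ * (n + 1 : ℕ) ≤ ((sweep n ω (m n)).config (-1)).count}) ∪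
      {ω | Real.exp (-(2 * θ * (γ * (n + 1 : ℕ)))) ≤ lossPotential n θ h (sweep n ω (m n))})
      ?_).trans ((measure_union_le _ _).trans (add_le_add ((measure_union_le _ _).trans
        (add_le_add (hm n) (hB.trans (le_of_eq ?_)))) (hC.trans (le_of_eq ?_))))
    · filter_upwards [ae_nnInstr (lam := lam) (mu := mu) hp] with ω hω hlt
      by_cases ht : (sweep n ω (m n)).target n = none
      · by_cases hl : γ * (n + 1 : ℕ) ≤ ((sweep n ω (m n)).config (-1)).count
        · exact Or.inl (Or.inr hl)
        · exact Or.inr ((sweepInv hω n (m n)).exp_lt_lossPotential hω ht hθ0 h (not_le.1 hl) hlt)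
      · exact Or.inl (Or.inl ht)
    · congr 1
      rw [← hD]
      push_cast
      field_simp
    · rw [← Real.exp_sub, ← Real.exp_nat_mul]
      congr 2
      rw [hγ]
      field_simp
      rw [hσ]
      ring
  have hlim : Tendsto (fun n : ℕ => ENNReal.ofReal (1 / ((n : ℝ) + 1)) +
      ENNReal.ofReal (D / γ * (1 / ((n : ℝ) + 1))) +
        ENNReal.ofReal (Real.exp (-(σ / 2)) ^ (n + 1))) atTop (𝓝 (0 + 0 + 0)) := by
    have t1 := tendsto_one_div_add_atTop_nhds_zero_nat (𝕜 := ℝ)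
    have t2 := (tendsto_pow_atTop_nhds_zero_of_lt_one (Real.exp_pos (-(σ / 2))).le
      (by rw [Real.exp_lt_one_iff]; linarith)).comp (tendsto_add_atTop_nat 1)
    refine Tendsto.add (Tendsto.add ?_ ?_) ?_
    · simpa using ENNReal.tendsto_ofReal t1
    · simpa using ENNReal.tendsto_ofReal (t1.const_mul (D / γ))
    · simpa using ENNReal.tendsto_ofReal t2
  simp only [add_zero] at hlim
  exact tendsto_of_tendsto_of_tendsto_of_le_of_le tendsto_const_nhds hlim (fun _ => zero_le) hbound

end ARW

namespace ARW

/-! ### Translation and reflection of the lattice -/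

variable {p : PMF ℤ} {lam mu : ℝ≥0}

/-- Multiply the displacement by `ε`. -/
def Instruction.scale (ε : ℤ) : Instruction → Instruction
  | .sleep => .sleep
  | .jump z => .jump (ε * z)

/-- The environment seen from `-εn`, in the orientation `ε`. -/
def reorient (ε : ℤ) (n : ℕ) (ω : Env) : Env := fun y =>
  ((ω (ε * (y - n))).1, fun k => ((instr ω (ε * (y - n)) k).scale ε, gap ω (ε * (y - n)) k))

lemma measurePreserving_reindex {ι α : Type*} [MeasurableSpace α] (ν : Measure α)
    [IsProbabilityMeasure ν] (e : ι ≃ ι) :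
    MeasurePreserving (fun (ω : ι → α) i => ω (e i)) (Measure.infinitePi fun _ : ι => ν)
      (Measure.infinitePi fun _ : ι => ν) := by
  refine ⟨by fun_prop, ?_⟩
  have h := Measure.infinitePi_map_piCongrLeft (fun _ : ι => ν) e.symm
  refine Eq.trans ?_ h
  congr 1
  funext ω i
  simp [MeasurableEquiv.piCongrLeft, Equiv.piCongrLeft_apply]

lemma measurePreserving_pi {ι α β : Type*} [MeasurableSpace α] [MeasurableSpace β]
    {ν : Measure α} {ν' : Measure β} [IsProbabilityMeasure ν] {f : α → β}
    (hf : MeasurePreserving f ν ν') :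
    MeasurePreserving (fun (ω : ι → α) i => f (ω i)) (Measure.infinitePi fun _ : ι => ν)
      (Measure.infinitePi fun _ : ι => ν') := by
  have := hf.measurable
  refine ⟨by fun_prop, ?_⟩
  rw [Measure.infinitePi_map_pi (f := fun _ => f) (fun _ : ι => ν) fun _ => this]
  simp only [hf.map_eq]

lemma measurePreserving_scale (p : PMF ℤ) (lam : ℝ≥0) (ε : ℤ) :
    MeasurePreserving (Instruction.scale ε) (instructionLaw p lam)
      (instructionLaw (p.map (ε * ·)) lam) := by
  have hm : Measurable (Instruction.scale ε) := measurable_from_top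
  refine ⟨hm, ?_⟩
  unfold instructionLaw
  rw [Measure.map_add _ _ hm, Measure.map_smul, Measure.map_smul, Measure.map_dirac' hm,
    PMF.toMeasure_map _ _ hm, PMF.map_comp, PMF.map_comp]
  rfl

/-- The reflection about `0`, if `ε = -1`, followed by the translation by `n`. -/
def siteEquiv (ε : ℤ) (hε : ε * ε = 1) (n : ℕ) : ℤ ≃ ℤ where
  toFun y := ε * (y - n)
  invFun x := ε * x + n
  left_inv y := by linear_combination (y - n) * hε
  right_inv x := by linear_combination x * hε

lemma measurePreserving_reorient {ε : ℤ} (hε : ε * ε = 1) (n : ℕ) :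
    MeasurePreserving (reorient ε n) (law p lam mu) (law (p.map (ε * ·)) lam mu) := by
  have h1 : MeasurePreserving (fun a : Instruction × ℝ => (a.1.scale ε, a.2))
      ((instructionLaw p lam).prod expLaw) ((instructionLaw (p.map (ε * ·)) lam).prod expLaw) :=
    (measurePreserving_scale p lam ε).prod (MeasurePreserving.id _)
  have h2 : MeasurePreserving (fun e : SiteEnv => (e.1, fun k => ((e.2 k).1.scale ε, (e.2 k).2)))
      (siteLaw p lam mu) (siteLaw (p.map (ε * ·)) lam mu) :=
    (MeasurePreserving.id _).prod (measurePreserving_pi h1)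
  exact (measurePreserving_pi h2).comp (measurePreserving_reindex _ (siteEquiv ε hε n))

/-- Equivariance of the dynamics under the symmetry; `ε * ε = 1` makes scaling the displacement
compatible with relabelling the sites. -/
lemma topple_comp {ε : ℤ} (hε : ε * ε = 1) (n : ℕ) (y : ℤ) (a : Instruction) (η : Config) :
    topple y (a.scale ε) η ∘ (siteEquiv ε hε n).symm =
      topple (siteEquiv ε hε n y) a (η ∘ (siteEquiv ε hε n).symm) := by
  set σ := siteEquiv ε hε n with hσ
  have hu : ∀ (f : Config) (w : ℤ) (s : SiteState),
      Function.update f w s ∘ σ.symm = Function.update (f ∘ σ.symm) (σ w) s := by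
    intro f w s
    conv_lhs => rw [← σ.symm_apply_apply w]
    exact Function.update_comp_eq_of_injective _ σ.symm.injective _ _
  cases a with
  | sleep => simp [topple, Instruction.scale, hu]
  | jump z =>
    have hz : σ (y + ε * z) = σ y + z := by
      change ε * (y + ε * z - n) = ε * (y - n) + z
      linear_combination z * hε
    have hz' : σ.symm (σ y + z) = y + ε * z := by rw [← hz, σ.symm_apply_apply]
    have e1 : (Function.update (η ∘ σ.symm) (σ y) (η y).remove) (σ y + z) =
        (Function.update η y (η y).remove) (y + ε * z) := by
      rw [← hu, Function.comp_apply, hz']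
    simp only [topple, Instruction.scale, hu, hz, Function.comp_apply, σ.symm_apply_apply, e1]

lemma Legal.reorient {ε : ℤ} (hε : ε * ε = 1) {n : ℕ} {ω : Env} {η₀ η : Config} {k : ℤ → ℕ}
    (h : Legal (reorient ε n ω) η₀ η k) :
    Legal ω (η₀ ∘ (siteEquiv ε hε n).symm) (η ∘ (siteEquiv ε hε n).symm)
      (k ∘ (siteEquiv ε hε n).symm) := by
  set σ := siteEquiv ε hε n with hσ
  induction h with
  | refl => exact .refl
  | @step η k y _ hy ih =>
    have h1 := ih.step (σ y) (by simpa using hy)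
    have e1 : (k ∘ σ.symm) (σ y) = k y := by simp
    have e2 : Function.update (k ∘ σ.symm) (σ y) (k y + 1) =
        Function.update k y (k y + 1) ∘ σ.symm := by
      symm
      conv_lhs => rw [← σ.symm_apply_apply y]
      rw [Function.update_comp_eq_of_injective _ σ.symm.injective, σ.symm_apply_apply]
    rw [e1, e2] at h1
    rw [hσ] at h1 ⊢
    rw [← topple_comp hε] at h1
    exact h1

lemma NNInstr.reorient {ε : ℤ} (hε : ε = 1 ∨ ε = -1) (n : ℕ) {ω : Env} (h : NNInstr ω) :
    NNInstr (reorient ε n ω) := by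
  intro y k
  have e : instr (ARW.reorient ε n ω) y k = (instr ω (ε * (y - n)) k).scale ε := rfl
  rw [e]
  have hi := h (ε * (y - n)) k
  generalize instr ω (ε * (y - n)) k = a at hi ⊢
  rcases hε with rfl | rfl <;> rcases hi with rfl | rfl | rfl <;> simp [Instruction.scale]

/-- The end `n` of the box corresponds to the origin, and the box itself to a subset of `[-n, n]`,
so its particles are present in every system with `M ≥ n`. -/
lemma unstable_of_reorient {ε : ℤ} (hε : ε = 1 ∨ ε = -1) {ω : Env} (hω : NNInstr ω)
    (h : ∀ J : ℕ, ∃ n m : ℕ, J ≤ (sweep n (reorient ε n ω) m).odo n) : Unstable ω := by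
  have hε' : ε * ε = 1 := by rcases hε with rfl | rfl <;> rfl
  intro J
  obtain ⟨n, m, hJ⟩ := h J
  have hinv := sweepInv (hω.reorient hε n) n m
  refine ⟨n, _, _, _, hinv.legal.reorient hε', fun x => ?_, fun M hM x => ?_, ?_⟩
  · change boxConfig n (reorient ε n ω) (ε * x + n) ≠ _
    unfold boxConfig
    split_ifs <;> simp
  · change (boxConfig n (reorient ε n ω) (ε * x + n)).count ≤ _
    unfold boxConfig start
    split_ifs with h1
    · have hx : |x| ≤ (M : ℤ) := by
        rw [abs_le]
        rcases hε with rfl | rfl <;> omega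
      have : ε * (ε * x + n - n) = x := by linear_combination x * hε'
      simp only [SiteState.count_num, reorient, this, if_pos hx, le_refl]
    · simp
  · simpa [siteEquiv] using hJ

lemma map_mul_apply {ε : ℤ} (hε : ε * ε = 1) (z : ℤ) : p.map (ε * ·) z = p (ε * z) := by
  rw [PMF.map_apply, tsum_eq_single (ε * z)]
  · rw [if_pos]; linear_combination -z * hε
  · intro w hw
    rw [if_neg]
    rintro rfl
    exact hw (by linear_combination -w * hε)

lemma NearestNeighbour.map_mul (hp : NearestNeighbour p) {ε : ℤ} (hε : ε = 1 ∨ ε = -1) :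
    NearestNeighbour (p.map (ε * ·)) := by
  intro z hz
  rw [map_mul_apply (by rcases hε with rfl | rfl <;> rfl)]
  refine hp _ ?_
  rcases hε with rfl | rfl <;> simpa using hz

/-- Above the failure probability, the origin can be toppled arbitrarily often. -/
lemma ae_unstable (hp : NearestNeighbour p) {ε : ℤ} (hε : ε = 1 ∨ ε = -1)
    (hd : (p (-ε)).toReal < (p ε).toReal) {h : ℤ → ℝ}
    (hh : FailureBound (p.map (ε * ·)) lam h) (h1 : h 0 ≤ 1) (hmu : h 0 < mu) :
    ∀ᵐ ω ∂(law p lam mu), Unstable ω := by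
  have hε' : ε * ε = 1 := by rcases hε with rfl | rfl <;> rfl
  obtain ⟨γ, hγ, m, hm⟩ := tendsto_law_sweep_lt (hp.map_mul hε)
    (by simpa [map_mul_apply hε'] using hd) hh h1 hmu
  have hae : ∀ᵐ ω ∂(law p lam mu), ∀ J : ℕ, ∃ n m : ℕ,
      J ≤ (sweep n (reorient ε n ω) m).odo n := by
    rw [ae_all_iff]
    intro J
    rw [ae_iff]
    -- If no sweep topples its end `J` times, then for each large `n` the odometer is below `γ * (n
    -- + 1)`. By invariance of the law, the probability of this tends to zero.
    refine le_antisymm (ge_of_tendsto hm ?_) zero_le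
    obtain ⟨N, hN⟩ := exists_nat_gt (J / γ)
    filter_upwards [eventually_ge_atTop N] with n hn
    have hmeas : MeasurableSet {ω | ((sweep n ω (m n)).odo n : ℝ) < γ * (n + 1 : ℕ)} :=
      (measurable_from_top (f := fun S : SweepState => ((S.odo n : ℕ) : ℝ))).comp
        (sweep_discrete n (m n)).2 measurableSet_Iio
    rw [← (measurePreserving_reorient (p := p) (lam := lam) (mu := mu) hε' n).measure_preimage
      hmeas.nullMeasurableSet]
    refine measure_mono fun ω hω => ?_
    simp only [Set.mem_ofPred_eq, not_exists, not_le, Set.preimage_ofPred_eq] at hω ⊢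
    rw [div_lt_iff₀ hγ] at hN
    have e1 : ((sweep n (reorient ε n ω) (m n)).odo n : ℝ) < J := by exact_mod_cast hω n (m n)
    have e2 : (N : ℝ) * γ ≤ γ * (n + 1 : ℕ) := by
      rw [mul_comm]
      gcongr
      omega
    linarith
  filter_upwards [hae, ae_nnInstr hp] with ω h1 h2
  exact unstable_of_reorient hε h2 h1

end ARW

namespace ARW

/-! ### The discounted random walk -/

variable {p : PMF ℤ}

/-- Law of the increments of the walk. -/
noncomputable def walkLaw (p : PMF ℤ) : Measure (ℕ → ℤ) := Measure.infinitePi fun _ : ℕ => p.toMeasure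

instance (p : PMF ℤ) : IsProbabilityMeasure (walkLaw p) := by
  unfold walkLaw; infer_instance

/-- Put one more increment in front. -/
def consSeq (z : ℤ × (ℕ → ℤ)) : ℕ → ℤ := fun n => Nat.casesOn n z.1 z.2

lemma measurable_consSeq : Measurable consSeq := by
  refine measurable_pi_lambda _ fun n => ?_
  cases n with
  | zero => exact measurable_fst
  | succ n => exact (measurable_pi_apply n).comp measurable_snd

/-- The Markov property of the walk at its first step, in the form needed for the recursion. -/
lemma measurePreserving_consSeq (p : PMF ℤ) :
    MeasurePreserving consSeq (p.toMeasure.prod (walkLaw p)) (walkLaw p) := by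
  refine ⟨measurable_consSeq, Measure.eq_infinitePi _ fun s t ht => ?_⟩
  have hinj : Set.InjOn Nat.succ (Nat.succ ⁻¹' (s : Set ℕ)) := Nat.succ_injective.injOn
  have e : consSeq ⁻¹' Set.pi s t = {z | 0 ∈ s → z ∈ t 0} ×ˢ
      Set.pi (s.preimage Nat.succ hinj : Finset ℕ) fun n => t (n + 1) := by
    ext ⟨z, ξ⟩
    simp only [Set.mem_preimage, Set.mem_pi, Finset.mem_coe, Set.mem_prod, Set.mem_ofPred_eq,
      Finset.mem_preimage]
    constructor
    · exact fun h => ⟨fun h0 => h 0 h0, fun n hn => h (n + 1) hn⟩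
    · rintro ⟨h0, h1⟩ n hn
      cases n with
      | zero => exact h0 hn
      | succ n => exact h1 n hn
  -- The factor one at index zero removes the only coordinate outside the range of `succ`.
  have hprod := Finset.prod_preimage Nat.succ s hinj
    (fun n => if n = 0 then 1 else p.toMeasure (t n)) ?_
  · simp only [Nat.succ_ne_zero, if_false] at hprod
    rw [Measure.map_apply measurable_consSeq (.pi s.countable_toSet fun _ _ => ht _), e,
      Measure.prod_prod, walkLaw, Measure.infinitePi_pi _ fun _ _ => ht _]
    rw [hprod]
    by_cases h0 : 0 ∈ s
    · rw [← Finset.mul_prod_erase _ _ h0, ← Finset.mul_prod_erase _ _ h0]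
      simp only [h0, forall_const, Set.ofPred_mem_eq, if_true, one_mul]
      congr 1
      exact Finset.prod_congr rfl fun n hn => if_neg (Finset.ne_of_mem_erase hn)
    · simp only [h0, false_imp_iff, Set.ofPred_true, measure_univ, one_mul]
      exact Finset.prod_congr rfl fun n hn => if_neg (by rintro rfl; exact h0 hn)
  · intro n _ hn
    cases n with
    | zero => rfl
    | succ n => exact absurd ⟨n, rfl⟩ hn

/-- Product over the first times of the factor `s` for each time spent on the nonpositive
half-line by the walk from `y` in the orientation `ε`. -/
noncomputable def discount (s : ℝ) (ε y : ℤ) (m : ℕ) (ξ : ℕ → ℤ) : ℝ :=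
  ∏ n ∈ Finset.range m, if y + ε * walk ξ n ≤ 0 then s else 1

/-- Mean of the discount: solution of the first-step recursion. -/
noncomputable def discountMean (s q₁ q₂ : ℝ) : ℕ → ℤ → ℝ
  | 0, _ => 1
  | m + 1, y => (if y ≤ 0 then s else 1) *
      (q₁ * discountMean s q₁ q₂ m (y + 1) + q₂ * discountMean s q₁ q₂ m (y - 1))

lemma measurable_discount (s : ℝ) (ε y : ℤ) (m : ℕ) : Measurable (discount s ε y m) := by
  unfold discount
  refine Finset.measurable_prod _ fun n _ => ?_
  have hw : Measurable fun ξ : ℕ → ℤ => walk ξ n :=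
    Finset.measurable_sum _ fun i _ => measurable_pi_apply i
  exact (measurable_from_top (f := fun z : ℤ => if y + ε * z ≤ 0 then s else 1)).comp hw

lemma discount_nonneg {s : ℝ} (hs : 0 ≤ s) (ε y : ℤ) (m : ℕ) (ξ : ℕ → ℤ) :
    0 ≤ discount s ε y m ξ :=
  Finset.prod_nonneg fun n _ => by split_ifs <;> linarith

lemma discount_le_one {s : ℝ} (hs : 0 ≤ s) (hs1 : s ≤ 1) (ε y : ℤ) (m : ℕ) (ξ : ℕ → ℤ) :
    discount s ε y m ξ ≤ 1 :=
  Finset.prod_le_one (fun n _ => by split_ifs <;> linarith) fun n _ => by split_ifs <;> linarith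

lemma discount_consSeq (s : ℝ) (ε y : ℤ) (m : ℕ) (z : ℤ) (ξ : ℕ → ℤ) :
    discount s ε y (m + 1) (consSeq (z, ξ)) =
      (if y ≤ 0 then s else 1) * discount s ε (y + ε * z) m ξ := by
  unfold discount
  rw [Finset.prod_range_succ', mul_comm]
  congr 1
  · simp [walk]
  · refine Finset.prod_congr rfl fun n _ => ?_
    have : walk (consSeq (z, ξ)) (n + 1) = z + walk ξ n := by
      unfold walk
      rw [Finset.sum_range_succ', add_comm]
      rfl
    rw [this, mul_add, add_assoc]

lemma lintegral_toMeasure (hp : NearestNeighbour p) (f : ℤ → ℝ≥0∞) :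
    ∫⁻ z, f z ∂p.toMeasure = p 1 * f 1 + p (-1) * f (-1) := by
  rw [lintegral_countable']
  simp only [PMF.toMeasure_apply_singleton _ _ (measurableSet_singleton _)]
  rw [tsum_eq_sum (s := {1, -1}), Finset.sum_pair (by norm_num), mul_comm, mul_comm (f _)]
  intro z hz
  rw [hp z, mul_zero]
  intro h1
  have : z = 1 ∨ z = -1 := eq_or_eq_neg_of_abs_eq h1
  simp at hz; tauto

lemma discountMean_nonneg {s q₁ q₂ : ℝ} (hs : 0 ≤ s) (h₁ : 0 ≤ q₁) (h₂ : 0 ≤ q₂) (m : ℕ) (y : ℤ) :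
    0 ≤ discountMean s q₁ q₂ m y := by
  induction m generalizing y with
  | zero => exact zero_le_one
  | succ m ih =>
    have := ih (y + 1)
    have := ih (y - 1)
    simp only [discountMean]
    split_ifs <;> positivity

lemma lintegral_discount (hp : NearestNeighbour p) {s : ℝ} (hs : 0 ≤ s) {ε : ℤ}
    (hε : ε = 1 ∨ ε = -1) (m : ℕ) (y : ℤ) :
    ∫⁻ ξ, ENNReal.ofReal (discount s ε y m ξ) ∂(walkLaw p) =
      ENNReal.ofReal (discountMean s (p ε).toReal (p (-ε)).toReal m y) := by
  induction m generalizing y with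
  | zero => simp [discount, discountMean]
  | succ m ih =>
    have hnn := fun y => discountMean_nonneg hs (p ε).toReal_nonneg (p (-ε)).toReal_nonneg m y
    have hc : (0 : ℝ) ≤ if y ≤ 0 then s else 1 := by split_ifs <;> linarith
    have hm : ∀ y m, Measurable fun ξ => ENNReal.ofReal (discount s ε y m ξ) := fun y m =>
      (measurable_discount s ε y m).ennreal_ofReal
    have hof : ∀ z, p z = ENNReal.ofReal (p z).toReal := fun z =>
      (ENNReal.ofReal_toReal (p.apply_ne_top z)).symm
    rw [← (measurePreserving_consSeq p).lintegral_comp (hm y (m + 1)),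
      lintegral_prod (fun a => ENNReal.ofReal (discount s ε y (m + 1) (consSeq a)))
        ((hm y (m + 1)).comp measurable_consSeq).aemeasurable]
    simp only [discount_consSeq, ENNReal.ofReal_mul hc]
    simp only [lintegral_const_mul _ (hm _ _), ih]
    rw [lintegral_toMeasure hp]
    -- For `ε = -1` the two jump directions exchange their roles.
    have e : p 1 * (ENNReal.ofReal (if y ≤ 0 then s else 1) *
          ENNReal.ofReal (discountMean s (p ε).toReal (p (-ε)).toReal m (y + ε * 1))) +
        p (-1) * (ENNReal.ofReal (if y ≤ 0 then s else 1) *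
          ENNReal.ofReal (discountMean s (p ε).toReal (p (-ε)).toReal m (y + ε * -1))) =
        p ε * (ENNReal.ofReal (if y ≤ 0 then s else 1) *
          ENNReal.ofReal (discountMean s (p ε).toReal (p (-ε)).toReal m (y + 1))) +
        p (-ε) * (ENNReal.ofReal (if y ≤ 0 then s else 1) *
          ENNReal.ofReal (discountMean s (p ε).toReal (p (-ε)).toReal m (y - 1))) := by
      rcases hε with rfl | rfl
      · simp [sub_eq_add_neg]
      · simp only [neg_mul, one_mul, neg_neg, mul_one, ← sub_eq_add_neg]
        rw [add_comm]
    rw [e, hof ε, hof (-ε)]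
    simp only [ENNReal.toReal_ofReal ENNReal.toReal_nonneg]
    rw [← ENNReal.ofReal_mul hc, ← ENNReal.ofReal_mul hc,
      ← ENNReal.ofReal_mul (by positivity), ← ENNReal.ofReal_mul (by positivity),
      ← ENNReal.ofReal_add (mul_nonneg (by positivity) (mul_nonneg hc (hnn _)))
        (mul_nonneg (by positivity) (mul_nonneg hc (hnn _)))]
    congr 1
    simp only [discountMean]
    ring

lemma integrable_discount {s : ℝ} (hs : 0 ≤ s) (hs1 : s ≤ 1) (ε y : ℤ) (m : ℕ) :
    Integrable (discount s ε y m) (walkLaw p) := by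
  refine Integrable.of_bound (measurable_discount s ε y m).aestronglyMeasurable 1
    (Eventually.of_forall fun ξ => ?_)
  rw [Real.norm_of_nonneg (discount_nonneg hs ε y m ξ)]
  exact discount_le_one hs hs1 ε y m ξ

lemma integral_discount (hp : NearestNeighbour p) {s : ℝ} (hs : 0 ≤ s) (hs1 : s ≤ 1) {ε : ℤ}
    (hε : ε = 1 ∨ ε = -1) (m : ℕ) (y : ℤ) :
    ∫ ξ, discount s ε y m ξ ∂(walkLaw p) =
      discountMean s (p ε).toReal (p (-ε)).toReal m y := by
  have h1 := ofReal_integral_eq_lintegral_ofReal (integrable_discount (p := p) hs hs1 ε y m)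
    (Eventually.of_forall (discount_nonneg hs ε y m))
  rw [lintegral_discount hp hs hε] at h1
  exact (ENNReal.ofReal_eq_ofReal_iff (integral_nonneg (discount_nonneg hs ε y m))
    (discountMean_nonneg hs ENNReal.toReal_nonneg ENNReal.toReal_nonneg m y)).1 h1

lemma discountMean_antitone {s q₁ q₂ : ℝ} (hs : 0 ≤ s) (hs1 : s ≤ 1) (h₁ : 0 ≤ q₁) (h₂ : 0 ≤ q₂)
    (hq : q₁ + q₂ = 1) (y : ℤ) : Antitone fun m => discountMean s q₁ q₂ m y := by
  refine antitone_nat_of_succ_le fun m => ?_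
  induction m generalizing y with
  | zero =>
    simp only [discountMean, mul_one, hq]
    split_ifs <;> linarith
  | succ m ih =>
    have hc : (0 : ℝ) ≤ if y ≤ 0 then s else 1 := by split_ifs <;> linarith
    have e1 := ih (y + 1)
    have e2 := ih (y - 1)
    rw [discountMean, discountMean.eq_def s q₁ q₂ (m + 1) y]
    simp only
    gcongr

/-- Limit of the mean discount subtracted from one: the probability that the carried particle
falls asleep behind its starting point. -/
noncomputable def failProb (s q₁ q₂ : ℝ) (y : ℤ) : ℝ := 1 - ⨅ m, discountMean s q₁ q₂ m y

lemma tendsto_discountMean {s q₁ q₂ : ℝ} (hs : 0 ≤ s) (hs1 : s ≤ 1) (h₁ : 0 ≤ q₁) (h₂ : 0 ≤ q₂)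
    (hq : q₁ + q₂ = 1) (y : ℤ) :
    Tendsto (fun m => discountMean s q₁ q₂ m y) atTop (𝓝 (1 - failProb s q₁ q₂ y)) := by
  rw [failProb, sub_sub_cancel]
  exact tendsto_atTop_ciInf (discountMean_antitone hs hs1 h₁ h₂ hq y)
    ⟨0, by rintro _ ⟨m, rfl⟩; exact discountMean_nonneg hs h₁ h₂ m y⟩

lemma failProb_rec {s q₁ q₂ : ℝ} (hs : 0 ≤ s) (hs1 : s ≤ 1) (h₁ : 0 ≤ q₁) (h₂ : 0 ≤ q₂)
    (hq : q₁ + q₂ = 1) (y : ℤ) :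
    1 - failProb s q₁ q₂ y = (if y ≤ 0 then s else 1) *
      (q₁ * (1 - failProb s q₁ q₂ (y + 1)) + q₂ * (1 - failProb s q₁ q₂ (y - 1))) :=
  tendsto_nhds_unique ((tendsto_discountMean hs hs1 h₁ h₂ hq y).comp (tendsto_add_atTop_nat 1))
    ((((tendsto_discountMean hs hs1 h₁ h₂ hq (y + 1)).const_mul q₁).add
      ((tendsto_discountMean hs hs1 h₁ h₂ hq (y - 1)).const_mul q₂)).const_mul _)

lemma failProb_nonneg {s q₁ q₂ : ℝ} (hs : 0 ≤ s) (hs1 : s ≤ 1) (h₁ : 0 ≤ q₁) (h₂ : 0 ≤ q₂)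
    (hq : q₁ + q₂ = 1) (y : ℤ) : 0 ≤ failProb s q₁ q₂ y := by
  have := (discountMean_antitone hs hs1 h₁ h₂ hq y).le_of_tendsto
    (tendsto_discountMean hs hs1 h₁ h₂ hq y) 0
  simp only [discountMean] at this
  linarith

lemma failProb_le_one {s q₁ q₂ : ℝ} (hs : 0 ≤ s) (hs1 : s ≤ 1) (h₁ : 0 ≤ q₁) (h₂ : 0 ≤ q₂)
    (hq : q₁ + q₂ = 1) (y : ℤ) : failProb s q₁ q₂ y ≤ 1 := by
  have := ge_of_tendsto' (tendsto_discountMean hs hs1 h₁ h₂ hq y)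
    fun m => discountMean_nonneg hs h₁ h₂ m y
  linarith

/-- The first-step equation gives equality in both inequalities. At positions `≤ 0` the next
instruction is a jump with probability `1 / (1 + lam)` and otherwise a failure; at positive
positions sleep is ignored. -/
lemma failureBound_failProb (hp : NearestNeighbour p) (lam : ℝ≥0) :
    FailureBound p lam (failProb (1 / (1 + lam)) (p 1).toReal (p (-1)).toReal) := by
  have hs : (0 : ℝ) ≤ 1 / (1 + lam) := by positivity
  have h2 := rate_add_rate lam
  have h3 : (0 : ℝ) ≤ lam / (1 + lam) := by positivity
  have hs1 : (1 : ℝ) / (1 + lam) ≤ 1 := by linarith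
  have h1 := toReal_add_toReal hp
  have hrec := failProb_rec hs hs1 ENNReal.toReal_nonneg ENNReal.toReal_nonneg h1
  have e3 : (lam : ℝ) / (1 + lam) = 1 - 1 / (1 + lam) := by linarith
  have e4 : (p (-1)).toReal = 1 - (p 1).toReal := by linarith
  refine ⟨failProb_nonneg hs hs1 ENNReal.toReal_nonneg ENNReal.toReal_nonneg h1,
    fun y hy => ?_, fun y hy => ?_⟩
  · have := hrec y
    rw [if_pos hy] at this
    generalize failProb _ _ _ y = a at *
    generalize failProb _ _ _ (y + 1) = b at *
    generalize failProb _ _ _ (y - 1) = c at *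
    rw [e3]
    rw [e4] at this ⊢
    linarith
  · have := hrec y
    rw [if_neg (by omega)] at this
    generalize failProb _ _ _ y = a at *
    generalize failProb _ _ _ (y + 1) = b at *
    generalize failProb _ _ _ (y - 1) = c at *
    rw [e4] at this ⊢
    linarith

end ARW

namespace ARW

/-! ### The time spent against the drift -/

variable {p : PMF ℤ}

lemma ae_abs_le_one (hp : NearestNeighbour p) : ∀ᵐ z ∂p.toMeasure, |z| ≤ 1 := by
  rw [ae_iff, ← lintegral_indicator_one (by trivial), lintegral_toMeasure hp]
  simp

lemma integrable_increment (hp : NearestNeighbour p) :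
    Integrable (fun z : ℤ => (z : ℝ)) p.toMeasure := by
  refine Integrable.of_bound measurable_from_top.aestronglyMeasurable 1 ?_
  filter_upwards [ae_abs_le_one hp] with z hz
  rw [Real.norm_eq_abs]
  exact_mod_cast hz

lemma drift_eq (hp : NearestNeighbour p) : drift p = (p 1).toReal - (p (-1)).toReal := by
  unfold drift
  rw [tsum_eq_sum (s := {1, -1}), Finset.sum_pair (by norm_num)]
  · push_cast; ring
  · intro z hz
    rw [hp z]
    · simp
    · intro h1
      have : z = 1 ∨ z = -1 := eq_or_eq_neg_of_abs_eq h1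
      simp at hz; tauto

lemma ae_tendsto_walk (hp : NearestNeighbour p) :
    ∀ᵐ ξ ∂(walkLaw p), Tendsto (fun n : ℕ => (walk ξ n : ℝ) / n) atTop (𝓝 (drift p)) := by
  have hev : ∀ i : ℕ, MeasurePreserving (fun ξ : ℕ → ℤ => ξ i) (walkLaw p) p.toMeasure := fun i =>
    measurePreserving_eval_infinitePi (fun _ : ℕ => p.toMeasure) i
  have hm : Measurable fun z : ℤ => (z : ℝ) := measurable_from_top
  have hmean : ∫ ξ, ((ξ 0 : ℤ) : ℝ) ∂(walkLaw p) = drift p := by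
    rw [drift, ← integral_map (f := fun z : ℤ => (z : ℝ)) (hev 0).aemeasurable
      hm.aestronglyMeasurable, (hev 0).map_eq, PMF.integral_eq_tsum _ _ (integrable_increment hp)]
    rfl
  have h := strong_law_ae_real (μ := walkLaw p) (fun i ξ => ((ξ i : ℤ) : ℝ))
    ((hev 0).integrable_comp_of_integrable (integrable_increment hp))
    (fun i j hij => (iIndepFun_infinitePi (P := fun _ : ℕ => p.toMeasure)
      (X := fun _ z => (z : ℝ)) fun _ => hm).indepFun hij)
    (fun i => by
      have h1 : ∀ j : ℕ, Measure.map (fun ξ : ℕ → ℤ => ((ξ j : ℤ) : ℝ)) (walkLaw p) =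
          p.toMeasure.map fun z : ℤ => (z : ℝ) := fun j => by
        rw [← (hev j).map_eq, Measure.map_map hm (hev j).measurable]
        rfl
      exact ⟨(hm.comp (hev i).measurable).aemeasurable, (hm.comp (hev 0).measurable).aemeasurable,
        by rw [h1, h1]⟩)
  rw [hmean] at h
  filter_upwards [h] with ξ hξ
  refine hξ.congr fun n => ?_
  unfold walk
  push_cast
  rfl

/-- By the strong law the walk divided by `n` tends to the nonzero drift, so it is eventually on the
side of the drift. -/
lemma ae_timeSpent_ne_top (hp : NearestNeighbour p) (hb : drift p ≠ 0) :
    ∀ᵐ ξ ∂(walkLaw p), timeSpent p ξ ≠ ⊤ := by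
  filter_upwards [ae_tendsto_walk hp] with ξ hξ
  have h1 : ∀ᶠ n : ℕ in atTop, 0 < drift p * ((walk ξ n : ℝ) / n) :=
    (hξ.const_mul (drift p)).eventually_const_lt (mul_self_pos.2 hb)
  obtain ⟨N, hN⟩ := eventually_atTop.1 h1
  unfold timeSpent
  rw [Set.encard_ne_top_iff]
  refine (Set.finite_lt_nat N).subset fun n hn => ?_
  by_contra hlt
  have h2 := hN n (not_lt.1 hlt)
  rw [← mul_div_assoc] at h2
  have : drift p * (walk ξ n : ℝ) / n ≤ 0 := div_nonpos_of_nonpos_of_nonneg hn (Nat.cast_nonneg n)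
  linarith

open Classical in
/-- The random variable `s ^ T`. -/
noncomputable def timeWeight (p : PMF ℤ) (s : ℝ) (ξ : ℕ → ℤ) : ℝ :=
  if timeSpent p ξ = ⊤ then 0 else s ^ (timeSpent p ξ).toNat

lemma F_eq (p : PMF ℤ) (lam : ℝ≥0) :
    F p lam = ∫ ξ, timeWeight p (1 / (1 + (lam : ℝ))) ξ ∂(walkLaw p) := rfl

lemma timeWeight_nonneg {s : ℝ} (hs : 0 ≤ s) (ξ : ℕ → ℤ) : 0 ≤ timeWeight p s ξ := by
  unfold timeWeight; split_ifs <;> positivity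

lemma timeWeight_le_one {s : ℝ} (hs : 0 ≤ s) (hs1 : s ≤ 1) (ξ : ℕ → ℤ) :
    timeWeight p s ξ ≤ 1 := by
  unfold timeWeight
  split_ifs
  · exact zero_le_one
  · exact pow_le_one₀ hs hs1

/-- Orientation of the drift. -/
def IsOrientation (p : PMF ℤ) (ε : ℤ) : Prop := (ε = 1 ∨ ε = -1) ∧ 0 < ε * drift p

lemma exists_isOrientation (hb : drift p ≠ 0) : ∃ ε, IsOrientation p ε := by
  rcases hb.lt_or_gt with h | h
  · exact ⟨-1, Or.inr rfl, by push_cast; linarith⟩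
  · exact ⟨1, Or.inl rfl, by push_cast; linarith⟩

lemma IsOrientation.mem_iff {ε : ℤ} (hε : IsOrientation p ε) (ξ : ℕ → ℤ) (n : ℕ) :
    drift p * (walk ξ n : ℝ) ≤ 0 ↔ 0 + ε * walk ξ n ≤ 0 := by
  obtain ⟨h1, h2⟩ := hε
  rw [zero_add]
  rcases h1 with rfl | rfl
  · rw [one_mul]
    have : 0 < drift p := by simpa using h2
    rw [← Int.cast_nonpos (R := ℝ)]
    constructor
    · exact fun h => nonpos_of_mul_nonpos_right h this
    · exact fun h => mul_nonpos_of_nonneg_of_nonpos this.le h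
  · have : drift p < 0 := by simpa using h2
    rw [neg_one_mul, neg_nonpos, ← Int.cast_nonneg_iff (R := ℝ)]
    constructor
    · exact fun h => nonneg_of_mul_nonpos_right h this
    · exact fun h => mul_nonpos_of_nonpos_of_nonneg this.le h

lemma discount_eq_pow (s : ℝ) (ε : ℤ) (m : ℕ) (ξ : ℕ → ℤ) :
    discount s ε 0 m ξ =
      s ^ ((Finset.range m).filter fun n => 0 + ε * walk ξ n ≤ 0).card := by
  unfold discount
  rw [Finset.prod_ite, Finset.prod_const, Finset.prod_const_one, mul_one]

lemma timeWeight_le_discount {s : ℝ} (hs : 0 ≤ s) (hs1 : s ≤ 1) {ε : ℤ}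
    (hε : IsOrientation p ε) (m : ℕ) (ξ : ℕ → ℤ) : timeWeight p s ξ ≤ discount s ε 0 m ξ := by
  unfold timeWeight
  split_ifs with h
  · exact discount_nonneg hs _ _ _ _
  · rw [discount_eq_pow s ε]
    refine pow_le_pow_of_le_one hs hs1 ?_
    rw [← ENat.natCast_le_natCast, ENat.natCast_toNat h, ← Set.encard_coe_eq_coe_finsetCard]
    refine Set.encard_le_encard fun n hn => ?_
    simp only [Finset.coe_filter, Set.mem_ofPred_eq] at hn
    exact (hε.mem_iff ξ n).2 hn.2

lemma tendsto_discount_timeWeight (s : ℝ) {ε : ℤ} (hε : IsOrientation p ε) {ξ : ℕ → ℤ}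
    (h : timeSpent p ξ ≠ ⊤) :
    Tendsto (fun m => discount s ε 0 m ξ) atTop (𝓝 (timeWeight p s ξ)) := by
  have hfin : {n : ℕ | drift p * (walk ξ n : ℝ) ≤ 0}.Finite := Set.encard_ne_top_iff.1 h
  obtain ⟨N, hN⟩ := hfin.bddAbove
  refine tendsto_const_nhds.congr' ?_
  filter_upwards [eventually_gt_atTop N] with m hm
  rw [timeWeight, if_neg h, discount_eq_pow s ε]
  congr 1
  rw [← ENat.natCast_inj, ENat.natCast_toNat h, ← Set.encard_coe_eq_coe_finsetCard, timeSpent]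
  congr 1
  ext n
  simp only [Finset.coe_filter, Set.mem_ofPred_eq, Finset.mem_range]
  rw [hε.mem_iff ξ n]
  exact ⟨fun hn => ⟨(hN ((hε.mem_iff ξ n).2 hn)).trans_lt hm, hn⟩, fun hn => hn.2⟩

/-- Obtained as an almost everywhere limit of the finite products, which avoids a direct study of
the cardinality defining `T`. -/
lemma aestronglyMeasurable_timeWeight (hp : NearestNeighbour p) (hb : drift p ≠ 0) (s : ℝ) :
    AEStronglyMeasurable (timeWeight p s) (walkLaw p) := by
  obtain ⟨ε, hε⟩ := exists_isOrientation hb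
  refine aestronglyMeasurable_of_tendsto_ae atTop
    (fun m => (measurable_discount s ε 0 m).aestronglyMeasurable) ?_
  filter_upwards [ae_timeSpent_ne_top hp hb] with ξ hξ
  exact tendsto_discount_timeWeight s hε hξ

lemma inv_rate_mem (lam : ℝ≥0) : 0 < 1 / (1 + (lam : ℝ)) ∧ 1 / (1 + (lam : ℝ)) ≤ 1 := by
  have h2 := rate_add_rate lam
  have h3 : (0 : ℝ) ≤ lam / (1 + lam) := by positivity
  exact ⟨by positivity, by linarith⟩

lemma F_pos (hp : NearestNeighbour p) (hb : drift p ≠ 0) (lam : ℝ≥0) : 0 < F p lam := by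
  obtain ⟨hs, hs1⟩ := inv_rate_mem lam
  set s := 1 / (1 + (lam : ℝ)) with hsdef
  have hint : Integrable (timeWeight p s) (walkLaw p) := by
    refine Integrable.of_bound (aestronglyMeasurable_timeWeight hp hb s) 1
      (Eventually.of_forall fun ξ => ?_)
    rw [Real.norm_of_nonneg (timeWeight_nonneg hs.le ξ)]
    exact timeWeight_le_one hs.le hs1 ξ
  rw [F_eq, integral_pos_iff_support_of_nonneg_ae
    (Eventually.of_forall (timeWeight_nonneg hs.le)) hint]
  have : (Set.univ : Set (ℕ → ℤ)) ≤ᵐ[walkLaw p] Function.support (timeWeight p s) := by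
    filter_upwards [ae_timeSpent_ne_top hp hb] with ξ hξ _
    change timeWeight p s ξ ≠ 0
    rw [timeWeight, if_neg hξ]
    positivity
  have := measure_mono_ae this
  rw [measure_univ] at this
  exact zero_lt_one.trans_le this

/-- Truncating the count of visits can only increase the power, as the base is at most one. Only
this inequality is needed to compare `failProb` at `0` with `1 - F`. -/
lemma F_le_discountMean (hp : NearestNeighbour p) {ε : ℤ} (hε : IsOrientation p ε) (lam : ℝ≥0)
    (m : ℕ) : F p lam ≤ discountMean (1 / (1 + lam)) (p ε).toReal (p (-ε)).toReal m 0 := by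
  obtain ⟨hs, hs1⟩ := inv_rate_mem lam
  rw [F_eq, ← integral_discount hp hs.le hs1 hε.1]
  exact integral_mono_of_nonneg (Eventually.of_forall (timeWeight_nonneg hs.le))
    (integrable_discount hs.le hs1 ε 0 m)
    (Eventually.of_forall (timeWeight_le_discount hs.le hs1 hε m))

/-- For almost every path `T` is finite, so the integrand tends to `1` and is dominated by `1`. -/
lemma tendsto_F (hp : NearestNeighbour p) (hb : drift p ≠ 0) :
    Tendsto (F p) (𝓝[>] 0) (𝓝 1) := by
  have h1 : ∫ _ξ : ℕ → ℤ, (1 : ℝ) ∂(walkLaw p) = 1 := by simp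
  rw [← h1]
  refine tendsto_integral_filter_of_dominated_convergence (fun _ => 1)
    (Eventually.of_forall fun lam => aestronglyMeasurable_timeWeight hp hb _)
    (Eventually.of_forall fun lam => Eventually.of_forall fun ξ => ?_) (integrable_const _) ?_
  · obtain ⟨hs, hs1⟩ := inv_rate_mem lam
    change ‖timeWeight p _ ξ‖ ≤ 1
    rw [Real.norm_of_nonneg (timeWeight_nonneg hs.le ξ)]
    exact timeWeight_le_one hs.le hs1 ξ
  · filter_upwards [ae_timeSpent_ne_top hp hb] with ξ hξ
    have hc : Continuous fun lam : ℝ≥0 => (1 / (1 + (lam : ℝ))) ^ (timeSpent p ξ).toNat := by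
      refine Continuous.pow (Continuous.div continuous_const (by fun_prop) fun lam => ?_) _
      positivity
    have := (hc.tendsto 0).mono_left (nhdsWithin_le_nhds (s := Set.Ioi 0))
    simp only [NNReal.coe_zero, add_zero, div_one, one_pow] at this
    refine this.congr fun lam => ?_
    rw [if_neg hξ]

/-! ### Absence of fixation -/

/-- The orientation `ε` turns the drift to the right, and the mean discount of the reflected walk
from `0` decreases to `1 - h 0`, which is thus at least `F`. -/
lemma exists_failureBound (hp : NearestNeighbour p) (hb : drift p ≠ 0) (lam : ℝ≥0) :
    ∃ ε : ℤ, (ε = 1 ∨ ε = -1) ∧ (p (-ε)).toReal < (p ε).toReal ∧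
      ∃ h, FailureBound (p.map (ε * ·)) lam h ∧ h 0 ≤ 1 ∧ h 0 ≤ 1 - F p lam := by
  obtain ⟨ε, hε⟩ := exists_isOrientation hb
  obtain ⟨hs, hs1⟩ := inv_rate_mem lam
  have hε' : ε * ε = 1 := by rcases hε.1 with rfl | rfl <;> rfl
  have hp' := hp.map_mul hε.1
  have h1 := toReal_add_toReal hp'
  have e1 : p.map (ε * ·) 1 = p ε := by rw [map_mul_apply hε', mul_one]
  have e2 : p.map (ε * ·) (-1) = p (-ε) := by rw [map_mul_apply hε', mul_neg_one]
  refine ⟨ε, hε.1, ?_, _, failureBound_failProb hp' lam, ?_, ?_⟩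
  · have h2 := hε.2
    rw [drift_eq hp] at h2
    rcases hε.1 with rfl | rfl
    · push_cast at h2; linarith
    · push_cast at h2; rw [neg_neg]; linarith
  · exact failProb_le_one hs.le hs1 ENNReal.toReal_nonneg ENNReal.toReal_nonneg h1 0
  · have := ge_of_tendsto' (tendsto_discountMean hs.le hs1 ENNReal.toReal_nonneg
      ENNReal.toReal_nonneg h1 0) fun m => by
        rw [e1, e2]; exact F_le_discountMean hp hε lam m
    linarith

lemma ae_not_fixates (hp : NearestNeighbour p) (hb : drift p ≠ 0) {lam mu : ℝ≥0}
    (hmu : 1 - F p lam < mu) : ∀ᵐ ω ∂(law p lam mu), ¬ Fixates lam ω := by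
  obtain ⟨ε, hε, hd, h, hh, h1, h2⟩ := exists_failureBound hp hb lam
  filter_upwards [ae_unstable hp hε hd hh h1 (h2.trans_lt hmu), ae_regular hp,
    ae_generic, ae_frequently_jump hp] with ω hun ⟨K, hreg⟩ hgen hjump
  exact hreg.not_fixates hgen hjump hun lam

lemma criticalDensity_le (hp : NearestNeighbour p) (hb : drift p ≠ 0) (lam : ℝ≥0) :
    criticalDensity p lam ≤ ENNReal.ofReal (1 - F p lam) := by
  refine iSup₂_le fun mu hfix => ?_
  by_contra hlt
  have hmu : 1 - F p lam < mu := by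
    rw [not_le] at hlt
    by_contra h
    rw [not_lt] at h
    have := ENNReal.ofReal_le_ofReal h
    rw [ENNReal.ofReal_coe_nnreal] at this
    exact absurd hlt (not_lt.2 this)
  -- Almost sure fixation and almost sure non-fixation cannot both hold under a probability measure.
  obtain ⟨ω, h1, h2⟩ := (hfix.and (ae_not_fixates hp hb hmu)).exists
  exact h2 h1

end ARW

theorem mainTheorem4 (p : PMF ℤ) (hp : ARW.NearestNeighbour p) (hb : ARW.drift p ≠ 0) :
    (∀ lam : ℝ≥0,
      ARW.criticalDensity p lam ≤ ENNReal.ofReal (1 - ARW.F p lam) ∧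
      1 - ARW.F p lam < 1 ∧
      (∀ mu : ℝ≥0, 1 - ARW.F p lam < (mu : ℝ) →
        ∀ᵐ ω ∂(ARW.law p lam mu), ¬ ARW.Fixates lam ω)) ∧
    Tendsto (ARW.criticalDensity p) (𝓝[>] 0) (𝓝 0) := by
  refine ⟨fun lam => ⟨ARW.criticalDensity_le hp hb lam, ?_, fun mu => ARW.ae_not_fixates hp hb⟩, ?_⟩
  · linarith [ARW.F_pos hp hb lam]
  · have h := ENNReal.tendsto_ofReal ((ARW.tendsto_F hp hb).const_sub 1)
    rw [sub_self, ENNReal.ofReal_zero] at h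
    exact tendsto_of_tendsto_of_tendsto_of_le_of_le tendsto_const_nhds h (fun _ => zero_le)
      (ARW.criticalDensity_le hp hb)
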